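/- **Setting.** Let $d\ge 3$, $n_1,\dots,n_d\ge 1$, $N=n_3\cdots n_d$. Real tensors $X\in\mathbb R^{n_1\times\cdots\times n_d}$ carry the entrywise inner product and the Frobenius norm $\|\cdot\|_F$. For $i=(i_3,\dots,i_d)$ let $\bar X^{(i)}\in\mathbb C^{n_1\times n_2}$ be the $i$-th frontal slice of the discrete Fourier transform of $X$ along dimensions $3,\dots,d$, and let $\bar X$ be the block diagonal matrix with these $N$ blocks. $\sigma_j(\cdot)$ is the $j$-th largest singular value and $\#\sigma_1(M)$ the multiplicity of $\sigma_1(M)$ (with $\#\sigma_1(0)=0$). The tensor nuclear norm is $\|X\|_*=\frac1N\sum_i\sum_j\sigma_j(\bar X^{(i)})$, $B=\{X:\|X\|_*\le 1\}$, and $\Pi_B$ is the Euclidean projection onto $B$. The rank-$r$ truncated projection of $P$ onto $B$ takes a t-SVD of $P$ (real tensors $U,V$ with unitary Fourier slices, $\bar P^{(i)}=\bar U^{(i)}\mathrm{diag}(\sigma_j(\bar P^{(i)}))\bar V^{(i)\mathsf H}$ for all $i$), finds $\sigma\ge0$ with $\frac1N\sum_i\sum_{j\le r}\max\{0,\sigma_j(\bar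 P^{(i)})-\sigma\}=1$ (or $\sigma=0$ if the sum at $\sigma=0$ is at most $1$), and returns the tensor $Z$ with $\bar Z^{(i)}=\sum_{j\le r}\max\{0,\sigma_j(\bar P^{(i)})-\sigma\}\,\bar u^{(i)}_j\bar v_j^{(i)\mathsf H}$, where $\bar u_j^{(i)},\bar v_j^{(i)}$ are the columns of $\bar U^{(i)},\bar V^{(i)}$. **Assumptions.** Let $f(X)=g(\mathcal A(X))+\langle C,X\rangle$, where $g:\mathbb R^m\to\mathbb R$ is $\alpha$-strongly convex, $\alpha>0$, and $\mathcal A:\mathbb R^{n_1\times\cdots\times n_d}\to\mathbb R^m$ is linear, and let $f$ be $\beta$-smooth, $\beta>0$ (differentiable on the whole space with $\beta$-Lipschitz gradient with respect to $\|\cdot\|_F$). Let $X^*$ be the unique minimizer of $f$ over $B$, and let it satisfy strict complementarity: $\mathrm{rank}(\bar X^*)<N\min\{n_1,n_2\}$ and $\sigma_1(\bar G)-\sigma_{\mathrm{rank}(\bar X^*)+1}(\bar G)>0$, where $G=\nabla f(X^*)$. **Notation.** $\mu=\max_i\#\sigma_1(\bar G^{(i)})$, $\nu=\#\{i:\bar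 G^{(i)}\ne0\}$, $\delta(r)=\sigma_1(\bar G)-\max_i\sigma_{r+1}(\bar G^{(i)})$, and $$R_0(r)=\frac{1}{2\beta\sqrt N}\max\left\{\frac{\delta(r)}{1+\frac{\sqrt{\mu\nu}}{\#\sigma_1(\bar G)}},\ \frac{\delta(r-\mu+1)}{\frac1{\sqrt\mu}+\frac{\sqrt{\mu\nu}}{\#\sigma_1(\bar G)}}\right\}.$$ **Method.** Nesterov's restarted fast gradient method with parameter $K\in\mathbb N$ starts at $X_1\in B$ and for $t=1,2,\dots$ sets $X_{t,1}=Y_{t,1}=X_t$, $\theta_1=1$; for $s=1,\dots,K$: $X_{t,s+1}=\Pi_B[Y_{t,s}-\frac1\beta\nabla f(Y_{t,s})]$, $\theta_{s+1}=\frac{1+\sqrt{1+4\theta_s^2}}2$, $Y_{t,s+1}=X_{t,s+1}+\frac{\theta_s-1}{\theta_{s+1}}(X_{t,s+1}-X_{t,s})$; then $X_{t+1}=X_{t,K+1}$. **Theorem.** There is a constant $\gamma$ with $0<\gamma\le 2e^2\beta$ such that $f(X)-f(X^*)\ge\gamma\|X-X^*\|_F^2$ for all $X\in B$. For every such $\gamma$,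 with $K=\lceil\sqrt{2\beta}\,e/\sqrt\gamma\rceil$, every integer $r$ with $\mu\le r<\min\{n_1,n_2\}$, and every $X_1\in B$ with $$\|X_1-X^*\|_F\le\frac{\sqrt2\min\{\gamma,\sqrt\gamma\}}{3\sqrt\beta}R_0(r),$$ replacing all projections $\Pi_B$ in the method by rank-$r$ truncated projections (with any choice of the t-SVDs) does not change the iterates $X_t,X_{t,s},Y_{t,s}$, and for all $t\ge1$ $$f(X_t)-f(X^*)\le\exp\left(-\frac{\sqrt{2\gamma}}{\sqrt\beta\,e}(t-1)\right)\big(f(X_1)-f(X^*)\big).$$ -/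

import Mathlib

open scoped InnerProductSpace Gradient

noncomputable section

namespace TNN

/-- Index set of the frontal slices of a tensor: the tuples `(i₃, …, i_d)`, where
`n 0, …, n (k-1)` are the dimensions `n₃, …, n_d` and `d = k + 2`. Indices start at `0`. -/
abbrev SliceIdx {k : ℕ} (n : Fin k → ℕ) : Type := (j : Fin k) → Fin (n j)

/-- Real tensors of size `n₁ × n₂ × n₃ × ⋯ × n_d`. The `EuclideanSpace` inner product and norm are
the tensor inner product and the Frobenius norm. -/
abbrev Tensor (n₁ n₂ : ℕ) {k : ℕ} (n : Fin k → ℕ) : Type :=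
  EuclideanSpace ℝ (Fin n₁ × Fin n₂ × SliceIdx n)

variable {n₁ n₂ k : ℕ} {n : Fin k → ℕ}

/-- `N = n₃ ⋯ n_d`, the number of frontal slices. -/
def numSlices (n : Fin k → ℕ) : ℕ := ∏ j, n j

/-- The frontal slice with index `i` of the discrete Fourier transform of `X` along all dimensions
but the first two. -/
def fslice (X : Tensor n₁ n₂ n) (i : SliceIdx n) : Matrix (Fin n₁) (Fin n₂) ℂ :=
  Matrix.of fun a b => ∑ l : SliceIdx n, (X (a, b, l) : ℂ) *
    ∏ j, Complex.exp (-(2 * Real.pi * Complex.I * ((i j : ℕ) : ℂ) * ((l j : ℕ) : ℂ)) / (n j : ℂ))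

/-- The block diagonal matrix whose diagonal blocks are the frontal slices of the Fourier transform
of `X`. -/
def bdiag (X : Tensor n₁ n₂ n) :
    Matrix (Fin n₁ × SliceIdx n) (Fin n₂ × SliceIdx n) ℂ :=
  Matrix.blockDiagonal (fslice X)

/-- `sval A j` is the `(j+1)`-st largest singular value of `A` (zero beyond the size of `A`). -/
def sval {p q : Type*} [Fintype p] [Fintype q] [DecidableEq q] (A : Matrix p q ℂ) (j : ℕ) : ℝ :=
  (Matrix.toEuclideanLin A).singularValues j

/-- Multiplicity of the largest singular value of `A`, with the convention that it is `0` for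
`A = 0`. -/
def topMult {p q : Type*} [Fintype p] [Fintype q] [DecidableEq q] (A : Matrix p q ℂ) : ℕ :=
  {j : ℕ | sval A j = sval A 0 ∧ sval A j ≠ 0}.ncard

/-- The tensor nuclear norm: the average over the frontal slices of the Fourier transform of the
sums of their singular values. -/
def tnn (X : Tensor n₁ n₂ n) : ℝ :=
  (1 / (numSlices n : ℝ)) *
    ∑ i : SliceIdx n, ∑ j ∈ Finset.range (min n₁ n₂), sval (fslice X i) j

/-- The unit ball of the tensor nuclear norm. -/
def ball (n₁ n₂ : ℕ) (n : Fin k → ℕ) : Set (Tensor n₁ n₂ n) := {X | tnn X ≤ 1}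

/-- `Z` is the Euclidean projection of `P` onto the unit ball of the tensor nuclear norm. -/
def IsProj (P Z : Tensor n₁ n₂ n) : Prop :=
  Z ∈ ball n₁ n₂ n ∧ ∀ W ∈ ball n₁ n₂ n, ‖P - Z‖ ≤ ‖P - W‖

/-- The `n₁ × n₂` matrix with diagonal entries `c 0, c 1, …`. -/
def rectDiag (n₁ n₂ : ℕ) (c : ℕ → ℝ) : Matrix (Fin n₁) (Fin n₂) ℂ :=
  Matrix.of fun a b => if (a : ℕ) = (b : ℕ) then (c a : ℂ) else 0

/-- `U`, `V` are the (real) orthogonal tensor factors of a t-SVD of `P`, expressed in the Fourier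
domain, where the t-product is the slice-wise matrix product: the slices of `U` and `V` are unitary
and give a singular value decomposition of each slice of `P`, singular values in decreasing
order. -/
def IsTSVD (P : Tensor n₁ n₂ n) (U : Tensor n₁ n₁ n) (V : Tensor n₂ n₂ n) : Prop :=
  ∀ i : SliceIdx n,
    fslice U i ∈ Matrix.unitaryGroup (Fin n₁) ℂ ∧
    fslice V i ∈ Matrix.unitaryGroup (Fin n₂) ℂ ∧
    fslice P i = fslice U i * rectDiag n₁ n₂ (sval (fslice P i)) * (fslice V i).conjTranspose

/-- `Z` is an output of the rank-`r` truncated projection of `P` onto the unit ball of the tensor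
nuclear norm: only the `r` leading singular triples of every Fourier slice of `P` (for some choice
of a t-SVD of `P`) are kept, and their singular values are soft-thresholded at a level `σ ≥ 0` for
which the thresholded values have average sum `1` (or at `σ = 0` if that sum is already at
most `1`). -/
def IsTruncProj (r : ℕ) (P Z : Tensor n₁ n₂ n) : Prop :=
  ∃ (U : Tensor n₁ n₁ n) (V : Tensor n₂ n₂ n) (σ : ℝ), IsTSVD P U V ∧ 0 ≤ σ ∧
    ((1 / (numSlices n : ℝ)) *
        ∑ i : SliceIdx n, ∑ j ∈ Finset.range r, max 0 (sval (fslice P i) j - σ) = 1 ∨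
      σ = 0 ∧ (1 / (numSlices n : ℝ)) *
        ∑ i : SliceIdx n, ∑ j ∈ Finset.range r, sval (fslice P i) j ≤ 1) ∧
    ∀ i : SliceIdx n, fslice Z i =
      fslice U i *
        rectDiag n₁ n₂ (fun j => if j < r then max 0 (sval (fslice P i) j - σ) else 0) *
        (fslice V i).conjTranspose

/-- `f` is `β`-smooth: differentiable with a `β`-Lipschitz gradient. -/
def IsSmooth (β : ℝ) (f : Tensor n₁ n₂ n → ℝ) : Prop :=
  Differentiable ℝ f ∧ ∀ X Y, ‖∇ f X - ∇ f Y‖ ≤ β * ‖X - Y‖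

/-- `Xs` is the unique minimizer of `f` over the unit ball of the tensor nuclear norm. -/
def IsUniqueMinimizer (f : Tensor n₁ n₂ n → ℝ) (Xs : Tensor n₁ n₂ n) : Prop :=
  Xs ∈ ball n₁ n₂ n ∧ ∀ X ∈ ball n₁ n₂ n, X ≠ Xs → f Xs < f X

/-- Strict complementarity of the optimal solution `Xs`. With `ρ` the average rank of `Xs`, so that
`ρ N = (bdiag Xs).rank`, it requires `ρ < min {n₁, n₂}` and
`σ₁ - σ_{ρN+1} > 0` for the block diagonal Fourier matrix of the gradient at `Xs`. -/
def StrictComplementarity (f : Tensor n₁ n₂ n → ℝ) (Xs : Tensor n₁ n₂ n) : Prop :=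
  (bdiag Xs).rank < min n₁ n₂ * numSlices n ∧
    0 < sval (bdiag (∇ f Xs)) 0 - sval (bdiag (∇ f Xs)) (bdiag Xs).rank

/-- Quadratic growth of `f` over the unit ball of the tensor nuclear norm, with constant `γ`. -/
def QuadraticGrowth (f : Tensor n₁ n₂ n → ℝ) (Xs : Tensor n₁ n₂ n) (γ : ℝ) : Prop :=
  ∀ X ∈ ball n₁ n₂ n, γ * ‖X - Xs‖ ^ 2 ≤ f X - f Xs

/-- The largest multiplicity of the top singular value among the Fourier slices of `G`. -/
def maxTopMult (G : Tensor n₁ n₂ n) : ℕ :=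
  Finset.univ.sup fun i : SliceIdx n => topMult (fslice G i)

/-- The number of nonzero diagonal blocks of `bdiag G`. -/
def nnzb (G : Tensor n₁ n₂ n) : ℕ := {i : SliceIdx n | fslice G i ≠ 0}.ncard

/-- The generalized complementarity measure `δ(r)` of an optimal solution with gradient `G`:
the largest singular value of `bdiag G` minus the largest `(r+1)`-st singular value among the
slices. -/
def genGap (G : Tensor n₁ n₂ n) (r : ℕ) : ℝ :=
  sval (bdiag G) 0 - ⨆ i : SliceIdx n, sval (fslice G i) r

/-- The radius `R₀(r)` for step size `1/β`, where `G` is the gradient at the optimal solution. -/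
def radius (β : ℝ) (G : Tensor n₁ n₂ n) (r : ℕ) : ℝ :=
  1 / (2 * β * √(numSlices n : ℝ)) *
    max
      (genGap G r /
        (1 + √((maxTopMult G : ℝ) * (nnzb G : ℝ)) / (topMult (bdiag G) : ℝ)))
      (genGap G (r - maxTopMult G + 1) /
        (1 / √(maxTopMult G : ℝ) +
          √((maxTopMult G : ℝ) * (nnzb G : ℝ)) / (topMult (bdiag G) : ℝ)))

/-- The sequence `θ₁ = 1`, `θ_{s+1} = (1 + √(1 + 4 θ_s²)) / 2` (the value at `0` is not used). -/
def theta : ℕ → ℝ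
  | 0 => 1
  | 1 => 1
  | s + 2 => (1 + √(1 + 4 * theta (s + 1) ^ 2)) / 2

/-- `X`, `x`, `y` are the outer iterates `X_t`, and the inner iterates `X_{t,s}`, `Y_{t,s}`, of
Nesterov's restarted fast gradient method with step size `1/β` and `K` inner steps, started at `X₁`,
where `proj P Z` says that `Z` may be returned as the projection of `P`. Only the values at `t ≥ 1`
and `1 ≤ s ≤ K + 1` are constrained. -/
structure IsRestartedFGM (proj : Tensor n₁ n₂ n → Tensor n₁ n₂ n → Prop)
    (f : Tensor n₁ n₂ n → ℝ) (β : ℝ) (K : ℕ) (X₁ : Tensor n₁ n₂ n)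
    (X : ℕ → Tensor n₁ n₂ n) (x y : ℕ → ℕ → Tensor n₁ n₂ n) : Prop where
  init : X 1 = X₁
  restart_x : ∀ t, 1 ≤ t → x t 1 = X t
  restart_y : ∀ t, 1 ≤ t → y t 1 = X t
  step : ∀ t, 1 ≤ t → ∀ s, 1 ≤ s → s ≤ K →
    proj (y t s - (1 / β) • ∇ f (y t s)) (x t (s + 1))
  momentum : ∀ t, 1 ≤ t → ∀ s, 1 ≤ s → s ≤ K →
    y t (s + 1) =
      x t (s + 1) + ((theta s - 1) / theta (s + 1)) • (x t (s + 1) - x t s)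
  next : ∀ t, 1 ≤ t → X (t + 1) = x t (K + 1)

end TNN

end

/-
Write `G = ∇ f X*` and `σ = σ₁(Ḡ)`. Optimality of `X*` says that `Q = -G / σ` certifies `X*`: the
Fourier slices of `Q` are contractions and `⟪Q, X*⟫ = 1 = ‖X*‖_*`, so every slice of `Q` is
isometric on the row space of the corresponding slice of `X*`. Strict complementarity makes these
row spaces exhaust the directions in which `Q` is isometric, so `X*` lies in the relative interior
of the face of `B` exposed by `Q`. Testing `X ∈ B` against functionals `Q + t W` that stay in the
dual ball up to `O(t²)` bounds the squared norm of the part of `X - X*` orthogonal to the span of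
this face by a multiple of `⟪Q, X* - X⟫`. A direction in the span that is annihilated by both `𝒜`
and `Q` would produce a second minimizer. Since `f X - f X*` dominates both `⟪G, X - X*⟫` and
`‖𝒜 (X - X*)‖²`, up to constants, it grows quadratically.

The point `X* - G / β = X* + (σ / β) Q` projects onto `X*`, and its singular values are
`σ_j(X̄*) + σ / β` on the row space of `X*`, while those of index above `r` are at most
`(σ - δ(r)) / β` in every slice. For `P` within `2 R₀(r)` of this point, Weyl's inequality gives a
level above all `σ_{r+1}(P̄⁽ⁱ⁾)` at which the thresholded singular values still have average sum
at least `1`. The exact threshold therefore exceeds every singular value that the truncation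
drops. The second term of the maximum in `R₀(r)` spreads the perturbation over `μ` singular
values: the `μ`-th singular value of a perturbation `D` is at most `‖D‖_F / √μ`.

One epoch of the fast gradient method gives `f X_{t+1} - f X* ≤ 2 β ‖X_t - X*‖² / (K + 1)²`. With
quadratic growth this contracts the error by `e⁻²` and keeps every extrapolated point within
`2 R₀(r)` of `X*`. The gradient step is nonexpansive, so all points that are projected lie within
`2 R₀(r)` of `X* - G / β`, where exact and truncated projections agree.
-/

noncomputable section

namespace TNN

open Module

variable {n₁ n₂ k : ℕ} {n : Fin k → ℕ}

section SingularValues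

variable {𝕜 : Type*} [RCLike 𝕜]
  {E : Type*} [NormedAddCommGroup E] [InnerProductSpace 𝕜 E]
  {F : Type*} [NormedAddCommGroup F] [InnerProductSpace 𝕜 F]

/-- `b` is an orthonormal basis of right singular vectors of `T`, with singular values `|c j|` in
any order. -/
def IsRightSVBasis (T : E →ₗ[𝕜] F) (c : ℕ → ℝ) {q : ℕ} (b : OrthonormalBasis (Fin q) 𝕜 E) : Prop :=
  ∀ i j : Fin q, ⟪T (b i), T (b j)⟫_𝕜 = if i = j then ((c j : ℝ) : 𝕜) ^ 2 else 0

namespace IsRightSVBasis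

variable {T : E →ₗ[𝕜] F} {c : ℕ → ℝ} {q : ℕ} {b : OrthonormalBasis (Fin q) 𝕜 E}

theorem norm_apply (h : IsRightSVBasis T c b) (j : Fin q) : ‖T (b j)‖ = |c j| := by
  have hsq : ((‖T (b j)‖ : ℝ) : 𝕜) ^ 2 = ((c j : ℝ) : 𝕜) ^ 2 := by
    rw [← inner_self_eq_norm_sq_to_K, h j j, if_pos rfl]
  rw [← abs_norm]
  exact (sq_eq_sq_iff_abs_eq_abs _ _).1 (mod_cast hsq)

theorem norm_sq_apply (h : IsRightSVBasis T c b) (x : E) :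
    ‖T x‖ ^ 2 = ∑ j : Fin q, c j ^ 2 * ‖⟪b j, x⟫_𝕜‖ ^ 2 := by
  have hx : T x = ∑ j, ⟪b j, x⟫_𝕜 • T (b j) := by
    conv_lhs => rw [← b.sum_repr' x]
    simp only [map_sum, map_smul]
  have key : ((‖T x‖ : ℝ) : 𝕜) ^ 2 = ∑ j : Fin q, ((c j : ℝ) : 𝕜) ^ 2 * (‖⟪b j, x⟫_𝕜‖ : 𝕜) ^ 2 := by
    rw [← inner_self_eq_norm_sq_to_K, hx, sum_inner]
    refine Finset.sum_congr rfl fun i _ => ?_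
    simp only [inner_sum, inner_smul_left, inner_smul_right, h i, mul_ite, mul_zero,
      Finset.sum_ite_eq, Finset.mem_univ, if_true]
    rw [← mul_assoc, RCLike.mul_conj, mul_comm]
  exact_mod_cast key

theorem mem_ker_orthogonal (hb : IsRightSVBasis T c b) {j : Fin q} (hj : c j ≠ 0) :
    b j ∈ T.kerᗮ := by
  rw [Submodule.mem_orthogonal]
  intro x hx
  have hsum := hb.norm_sq_apply x
  rw [LinearMap.mem_ker.1 hx, norm_zero, zero_pow two_ne_zero, eq_comm,
    Finset.sum_eq_zero_iff_of_nonneg (fun _ _ => by positivity)] at hsum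
  have hinner := (mul_eq_zero_iff_left (pow_ne_zero 2 hj)).1 (hsum j (Finset.mem_univ j))
  rw [← inner_conj_symm, norm_eq_zero.1 (pow_eq_zero_iff two_ne_zero |>.1 hinner), map_zero]

theorem ker_orthogonal_le_span (hb : IsRightSVBasis T c b) :
    T.kerᗮ ≤ Submodule.span 𝕜 (b '' {j | c j ≠ 0}) := by
  intro x hx
  rw [← b.sum_repr' x]
  refine Submodule.sum_mem _ fun j _ => ?_
  by_cases hj : c j = 0
  · have hker : b j ∈ T.ker := by
      rw [LinearMap.mem_ker, ← norm_eq_zero, hb.norm_apply j, hj, abs_zero]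
    rw [(Submodule.mem_orthogonal _ _).1 hx _ hker, zero_smul]
    exact Submodule.zero_mem _
  · exact Submodule.smul_mem _ _ (Submodule.subset_span ⟨j, hj, rfl⟩)

theorem exists_submodule_le_norm_apply (h : IsRightSVBasis T c b) {j : ℕ} (hj : j < q)
    (hc0 : 0 ≤ c j) (hc : ∀ i ≤ j, c j ≤ c i) :
    ∃ S : Submodule 𝕜 E, finrank 𝕜 S = j + 1 ∧ ∀ x ∈ S, c j * ‖x‖ ≤ ‖T x‖ := by
  let v : Fin (j + 1) → E := fun i => b ⟨i, by omega⟩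
  have hv : Orthonormal 𝕜 v := b.orthonormal.comp (fun i : Fin (j + 1) => (⟨i, by omega⟩ : Fin q))
    fun x y hxy => Fin.ext (Fin.mk.inj hxy)
  refine ⟨Submodule.span 𝕜 (Set.range v), ?_, fun x hx => ?_⟩
  · rw [finrank_span_eq_card hv.linearIndependent, Fintype.card_fin]
  have hz : ∀ i : Fin q, j < i → ⟪b i, x⟫_𝕜 = 0 := fun i hi => by
    have hle : Submodule.span 𝕜 (Set.range v) ≤ (𝕜 ∙ b i)ᗮ := by
      rw [Submodule.span_le]
      rintro _ ⟨l, rfl⟩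
      exact Submodule.mem_orthogonal_singleton_iff_inner_right.2
        (b.orthonormal.2 (Fin.ne_of_gt (Fin.lt_def.2 (by simp only; omega))))
    exact Submodule.mem_orthogonal_singleton_iff_inner_right.1 (hle hx)
  refine le_of_sq_le_sq ?_ (norm_nonneg _)
  rw [h.norm_sq_apply, mul_pow, ← b.sum_sq_norm_inner_right x, Finset.mul_sum]
  refine Finset.sum_le_sum fun i _ => ?_
  by_cases hi : j < i
  · simp [hz i hi]
  · gcongr
    exact hc i (by omega)

theorem exists_submodule_norm_apply_le (h : IsRightSVBasis T c b) (j : ℕ)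
    {d : ℝ} (hd : 0 ≤ d) (hc : ∀ i < q, j ≤ i → |c i| ≤ d) :
    ∃ R : Submodule 𝕜 E, finrank 𝕜 E ≤ finrank 𝕜 R + j ∧ ∀ x ∈ R, ‖T x‖ ≤ d * ‖x‖ := by
  have := b.toBasis.finiteDimensional_of_finite
  let L : E →ₗ[𝕜] (Fin (min j q) → 𝕜) :=
    LinearMap.pi fun i => (innerSL 𝕜 (b ⟨i, by omega⟩)).toLinearMap
  refine ⟨LinearMap.ker L, ?_, fun x hx => ?_⟩
  · have hsum := LinearMap.finrank_range_add_finrank_ker L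
    have hrange := Submodule.finrank_le (LinearMap.range L)
    rw [Module.finrank_fin_fun] at hrange
    omega
  have hz : ∀ i : Fin q, (i : ℕ) < j → ⟪b i, x⟫_𝕜 = 0 := fun i hi =>
    congrFun (LinearMap.mem_ker.1 hx) ⟨i, by omega⟩
  refine le_of_sq_le_sq ?_ (by positivity)
  rw [h.norm_sq_apply, mul_pow, ← b.sum_sq_norm_inner_right x, Finset.mul_sum]
  refine Finset.sum_le_sum fun i _ => ?_
  by_cases hi : (i : ℕ) < j
  · simp [hz i hi]
  · exact mul_le_mul_of_nonneg_right (sq_le_sq.2 ((hc i i.2 (by omega)).trans (le_abs_self d)))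
      (sq_nonneg _)

end IsRightSVBasis

theorem le_of_norm_apply_bounds_on_submodules [FiniteDimensional 𝕜 E] {T : E →ₗ[𝕜] F} {c d : ℝ}
    {S R : Submodule 𝕜 E} (hdim : finrank 𝕜 E < finrank 𝕜 S + finrank 𝕜 R)
    (hS : ∀ x ∈ S, c * ‖x‖ ≤ ‖T x‖) (hR : ∀ x ∈ R, ‖T x‖ ≤ d * ‖x‖) : c ≤ d := by
  obtain ⟨x, ⟨hxS, hxR⟩, hx0⟩ : ∃ x ∈ S ⊓ R, x ≠ 0 :=
    Submodule.exists_mem_ne_zero_of_ne_bot fun hbot =>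
      hdim.not_ge (Submodule.finrank_add_finrank_le_of_disjoint (disjoint_iff.2 hbot))
  exact le_of_mul_le_mul_right ((hS x hxS).trans (hR x hxR)) (norm_pos_iff.2 hx0)

variable [FiniteDimensional 𝕜 E] [FiniteDimensional 𝕜 F]

theorem exists_isRightSVBasis (T : E →ₗ[𝕜] F) {q : ℕ} (hq : finrank 𝕜 E = q) :
    ∃ b : OrthonormalBasis (Fin q) 𝕜 E, IsRightSVBasis T T.singularValues b := by
  refine ⟨T.isSymmetric_adjoint_comp_self.eigenvectorBasis hq, fun i j => ?_⟩
  rw [← LinearMap.adjoint_inner_right, ← LinearMap.comp_apply,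
    T.isSymmetric_adjoint_comp_self.apply_eigenvectorBasis hq j, inner_smul_right,
    OrthonormalBasis.inner_eq_ite, ← T.sq_singularValues_fin hq j]
  split_ifs <;> simp

theorem exists_submodule_singularValues_mul_le (T : E →ₗ[𝕜] F) {j : ℕ} (hj : j < finrank 𝕜 E) :
    ∃ S : Submodule 𝕜 E, finrank 𝕜 S = j + 1 ∧ ∀ x ∈ S, T.singularValues j * ‖x‖ ≤ ‖T x‖ := by
  obtain ⟨b, hb⟩ := exists_isRightSVBasis T rfl
  exact hb.exists_submodule_le_norm_apply hj (T.singularValues_nonneg j)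
    fun i hi => T.singularValues_antitone hi

theorem exists_submodule_le_singularValues_mul (T : E →ₗ[𝕜] F) (j : ℕ) :
    ∃ R : Submodule 𝕜 E, finrank 𝕜 E ≤ finrank 𝕜 R + j ∧
      ∀ x ∈ R, ‖T x‖ ≤ T.singularValues j * ‖x‖ := by
  obtain ⟨b, hb⟩ := exists_isRightSVBasis T rfl
  refine hb.exists_submodule_norm_apply_le j (T.singularValues_nonneg j) fun i _ hi => ?_
  rw [abs_of_nonneg (T.singularValues_nonneg i)]
  exact T.singularValues_antitone hi

theorem norm_apply_le_singularValues_zero_mul (T : E →ₗ[𝕜] F) (x : E) :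
    ‖T x‖ ≤ T.singularValues 0 * ‖x‖ := by
  obtain ⟨R, hR, h⟩ := exists_submodule_le_singularValues_mul T 0
  have hRtop : R = ⊤ := Submodule.eq_top_of_finrank_eq (R.finrank_le.antisymm hR)
  exact h x (hRtop ▸ Submodule.mem_top)

theorem le_singularValues (T : E →ₗ[𝕜] F) {c : ℝ} {j : ℕ} (S : Submodule 𝕜 E)
    (hj : j < finrank 𝕜 S) (hS : ∀ x ∈ S, c * ‖x‖ ≤ ‖T x‖) : c ≤ T.singularValues j := by
  obtain ⟨R, hR, h⟩ := exists_submodule_le_singularValues_mul T j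
  exact le_of_norm_apply_bounds_on_submodules (by omega) hS h

theorem singularValues_le (T : E →ₗ[𝕜] F) {d : ℝ} (hd : 0 ≤ d) {j : ℕ} (R : Submodule 𝕜 E)
    (hj : finrank 𝕜 E ≤ finrank 𝕜 R + j) (hR : ∀ x ∈ R, ‖T x‖ ≤ d * ‖x‖) :
    T.singularValues j ≤ d := by
  by_cases hjE : j < finrank 𝕜 E
  · obtain ⟨S, hS, h⟩ := exists_submodule_singularValues_mul_le T hjE
    exact le_of_norm_apply_bounds_on_submodules (by omega) h hR
  · rwa [T.singularValues_of_finrank_le (not_lt.1 hjE)]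

theorem singularValues_smul_le (c : 𝕜) (T : E →ₗ[𝕜] F) (j : ℕ) :
    (c • T).singularValues j ≤ ‖c‖ * T.singularValues j := by
  obtain ⟨R, hR, h⟩ := exists_submodule_le_singularValues_mul T j
  refine singularValues_le _ (mul_nonneg (norm_nonneg _) (T.singularValues_nonneg j)) R hR
    fun x hx => ?_
  rw [LinearMap.smul_apply, norm_smul, mul_assoc]
  exact mul_le_mul_of_nonneg_left (h x hx) (norm_nonneg c)

theorem singularValues_add_le (S T : E →ₗ[𝕜] F) (i j : ℕ) :
    (S + T).singularValues (i + j) ≤ S.singularValues i + T.singularValues j := by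
  obtain ⟨R₁, hR₁, h₁⟩ := exists_submodule_le_singularValues_mul S i
  obtain ⟨R₂, hR₂, h₂⟩ := exists_submodule_le_singularValues_mul T j
  refine singularValues_le _ (add_nonneg (S.singularValues_nonneg i) (T.singularValues_nonneg j))
    (R₁ ⊓ R₂) ?_ fun x hx => ?_
  · have hdim := Submodule.finrank_sup_add_finrank_inf_eq R₁ R₂
    have hsup := Submodule.finrank_le (R₁ ⊔ R₂)
    omega
  · rw [LinearMap.add_apply, add_mul]
    exact (norm_add_le _ _).trans (add_le_add (h₁ x hx.1) (h₂ x hx.2))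

theorem IsRightSVBasis.singularValues_eq {T : E →ₗ[𝕜] F} {c : ℕ → ℝ} {q : ℕ}
    {b : OrthonormalBasis (Fin q) 𝕜 E} (h : IsRightSVBasis T c b) (hc0 : ∀ j, 0 ≤ c j)
    (hc : ∀ i j, i ≤ j → j < q → c j ≤ c i) {j : ℕ} (hj : j < q) : T.singularValues j = c j := by
  apply le_antisymm
  · obtain ⟨R, hR, hbd⟩ := h.exists_submodule_norm_apply_le j (hc0 j) fun i hi hij => by
      rw [abs_of_nonneg (hc0 i)]; exact hc j i hij hi
    exact singularValues_le T (hc0 j) R hR hbd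
  · obtain ⟨S, hS, hbd⟩ := h.exists_submodule_le_norm_apply hj (hc0 j) fun i hi => hc i j hi hj
    exact le_singularValues T S (hS ▸ Nat.lt_succ_self j) hbd

/-- The real part of the Frobenius inner product of linear maps. -/
def frobInner (S T : E →ₗ[𝕜] F) : ℝ := RCLike.re (LinearMap.trace 𝕜 E (S.adjoint ∘ₗ T))

theorem frobInner_eq_sum {ι : Type*} [Fintype ι] (S T : E →ₗ[𝕜] F) (b : OrthonormalBasis ι 𝕜 E) :
    frobInner S T = ∑ j, RCLike.re ⟪S (b j), T (b j)⟫_𝕜 := by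
  rw [frobInner, LinearMap.trace_eq_sum_inner _ b, map_sum]
  simp [LinearMap.adjoint_inner_right]

theorem frobInner_self_eq_sum {ι : Type*} [Fintype ι] (T : E →ₗ[𝕜] F)
    (b : OrthonormalBasis ι 𝕜 E) : frobInner T T = ∑ j, ‖T (b j)‖ ^ 2 := by
  rw [frobInner_eq_sum T T b]
  simp

theorem frobInner_self_nonneg (T : E →ₗ[𝕜] F) : 0 ≤ frobInner T T := by
  rw [frobInner_self_eq_sum T (stdOrthonormalBasis 𝕜 E)]
  positivity

theorem frobInner_self_eq_sum_sq_singularValues (T : E →ₗ[𝕜] F) :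
    frobInner T T = ∑ i ∈ Finset.range (finrank 𝕜 E), T.singularValues i ^ 2 := by
  obtain ⟨b, hb⟩ := exists_isRightSVBasis T rfl
  rw [frobInner_self_eq_sum T b, ← Fin.sum_univ_eq_sum_range fun i => T.singularValues i ^ 2]
  exact Finset.sum_congr rfl fun i _ => by rw [hb.norm_apply, sq_abs]

theorem sqrt_succ_mul_singularValues_le (T : E →ₗ[𝕜] F) (j : ℕ) :
    √((j : ℝ) + 1) * T.singularValues j ≤ √(frobInner T T) := by
  by_cases hj : j < finrank 𝕜 E
  · apply Real.le_sqrt_of_sq_le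
    rw [mul_pow, Real.sq_sqrt (by positivity), frobInner_self_eq_sum_sq_singularValues]
    calc ((j : ℝ) + 1) * T.singularValues j ^ 2
        = ∑ _i ∈ Finset.range (j + 1), T.singularValues j ^ 2 := by simp
      _ ≤ ∑ i ∈ Finset.range (j + 1), T.singularValues i ^ 2 :=
          Finset.sum_le_sum fun _ hi => pow_le_pow_left₀ (T.singularValues_nonneg j)
            (T.singularValues_antitone (Finset.mem_range_succ_iff.1 hi)) 2
      _ ≤ _ := Finset.sum_le_sum_of_subset_of_nonneg
          (Finset.range_subset_range.2 hj) fun _ _ _ => sq_nonneg _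
  · rw [T.singularValues_of_finrank_le (not_lt.1 hj), mul_zero]
    exact Real.sqrt_nonneg _

theorem norm_apply_le_sqrt_frobInner_mul (T : E →ₗ[𝕜] F) (x : E) :
    ‖T x‖ ≤ √(frobInner T T) * ‖x‖ := by
  refine (norm_apply_le_singularValues_zero_mul T x).trans ?_
  gcongr
  simpa using sqrt_succ_mul_singularValues_le T 0

end SingularValues

section Fourier

/-- The kernel of the discrete Fourier transform. -/
def dftKernel (i l : SliceIdx n) : ℂ :=
  ∏ j, Complex.exp (-(2 * Real.pi * Complex.I * ((i j : ℕ) : ℂ) * ((l j : ℕ) : ℂ)) / (n j : ℂ))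

theorem fslice_apply (X : Tensor n₁ n₂ n) (i : SliceIdx n) (a : Fin n₁) (b : Fin n₂) :
    fslice X i a b = ∑ l, (X (a, b, l) : ℂ) * dftKernel i l := rfl

theorem exp_neg_div_eq_inv_pow (m a b : ℕ) :
    Complex.exp (-(2 * Real.pi * Complex.I * (a : ℂ) * (b : ℂ)) / (m : ℂ)) =
      (Complex.exp (2 * Real.pi * Complex.I / m) ^ (a * b))⁻¹ := by
  rw [← Complex.exp_nat_mul, ← Complex.exp_neg]
  congr 1
  push_cast
  ring

theorem dftKernel_eq_prod_inv_pow (i l : SliceIdx n) :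
    dftKernel i l =
      ∏ j, (Complex.exp (2 * Real.pi * Complex.I / n j) ^ ((i j : ℕ) * (l j : ℕ)))⁻¹ :=
  Finset.prod_congr rfl fun _ _ => exp_neg_div_eq_inv_pow _ _ _

theorem conj_exp_two_pi_I_div (m : ℕ) :
    starRingEnd ℂ (Complex.exp (2 * Real.pi * Complex.I / m)) =
      (Complex.exp (2 * Real.pi * Complex.I / m))⁻¹ := by
  rw [← Complex.exp_conj, ← Complex.exp_neg]
  congr 1
  simp [map_ofNat, neg_div]

theorem conj_dftKernel (i l : SliceIdx n) :
    starRingEnd ℂ (dftKernel i l) =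
      ∏ j, Complex.exp (2 * Real.pi * Complex.I / n j) ^ ((i j : ℕ) * (l j : ℕ)) := by
  simp only [dftKernel_eq_prod_inv_pow, map_prod, map_inv₀, map_pow, conj_exp_two_pi_I_div,
    inv_pow, inv_inv]

theorem dftKernel_comm (i l : SliceIdx n) : dftKernel i l = dftKernel l i := by
  simp only [dftKernel_eq_prod_inv_pow, mul_comm]

variable [∀ j, NeZero (n j)]

theorem dftKernel_neg_left (i l : SliceIdx n) :
    dftKernel (-i) l = starRingEnd ℂ (dftKernel i l) := by
  rw [conj_dftKernel, dftKernel_eq_prod_inv_pow]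
  refine Finset.prod_congr rfl fun j _ => inv_eq_of_mul_eq_one_left ?_
  have hdvd : n j ∣ (i j : ℕ) + ((-i) j : ℕ) := by
    rw [Nat.dvd_iff_mod_eq_zero, ← Fin.val_add]
    simp
  rw [← pow_add, ← add_mul, pow_mul,
    ((Complex.isPrimitiveRoot_exp (n j) (NeZero.ne _)).pow_eq_one_iff_dvd _).2 hdvd, one_pow]

theorem sum_inv_pow_mul_pow_of_isPrimitiveRoot {K : Type*} [Field K] {m : ℕ} {ζ : K}
    (hζ : IsPrimitiveRoot ζ m) (a b : Fin m) :
    ∑ x : Fin m, (ζ ^ ((x : ℕ) * (a : ℕ)))⁻¹ * ζ ^ ((x : ℕ) * (b : ℕ)) =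
      if a = b then (m : K) else 0 := by
  have hζ0 : ζ ≠ 0 := hζ.ne_zero (Fin.pos a).ne'
  have hterm (x : Fin m) :
      (ζ ^ ((x : ℕ) * (a : ℕ)))⁻¹ * ζ ^ ((x : ℕ) * (b : ℕ)) =
        (ζ ^ (b : ℕ) / ζ ^ (a : ℕ)) ^ (x : ℕ) := by
    rw [mul_comm (x : ℕ), mul_comm (x : ℕ), pow_mul, pow_mul, div_pow, div_eq_inv_mul]
  simp only [hterm, Fin.sum_univ_eq_sum_range fun x => (ζ ^ (b : ℕ) / ζ ^ (a : ℕ)) ^ x]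
  split_ifs with hab
  · simp [hab, div_self (pow_ne_zero _ hζ0)]
  · have hne : ζ ^ (b : ℕ) / ζ ^ (a : ℕ) ≠ 1 := fun h =>
      hab (Fin.ext (hζ.pow_inj a.2 b.2 (eq_of_div_eq_one h).symm))
    rw [geom_sum_eq hne, div_pow, ← pow_mul, ← pow_mul, mul_comm, pow_mul, mul_comm, pow_mul,
      hζ.pow_eq_one, one_pow, one_pow, div_one, sub_self, zero_div]

theorem sum_dftKernel_mul_conj (l l' : SliceIdx n) :
    ∑ i, dftKernel i l * starRingEnd ℂ (dftKernel i l') =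
      if l = l' then (numSlices n : ℂ) else 0 := by
  simp only [conj_dftKernel]
  simp only [dftKernel_eq_prod_inv_pow, ← Finset.prod_mul_distrib]
  rw [← Fintype.prod_sum fun j (x : Fin (n j)) =>
    (Complex.exp (2 * Real.pi * Complex.I / n j) ^ ((x : ℕ) * (l j : ℕ)))⁻¹ *
      Complex.exp (2 * Real.pi * Complex.I / n j) ^ ((x : ℕ) * (l' j : ℕ))]
  simp only [sum_inv_pow_mul_pow_of_isPrimitiveRoot
    (Complex.isPrimitiveRoot_exp _ (NeZero.ne _))]
  split_ifs with h
  · simp [h, numSlices]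
  · obtain ⟨j, hj⟩ := Function.ne_iff.1 h
    exact Finset.prod_eq_zero (Finset.mem_univ j) (if_neg hj)

theorem numSlices_pos : 0 < numSlices n := Finset.prod_pos fun j _ => NeZero.pos (n j)

theorem fslice_neg_idx (X : Tensor n₁ n₂ n) (i : SliceIdx n) :
    fslice X (-i) = (fslice X i).map (starRingEnd ℂ) := by
  ext a b
  simp [fslice_apply, dftKernel_neg_left]

/-- The real part of the inverse discrete Fourier transform of a family of slices. For a family
with `F (-i) = conj (F i)` the inverse transform is already real. -/
def realInvDFT (F : SliceIdx n → Matrix (Fin n₁) (Fin n₂) ℂ) : Tensor n₁ n₂ n :=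
  WithLp.toLp 2 fun p => 1 / (numSlices n : ℝ) *
    (∑ i, F i p.1 p.2.1 * starRingEnd ℂ (dftKernel i p.2.2)).re

theorem realInvDFT_fslice (X : Tensor n₁ n₂ n) : realInvDFT (fslice X) = X := by
  have hN : (numSlices n : ℝ) ≠ 0 := Nat.cast_ne_zero.2 numSlices_pos.ne'
  ext ⟨a, b, l⟩
  have hinv : ∑ i, fslice X i a b * starRingEnd ℂ (dftKernel i l) =
      ((numSlices n * X (a, b, l) : ℝ) : ℂ) := by
    simp only [fslice_apply, Finset.sum_mul]
    rw [Finset.sum_comm]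
    simp only [mul_assoc, ← Finset.mul_sum, sum_dftKernel_mul_conj]
    simp [mul_comm]
  simp only [realInvDFT, hinv, Complex.ofReal_re]
  field_simp

theorem coe_realInvDFT_apply {F : SliceIdx n → Matrix (Fin n₁) (Fin n₂) ℂ}
    (hF : ∀ i, F (-i) = (F i).map (starRingEnd ℂ)) (a : Fin n₁) (b : Fin n₂) (l : SliceIdx n) :
    ((realInvDFT F (a, b, l) : ℝ) : ℂ) =
      1 / (numSlices n : ℂ) * ∑ i, F i a b * starRingEnd ℂ (dftKernel i l) := by
  simp only [realInvDFT]
  push_cast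
  congr 1
  refine Complex.conj_eq_iff_re.1 ?_
  rw [map_sum, ← Equiv.sum_comp (Equiv.neg _)]
  refine Finset.sum_congr rfl fun i _ => ?_
  simp [hF, dftKernel_neg_left]

theorem fslice_realInvDFT {F : SliceIdx n → Matrix (Fin n₁) (Fin n₂) ℂ}
    (hF : ∀ i, F (-i) = (F i).map (starRingEnd ℂ)) : fslice (realInvDFT F) = F := by
  have hN : (numSlices n : ℂ) ≠ 0 := Nat.cast_ne_zero.2 numSlices_pos.ne'
  have horth (i i' : SliceIdx n) : ∑ l, starRingEnd ℂ (dftKernel i' l) * dftKernel i l =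
      if i = i' then (numSlices n : ℂ) else 0 := by
    simp only [← sum_dftKernel_mul_conj i i', dftKernel_comm _ i, dftKernel_comm _ i', mul_comm]
  ext i a b
  simp only [fslice_apply, coe_realInvDFT_apply hF, mul_assoc, Finset.sum_mul, ← Finset.mul_sum]
  rw [Finset.sum_comm]
  simp only [← Finset.mul_sum, horth, mul_ite, mul_zero, Finset.sum_ite_eq, Finset.mem_univ,
    if_true]
  field_simp

end Fourier

section Slices

theorem fslice_smul (c : ℝ) (X : Tensor n₁ n₂ n) (i : SliceIdx n) :
    fslice (c • X) i = (c : ℂ) • fslice X i := by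
  ext a b
  simp [fslice_apply, mul_assoc, Finset.mul_sum]

/-- The `i`-th frontal slice of the Fourier transform, as a linear map of Euclidean spaces
depending real-linearly on the tensor. -/
def slice (i : SliceIdx n) :
    Tensor n₁ n₂ n →ₗ[ℝ] EuclideanSpace ℂ (Fin n₂) →ₗ[ℂ] EuclideanSpace ℂ (Fin n₁) where
  toFun X := Matrix.toEuclideanLin (fslice X i)
  map_add' X Y := by
    rw [← map_add]
    congr 1
    ext a b
    simp [fslice_apply, add_mul, Finset.sum_add_distrib]
  map_smul' c X := by
    rw [fslice_smul, map_smul, RingHom.id_apply, Complex.coe_smul]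

theorem slice_apply (X : Tensor n₁ n₂ n) (i : SliceIdx n) :
    slice i X = Matrix.toEuclideanLin (fslice X i) := rfl

theorem sval_fslice (X : Tensor n₁ n₂ n) (i : SliceIdx n) (j : ℕ) :
    sval (fslice X i) j = (slice i X).singularValues j := rfl

theorem frobInner_toEuclideanLin {p q : Type*} [Fintype p] [Fintype q] [DecidableEq q]
    (A B : Matrix p q ℂ) :
    frobInner (Matrix.toEuclideanLin A) (Matrix.toEuclideanLin B) =
      ∑ b, ∑ a, (starRingEnd ℂ (A a b) * B a b).re := by
  rw [frobInner_eq_sum _ _ (EuclideanSpace.basisFun q ℂ)]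
  simp [Matrix.toLpLin_apply, PiLp.inner_apply, mul_comm]

theorem inner_realInvDFT (W : Tensor n₁ n₂ n) (F : SliceIdx n → Matrix (Fin n₁) (Fin n₂) ℂ) :
    ⟪W, realInvDFT F⟫_ℝ =
      1 / (numSlices n : ℝ) * ∑ i, frobInner (slice i W) (Matrix.toEuclideanLin (F i)) := by
  have hentry (a : Fin n₁) (b : Fin n₂) : ∑ l, ⟪W (a, b, l), realInvDFT F (a, b, l)⟫_ℝ =
      1 / (numSlices n : ℝ) * ∑ i, (starRingEnd ℂ (fslice W i a b) * F i a b).re := by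
    simp only [realInvDFT, fslice_apply, Complex.re_sum, map_sum, map_mul, Complex.conj_ofReal,
      Finset.sum_mul, Finset.mul_sum, RCLike.inner_apply, conj_trivial]
    rw [Finset.sum_comm]
    refine Finset.sum_congr rfl fun i _ => Finset.sum_congr rfl fun l _ => ?_
    rw [mul_assoc (W (a, b, l) : ℂ), Complex.re_ofReal_mul, mul_comm (F i a b)]
    ring
  simp only [PiLp.inner_apply, Fintype.sum_prod_type, hentry, ← Finset.mul_sum, slice_apply,
    frobInner_toEuclideanLin]
  congr 1
  rw [Finset.sum_congr rfl fun a _ => Finset.sum_comm, Finset.sum_comm]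
  exact Finset.sum_congr rfl fun i _ => Finset.sum_comm

theorem inner_eq_sum_frobInner [∀ j, NeZero (n j)] (X Y : Tensor n₁ n₂ n) :
    ⟪X, Y⟫_ℝ = 1 / (numSlices n : ℝ) * ∑ i, frobInner (slice i X) (slice i Y) := by
  conv_lhs => rw [← realInvDFT_fslice Y]
  exact inner_realInvDFT X (fslice Y)

theorem sum_frobInner_self [∀ j, NeZero (n j)] (W : Tensor n₁ n₂ n) :
    ∑ i, frobInner (slice i W) (slice i W) = numSlices n * ‖W‖ ^ 2 := by
  have hN : (numSlices n : ℝ) ≠ 0 := Nat.cast_ne_zero.2 numSlices_pos.ne'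
  rw [← real_inner_self_eq_norm_sq, inner_eq_sum_frobInner]
  field_simp

end Slices

section MatrixSVD

variable {𝕜 : Type*} [RCLike 𝕜]

/-- The rectangular diagonal matrix over `𝕜` with diagonal entries `c 0, c 1, …`; over `ℂ` this is
`rectDiag`. Working over `𝕜` gives conjugation-invariant slices a real decomposition. -/
def diagRect (𝕜 : Type*) [RCLike 𝕜] (n₁ n₂ : ℕ) (c : ℕ → ℝ) : Matrix (Fin n₁) (Fin n₂) 𝕜 :=
  Matrix.of fun a b => if (a : ℕ) = (b : ℕ) then (c a : 𝕜) else 0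

/-- `T` is diagonal with entries `c` with respect to the orthonormal bases `u` and `v`. -/
def IsDiagIn (T : EuclideanSpace 𝕜 (Fin n₂) →ₗ[𝕜] EuclideanSpace 𝕜 (Fin n₁)) (c : ℕ → ℝ)
    (u : OrthonormalBasis (Fin n₁) 𝕜 (EuclideanSpace 𝕜 (Fin n₁)))
    (v : OrthonormalBasis (Fin n₂) 𝕜 (EuclideanSpace 𝕜 (Fin n₂))) : Prop :=
  ∀ j : Fin n₂, T (v j) = if h : (j : ℕ) < n₁ then ((c j : ℝ) : 𝕜) • u ⟨j, h⟩ else 0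

theorem singularValues_eq_zero_of_le
    (T : EuclideanSpace 𝕜 (Fin n₂) →ₗ[𝕜] EuclideanSpace 𝕜 (Fin n₁)) {j : ℕ} (hj : min n₁ n₂ ≤ j) :
    T.singularValues j = 0 := by
  rw [T.singularValues_eq_zero_iff_le_finrank_range]
  refine le_trans (le_min ?_ ?_) hj
  · simpa using Submodule.finrank_le (LinearMap.range T)
  · simpa using LinearMap.finrank_range_le T

namespace IsDiagIn

variable {T : EuclideanSpace 𝕜 (Fin n₂) →ₗ[𝕜] EuclideanSpace 𝕜 (Fin n₁)} {c : ℕ → ℝ}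
  {u : OrthonormalBasis (Fin n₁) 𝕜 (EuclideanSpace 𝕜 (Fin n₁))}
  {v : OrthonormalBasis (Fin n₂) 𝕜 (EuclideanSpace 𝕜 (Fin n₂))}

theorem isRightSVBasis (h : IsDiagIn T c u v) :
    IsRightSVBasis T (fun j => if j < n₁ then c j else 0) v := by
  intro i j
  rw [h i, h j]
  by_cases hi : (i : ℕ) < n₁ <;> by_cases hj : (j : ℕ) < n₁
  · simp only [hi, hj, dif_pos, inner_smul_left, inner_smul_right, OrthonormalBasis.inner_eq_ite,
      if_pos, RCLike.conj_ofReal, Fin.ext_iff]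
    split_ifs with hij
    · rw [hij]; ring
    · simp
  · have : i ≠ j := by rintro rfl; exact hj hi
    simp [hj, this]
  · have : i ≠ j := by rintro rfl; exact hi hj
    simp [hi, this]
  · simp [hi, hj]

theorem singularValues_eq (h : IsDiagIn T c u v) (hc0 : ∀ j, 0 ≤ c j) (hc : Antitone c) {j : ℕ}
    (hj : j < min n₁ n₂) : T.singularValues j = c j := by
  rw [h.isRightSVBasis.singularValues_eq _ _ (lt_min_iff.1 hj).2, if_pos (lt_min_iff.1 hj).1]
  · intro j
    split_ifs
    exacts [hc0 j, le_rfl]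
  · intro i j hij _
    split_ifs
    exacts [hc hij, by omega, hc0 i, le_rfl]

end IsDiagIn

theorem orthonormal_inv_singularValues_smul {E F : Type*} [NormedAddCommGroup E]
    [InnerProductSpace 𝕜 E] [NormedAddCommGroup F] [InnerProductSpace 𝕜 F] {T : E →ₗ[𝕜] F}
    {c : ℕ → ℝ} {q : ℕ} {b : OrthonormalBasis (Fin q) 𝕜 E} (h : IsRightSVBasis T c b) :
    Orthonormal 𝕜 fun j : {j : Fin q // c j ≠ 0} => (((c j)⁻¹ : ℝ) : 𝕜) • T (b j) := by
  rw [orthonormal_iff_ite]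
  rintro ⟨i, hi⟩ ⟨j, hj⟩
  have hj' : (c j : 𝕜) ≠ 0 := mod_cast hj
  simp only [inner_smul_left, inner_smul_right, h i j, RCLike.conj_ofReal, Subtype.mk.injEq]
  split_ifs with hij
  · subst hij
    push_cast
    field_simp
  · simp

theorem exists_isDiagIn (T : EuclideanSpace 𝕜 (Fin n₂) →ₗ[𝕜] EuclideanSpace 𝕜 (Fin n₁)) :
    ∃ u v, IsDiagIn T T.singularValues u v := by
  obtain ⟨v, hv⟩ := exists_isRightSVBasis T (q := n₂) (by simp)
  set σ := T.singularValues
  have hlt {j : ℕ} (hj : σ j ≠ 0) : j < min n₁ n₂ :=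
    not_le.1 fun h => hj (singularValues_eq_zero_of_le T h)
  let e (a : {a : Fin n₁ | σ a ≠ 0}) : {j : Fin n₂ // σ j ≠ 0} :=
    ⟨⟨a.1, (lt_min_iff.1 (hlt a.2)).2⟩, a.2⟩
  have he : Function.Injective e := fun a a' h => by simpa [e, Fin.ext_iff, Subtype.ext_iff] using h
  let w (a : Fin n₁) : EuclideanSpace 𝕜 (Fin n₁) :=
    if h : (a : ℕ) < n₂ then (((σ a)⁻¹ : ℝ) : 𝕜) • T (v ⟨a, h⟩) else 0
  have hw : Orthonormal 𝕜 ({a : Fin n₁ | σ a ≠ 0}.domRestrict w) := by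
    have hwe : {a : Fin n₁ | σ a ≠ 0}.domRestrict w =
        (fun j : {j : Fin n₂ // σ j ≠ 0} => (((σ j)⁻¹ : ℝ) : 𝕜) • T (v j)) ∘ e := by
      funext a
      simp [w, e, (lt_min_iff.1 (hlt a.2)).2]
    exact hwe ▸ (orthonormal_inv_singularValues_smul hv).comp e he
  obtain ⟨u, hu⟩ := hw.exists_orthonormalBasis_extension_of_card_eq (by simp)
  refine ⟨u, v, fun j => ?_⟩
  by_cases h0 : σ j = 0
  · have hTv : T (v j) = 0 := norm_eq_zero.1 (by rw [hv.norm_apply, h0, abs_zero])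
    simp [hTv, h0]
  · have hj := (lt_min_iff.1 (hlt h0)).1
    have h0' : (σ j : 𝕜) ≠ 0 := mod_cast h0
    rw [dif_pos hj, hu ⟨j, hj⟩ h0]
    simp [w, smul_smul, mul_inv_cancel₀ h0']

/-- The matrix whose columns are the vectors of an orthonormal basis. -/
def colMatrix {m : ℕ} (u : OrthonormalBasis (Fin m) 𝕜 (EuclideanSpace 𝕜 (Fin m))) :
    Matrix (Fin m) (Fin m) 𝕜 := (EuclideanSpace.basisFun (Fin m) 𝕜).toBasis.toMatrix u

theorem colMatrix_apply {m : ℕ} (u : OrthonormalBasis (Fin m) 𝕜 (EuclideanSpace 𝕜 (Fin m)))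
    (a j : Fin m) : colMatrix u a j = u j a := rfl

theorem colMatrix_mem_unitaryGroup {m : ℕ}
    (u : OrthonormalBasis (Fin m) 𝕜 (EuclideanSpace 𝕜 (Fin m))) :
    colMatrix u ∈ Matrix.unitaryGroup (Fin m) 𝕜 :=
  (EuclideanSpace.basisFun (Fin m) 𝕜).toMatrix_orthonormalBasis_mem_unitary u

theorem exists_colMatrix_eq {m : ℕ} {U : Matrix (Fin m) (Fin m) 𝕜}
    (hU : U ∈ Matrix.unitaryGroup (Fin m) 𝕜) :
    ∃ u : OrthonormalBasis (Fin m) 𝕜 (EuclideanSpace 𝕜 (Fin m)), colMatrix u = U := by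
  let w (j : Fin m) : EuclideanSpace 𝕜 (Fin m) := WithLp.toLp 2 fun a => U a j
  have hw : Orthonormal 𝕜 w := by
    rw [orthonormal_iff_ite]
    intro i j
    rw [← Matrix.one_apply, ← Matrix.mem_unitaryGroup_iff'.1 hU, Matrix.mul_apply,
      PiLp.inner_apply]
    exact Finset.sum_congr rfl fun a _ => mul_comm _ _
  have hspan := hw.linearIndependent.span_eq_top_of_card_eq_finrank' (by simp)
  refine ⟨OrthonormalBasis.mk hw hspan.ge, ?_⟩
  ext a j
  rw [colMatrix_apply, OrthonormalBasis.coe_mk]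

theorem mul_diagRect_apply {p : Type*} (U : Matrix p (Fin n₁) 𝕜) (c : ℕ → ℝ) (a : p)
    (j : Fin n₂) :
    (U * diagRect 𝕜 n₁ n₂ c) a j =
      if h : (j : ℕ) < n₁ then (c j : 𝕜) * U a ⟨j, h⟩ else 0 := by
  simp only [Matrix.mul_apply, diagRect, Matrix.of_apply, mul_ite, mul_zero]
  split_ifs with h
  · rw [Fintype.sum_eq_single (⟨j, h⟩ : Fin n₁) fun b hb => if_neg (hb <| Fin.ext ·), if_pos rfl,
      mul_comm]
  · exact Finset.sum_eq_zero fun b _ => if_neg fun hb : (b : ℕ) = j => h (hb ▸ b.2)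

theorem isDiagIn_iff_mul_colMatrix (A : Matrix (Fin n₁) (Fin n₂) 𝕜) (c : ℕ → ℝ)
    (u : OrthonormalBasis (Fin n₁) 𝕜 (EuclideanSpace 𝕜 (Fin n₁)))
    (v : OrthonormalBasis (Fin n₂) 𝕜 (EuclideanSpace 𝕜 (Fin n₂))) :
    IsDiagIn (Matrix.toEuclideanLin A) c u v ↔
      A * colMatrix v = colMatrix u * diagRect 𝕜 n₁ n₂ c := by
  rw [← Matrix.ext_iff, IsDiagIn, forall_comm]
  refine forall_congr' fun j => ?_
  rw [PiLp.ext_iff]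
  refine forall_congr' fun a => ?_
  have hleft : Matrix.toEuclideanLin A (v j) a = (A * colMatrix v) a j := by
    simp [Matrix.toLpLin_apply, Matrix.mul_apply, colMatrix_apply, Matrix.mulVec, dotProduct]
  rw [hleft, mul_diagRect_apply]
  split_ifs <;> rfl

theorem isDiagIn_iff (A : Matrix (Fin n₁) (Fin n₂) 𝕜) (c : ℕ → ℝ)
    (u : OrthonormalBasis (Fin n₁) 𝕜 (EuclideanSpace 𝕜 (Fin n₁)))
    (v : OrthonormalBasis (Fin n₂) 𝕜 (EuclideanSpace 𝕜 (Fin n₂))) :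
    IsDiagIn (Matrix.toEuclideanLin A) c u v ↔
      A = colMatrix u * diagRect 𝕜 n₁ n₂ c * (colMatrix v).conjTranspose := by
  have hv := colMatrix_mem_unitaryGroup v
  rw [isDiagIn_iff_mul_colMatrix, ← Matrix.star_eq_conjTranspose]
  constructor <;> intro h
  · rw [← h, Matrix.mul_assoc, Matrix.mem_unitaryGroup_iff.1 hv, Matrix.mul_one]
  · rw [h, Matrix.mul_assoc, Matrix.mem_unitaryGroup_iff'.1 hv, Matrix.mul_one]

theorem exists_svd (A : Matrix (Fin n₁) (Fin n₂) 𝕜) :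
    ∃ U ∈ Matrix.unitaryGroup (Fin n₁) 𝕜, ∃ V ∈ Matrix.unitaryGroup (Fin n₂) 𝕜,
      A = U * diagRect 𝕜 n₁ n₂ (Matrix.toEuclideanLin A).singularValues * V.conjTranspose := by
  obtain ⟨u, v, h⟩ := exists_isDiagIn (Matrix.toEuclideanLin A)
  exact ⟨_, colMatrix_mem_unitaryGroup u, _, colMatrix_mem_unitaryGroup v,
    (isDiagIn_iff A _ u v).1 h⟩

theorem rectDiag_congr {c d : ℕ → ℝ} (h : ∀ j < min n₁ n₂, c j = d j) :
    rectDiag n₁ n₂ c = rectDiag n₁ n₂ d := by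
  ext a b
  simp only [rectDiag, Matrix.of_apply]
  split_ifs with hab
  · rw [h a (lt_min a.2 (hab ▸ b.2))]
  · rfl

theorem sval_eq_of_decomposition {A : Matrix (Fin n₁) (Fin n₂) ℂ} {U : Matrix (Fin n₁) (Fin n₁) ℂ}
    {V : Matrix (Fin n₂) (Fin n₂) ℂ} {c : ℕ → ℝ} (hU : U ∈ Matrix.unitaryGroup (Fin n₁) ℂ)
    (hV : V ∈ Matrix.unitaryGroup (Fin n₂) ℂ) (hA : A = U * rectDiag n₁ n₂ c * V.conjTranspose)
    (hc0 : ∀ j, 0 ≤ c j) (hc : Antitone c) {j : ℕ} (hj : j < min n₁ n₂) : sval A j = c j := by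
  obtain ⟨u, rfl⟩ := exists_colMatrix_eq hU
  obtain ⟨v, rfl⟩ := exists_colMatrix_eq hV
  exact ((isDiagIn_iff A c u v).2 hA).singularValues_eq hc0 hc hj

theorem map_mem_unitaryGroup {R S : Type*} [CommRing R] [StarRing R] [CommRing S] [StarRing S]
    {m : ℕ} (φ : R →+* S) (hφ : ∀ x, φ (star x) = star (φ x)) {U : Matrix (Fin m) (Fin m) R}
    (hU : U ∈ Matrix.unitaryGroup (Fin m) R) : U.map φ ∈ Matrix.unitaryGroup (Fin m) S := by
  rw [Matrix.mem_unitaryGroup_iff] at hU ⊢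
  have hstar : star (U.map φ) = (star U).map φ := by
    ext a b
    simp [Matrix.star_apply, hφ]
  rw [hstar, ← Matrix.map_mul, hU, Matrix.map_one _ (map_zero φ) (map_one φ)]

theorem map_conj_mem_unitaryGroup {m : ℕ} {U : Matrix (Fin m) (Fin m) ℂ}
    (hU : U ∈ Matrix.unitaryGroup (Fin m) ℂ) :
    U.map (starRingEnd ℂ) ∈ Matrix.unitaryGroup (Fin m) ℂ :=
  map_mem_unitaryGroup _ (fun _ => rfl) hU

theorem exists_svd_of_map_conj_eq {A : Matrix (Fin n₁) (Fin n₂) ℂ}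
    (hA : A.map (starRingEnd ℂ) = A) :
    ∃ U ∈ Matrix.unitaryGroup (Fin n₁) ℂ, ∃ V ∈ Matrix.unitaryGroup (Fin n₂) ℂ,
      A = U * rectDiag n₁ n₂ (sval A) * V.conjTranspose ∧
      U.map (starRingEnd ℂ) = U ∧ V.map (starRingEnd ℂ) = V := by
  obtain ⟨U, hU, V, hV, h⟩ := exists_svd (A.map Complex.re)
  set c := (Matrix.toEuclideanLin (A.map Complex.re)).singularValues
  have hreal : A = (A.map Complex.re).map Complex.ofRealHom := by
    ext a b
    exact (Complex.conj_eq_iff_re.1 (congrFun (congrFun hA a) b)).symm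
  have hdiag : (diagRect ℝ n₁ n₂ c).map Complex.ofRealHom = rectDiag n₁ n₂ c := by
    ext a b
    simp only [diagRect, rectDiag, Matrix.map_apply, Matrix.of_apply]
    split_ifs <;> simp
  have hVmap : (V.conjTranspose).map Complex.ofRealHom =
      (V.map Complex.ofRealHom).conjTranspose := by
    ext a b
    simp
  have hdec : A = U.map Complex.ofRealHom * rectDiag n₁ n₂ c *
      (V.map Complex.ofRealHom).conjTranspose := by
    rw [← hdiag, ← hVmap, ← Matrix.map_mul, ← Matrix.map_mul, ← h, ← hreal]
  have hφ (x : ℝ) : Complex.ofRealHom (star x) = star (Complex.ofRealHom x) := by simp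
  have hU' := map_mem_unitaryGroup _ hφ hU
  have hV' := map_mem_unitaryGroup _ hφ hV
  refine ⟨_, hU', _, hV', ?_, ?_, ?_⟩
  · rwa [rectDiag_congr fun j hj => sval_eq_of_decomposition hU' hV' hdec
      (LinearMap.singularValues_nonneg _) (LinearMap.singularValues_antitone _) hj]
  all_goals ext a b; simp

theorem map_conj_decomposition (U : Matrix (Fin n₁) (Fin n₁) ℂ) (V : Matrix (Fin n₂) (Fin n₂) ℂ)
    (c : ℕ → ℝ) :
    (U * rectDiag n₁ n₂ c * V.conjTranspose).map (starRingEnd ℂ) =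
      U.map (starRingEnd ℂ) * rectDiag n₁ n₂ c * (V.map (starRingEnd ℂ)).conjTranspose := by
  have hdiag : (rectDiag n₁ n₂ c).map (starRingEnd ℂ) = rectDiag n₁ n₂ c := by
    ext a b
    simp only [rectDiag, Matrix.map_apply, Matrix.of_apply]
    split_ifs <;> simp
  rw [Matrix.map_mul, Matrix.map_mul, hdiag]
  rfl

theorem sval_map_conj (A : Matrix (Fin n₁) (Fin n₂) ℂ) : sval (A.map (starRingEnd ℂ)) = sval A := by
  funext j
  by_cases hj : j < min n₁ n₂
  · obtain ⟨U, hU, V, hV, h⟩ := exists_svd A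
    change A = U * rectDiag n₁ n₂ (sval A) * V.conjTranspose at h
    refine sval_eq_of_decomposition (map_conj_mem_unitaryGroup hU) (map_conj_mem_unitaryGroup hV) ?_
      (LinearMap.singularValues_nonneg _) (LinearMap.singularValues_antitone _) hj
    conv_lhs => rw [h]
    exact map_conj_decomposition _ _ _
  · exact (singularValues_eq_zero_of_le _ (not_lt.1 hj)).trans
      (singularValues_eq_zero_of_le _ (not_lt.1 hj)).symm

theorem exists_family_neg_eq {ι α : Type*} [InvolutiveNeg ι] {τ : α → α}
    (hτ : Function.Involutive τ) {p : ι → α → Prop} (hp : ∀ i a, p i a → p (-i) (τ a))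
    (hex : ∀ i, ∃ a, p i a ∧ (-i = i → τ a = a)) :
    ∃ a : ι → α, ∀ i, p i (a i) ∧ a (-i) = τ (a i) := by
  classical
  choose b hb hfix using hex
  let _ : LinearOrder ι := linearOrderOfSTO WellOrderingRel
  refine ⟨fun i => if i ≤ -i then b i else τ (b (-i)), fun i => ⟨?_, ?_⟩⟩
  · beta_reduce
    split_ifs
    · exact hb i
    · simpa using hp _ _ (hb (-i))
  · simp only [neg_neg]
    rcases lt_trichotomy i (-i) with h | h | h
    · rw [if_neg h.not_ge, if_pos h.le]
    · rw [← h, if_pos le_rfl, hfix i h.symm]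
    · rw [if_pos h.le, if_neg h.not_ge, hτ]

theorem exists_isTSVD [∀ j, NeZero (n j)] (P : Tensor n₁ n₂ n) : ∃ U V, IsTSVD P U V := by
  let τ : Matrix (Fin n₁) (Fin n₁) ℂ × Matrix (Fin n₂) (Fin n₂) ℂ →
      Matrix (Fin n₁) (Fin n₁) ℂ × Matrix (Fin n₂) (Fin n₂) ℂ :=
    fun W => (W.1.map (starRingEnd ℂ), W.2.map (starRingEnd ℂ))
  have hτ : Function.Involutive τ := fun W => by
    ext <;> simp [τ]
  obtain ⟨W, hW⟩ := exists_family_neg_eq hτ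
    (p := fun (i : SliceIdx n) W => W.1 ∈ Matrix.unitaryGroup (Fin n₁) ℂ ∧
      W.2 ∈ Matrix.unitaryGroup (Fin n₂) ℂ ∧
      fslice P i = W.1 * rectDiag n₁ n₂ (sval (fslice P i)) * W.2.conjTranspose)
    (by
      rintro i W ⟨hU, hV, hdec⟩
      refine ⟨map_conj_mem_unitaryGroup hU, map_conj_mem_unitaryGroup hV, ?_⟩
      rw [fslice_neg_idx, sval_map_conj, ← map_conj_decomposition, ← hdec])
    (fun i => by
      by_cases hi : -i = i
      · obtain ⟨U, hU, V, hV, hdec, hUc, hVc⟩ :=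
          exists_svd_of_map_conj_eq (A := fslice P i) (by rw [← fslice_neg_idx, hi])
        exact ⟨(U, V), ⟨hU, hV, hdec⟩, fun _ => Prod.ext hUc hVc⟩
      · obtain ⟨U, hU, V, hV, hdec⟩ := exists_svd (fslice P i)
        exact ⟨(U, V), ⟨hU, hV, hdec⟩, fun h => absurd h hi⟩)
  refine ⟨realInvDFT fun i => (W i).1, realInvDFT fun i => (W i).2, fun i => ?_⟩
  rw [fslice_realInvDFT fun i => congrArg Prod.fst (hW i).2,
    fslice_realInvDFT fun i => congrArg Prod.snd (hW i).2]
  exact (hW i).1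

end MatrixSVD

section Duality

/-- The operator norms of all Fourier slices of `Y` are at most `c`. -/
def SliceBound (Y : Tensor n₁ n₂ n) (c : ℝ) : Prop := ∀ i x, ‖slice i Y x‖ ≤ c * ‖x‖

theorem tnn_eq (X : Tensor n₁ n₂ n) :
    tnn X = 1 / (numSlices n : ℝ) * ∑ i, ∑ j : Fin n₂, (slice i X).singularValues j := by
  refine congrArg _ (Finset.sum_congr rfl fun i _ => ?_)
  rw [Fin.sum_univ_eq_sum_range (fun j => (slice i X).singularValues j) n₂]
  refine Finset.sum_subset (Finset.range_subset_range.2 (min_le_right _ _)) fun j _ hj => ?_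
  exact singularValues_eq_zero_of_le (slice i X) (not_lt.1 (Finset.mem_range.not.1 hj))

theorem frobInner_le_of_bound {𝕜 E F : Type*} [RCLike 𝕜] [NormedAddCommGroup E]
    [InnerProductSpace 𝕜 E] [FiniteDimensional 𝕜 E] [NormedAddCommGroup F]
    [InnerProductSpace 𝕜 F] [FiniteDimensional 𝕜 F] {S T : E →ₗ[𝕜] F} {c : ℝ} {q : ℕ}
    (hq : finrank 𝕜 E = q) (hS : ∀ x, ‖S x‖ ≤ c * ‖x‖) :
    frobInner S T ≤ c * ∑ j : Fin q, T.singularValues j := by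
  obtain ⟨b, hb⟩ := exists_isRightSVBasis T hq
  rw [frobInner_eq_sum S T b, Finset.mul_sum]
  refine Finset.sum_le_sum fun j _ => ?_
  calc RCLike.re ⟪S (b j), T (b j)⟫_𝕜 ≤ ‖S (b j)‖ * ‖T (b j)‖ := re_inner_le_norm _ _
    _ ≤ c * T.singularValues j := by
        rw [hb.norm_apply j, abs_of_nonneg (T.singularValues_nonneg j)]
        gcongr
        · exact T.singularValues_nonneg j
        · simpa using hS (b j)

theorem sum_fin_ite_lt (c : ℕ → ℝ) :
    ∑ j : Fin n₂, (if (j : ℕ) < n₁ then c j else 0) = ∑ j ∈ Finset.range (min n₁ n₂), c j := by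
  rw [Fin.sum_univ_eq_sum_range (fun j => if j < n₁ then c j else 0) n₂, ← Finset.sum_filter]
  congr 1
  ext j
  simp [and_comm]

namespace IsDiagIn

variable {S T : EuclideanSpace ℂ (Fin n₂) →ₗ[ℂ] EuclideanSpace ℂ (Fin n₁)} {c d : ℕ → ℝ}
  {u : OrthonormalBasis (Fin n₁) ℂ (EuclideanSpace ℂ (Fin n₁))}
  {v : OrthonormalBasis (Fin n₂) ℂ (EuclideanSpace ℂ (Fin n₂))}

theorem sub (hS : IsDiagIn S c u v) (hT : IsDiagIn T d u v) :
    IsDiagIn (S - T) (fun j => c j - d j) u v := by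
  intro j
  rw [LinearMap.sub_apply, hS j, hT j]
  split_ifs with h
  · rw [← sub_smul]; simp
  · simp

theorem norm_apply_le (h : IsDiagIn T c u v) {B : ℝ} (hB : 0 ≤ B)
    (hc : ∀ j < min n₁ n₂, |c j| ≤ B) (x : EuclideanSpace ℂ (Fin n₂)) : ‖T x‖ ≤ B * ‖x‖ := by
  refine le_of_sq_le_sq ?_ (by positivity)
  rw [h.isRightSVBasis.norm_sq_apply, mul_pow, ← v.sum_sq_norm_inner_right x, Finset.mul_sum]
  refine Finset.sum_le_sum fun j _ => mul_le_mul_of_nonneg_right ?_ (sq_nonneg _)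
  split_ifs with hj
  · exact sq_le_sq' (abs_le.1 (hc j (lt_min hj j.2))).1 (abs_le.1 (hc j (lt_min hj j.2))).2
  · simpa using sq_nonneg B

theorem frobInner_eq (hS : IsDiagIn S c u v) (hT : IsDiagIn T d u v) :
    frobInner S T = ∑ j ∈ Finset.range (min n₁ n₂), c j * d j := by
  have hterm (j : Fin n₂) : RCLike.re ⟪S (v j), T (v j)⟫_ℂ =
      if (j : ℕ) < n₁ then c j * d j else 0 := by
    rw [hS j, hT j]
    split_ifs with hj
    · rw [inner_smul_left, inner_smul_right, u.inner_eq_one]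
      simp
    · simp
  rw [frobInner_eq_sum S T v, Finset.sum_congr rfl fun j _ => hterm j,
    sum_fin_ite_lt fun j => c j * d j]

end IsDiagIn

theorem IsTSVD.exists_isDiagIn {P Z : Tensor n₁ n₂ n} {U : Tensor n₁ n₁ n} {V : Tensor n₂ n₂ n}
    (h : IsTSVD P U V) {c : ℕ → ℝ} {i : SliceIdx n}
    (hZ : fslice Z i = fslice U i * rectDiag n₁ n₂ c * (fslice V i).conjTranspose) :
    ∃ u v, IsDiagIn (slice i P) (sval (fslice P i)) u v ∧ IsDiagIn (slice i Z) c u v := by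
  obtain ⟨hU, hV, hP⟩ := h i
  obtain ⟨u, hu⟩ := exists_colMatrix_eq hU
  obtain ⟨v, hv⟩ := exists_colMatrix_eq hV
  rw [← hu, ← hv] at hP hZ
  exact ⟨u, v, (isDiagIn_iff _ _ u v).2 hP, (isDiagIn_iff _ _ u v).2 hZ⟩

theorem isProj_iff_norm_eq_iInf {P Z : Tensor n₁ n₂ n} (hZ : Z ∈ ball n₁ n₂ n) :
    IsProj P Z ↔ ‖P - Z‖ = ⨅ W : ball n₁ n₂ n, ‖P - W‖ := by
  have : Nonempty (ball n₁ n₂ n) := ⟨⟨Z, hZ⟩⟩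
  have hbdd : BddBelow (Set.range fun W : ball n₁ n₂ n => ‖P - W‖) :=
    ⟨0, Set.forall_mem_range.2 fun _ => norm_nonneg _⟩
  exact ⟨fun h => (le_ciInf fun W : ball n₁ n₂ n => h.2 W W.2).antisymm (ciInf_le hbdd ⟨Z, hZ⟩),
    fun h => ⟨hZ, fun W hW => h.trans_le (ciInf_le hbdd ⟨W, hW⟩)⟩⟩

variable [∀ j, NeZero (n j)]

theorem inner_le_of_sliceBound {X Y : Tensor n₁ n₂ n} {c : ℝ} (hY : SliceBound Y c) :
    ⟪Y, X⟫_ℝ ≤ c * tnn X := by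
  rw [inner_eq_sum_frobInner, tnn_eq, mul_left_comm]
  refine mul_le_mul_of_nonneg_left ?_ (one_div_nonneg.2 (Nat.cast_nonneg _))
  rw [Finset.mul_sum]
  exact Finset.sum_le_sum fun i _ => frobInner_le_of_bound finrank_euclideanSpace_fin (hY i)

theorem exists_fslice_eq (U : Tensor n₁ n₁ n) (V : Tensor n₂ n₂ n) (c : SliceIdx n → ℕ → ℝ)
    (hc : ∀ i, c (-i) = c i) :
    ∃ Z : Tensor n₁ n₂ n, ∀ i,
      fslice Z i = fslice U i * rectDiag n₁ n₂ (c i) * (fslice V i).conjTranspose := by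
  refine ⟨realInvDFT fun i => fslice U i * rectDiag n₁ n₂ (c i) * (fslice V i).conjTranspose,
    congrFun (fslice_realInvDFT fun i => ?_)⟩
  rw [map_conj_decomposition, fslice_neg_idx, fslice_neg_idx, hc]

/-- The dual tensor is the polar factor `U * Vᵀ` of a t-SVD. -/
theorem exists_sliceBound_inner_eq_tnn (X : Tensor n₁ n₂ n) :
    ∃ Y : Tensor n₁ n₂ n, SliceBound Y 1 ∧ ⟪Y, X⟫_ℝ = tnn X := by
  obtain ⟨U, V, h⟩ := exists_isTSVD X
  obtain ⟨Y, hY⟩ := exists_fslice_eq U V (fun _ _ => 1) fun _ => rfl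
  have hdiag (i : SliceIdx n) := h.exists_isDiagIn (hY i)
  refine ⟨Y, fun i x => ?_, ?_⟩
  · obtain ⟨u, v, -, hYi⟩ := hdiag i
    exact hYi.norm_apply_le zero_le_one (by simp) x
  · rw [inner_eq_sum_frobInner, tnn]
    refine congrArg _ (Finset.sum_congr rfl fun i _ => ?_)
    obtain ⟨u, v, hXi, hYi⟩ := hdiag i
    simp only [hYi.frobInner_eq hXi, one_mul]

theorem mem_ball_iff (X : Tensor n₁ n₂ n) :
    X ∈ ball n₁ n₂ n ↔ ∀ Y : Tensor n₁ n₂ n, SliceBound Y 1 → ⟪Y, X⟫_ℝ ≤ 1 := by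
  constructor
  · intro hX Y hY
    exact (inner_le_of_sliceBound hY).trans (by simpa [ball] using hX)
  · intro h
    obtain ⟨Y, hY, hXY⟩ := exists_sliceBound_inner_eq_tnn X
    exact hXY.symm.le.trans (h Y hY)

theorem ball_eq_iInter : ball n₁ n₂ n =
    ⋂ (Y : Tensor n₁ n₂ n) (_ : SliceBound Y 1), {X | ⟪Y, X⟫_ℝ ≤ 1} := by
  ext X
  simp only [mem_ball_iff, Set.mem_iInter, Set.mem_ofPred_eq]

theorem convex_ball : Convex ℝ (ball n₁ n₂ n) := by
  rw [ball_eq_iInter]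
  exact convex_iInter₂ fun Y _ =>
    convex_halfSpace_le (innerSL ℝ Y).isBoundedLinearMap.toIsLinearMap 1

theorem isClosed_ball : IsClosed (ball n₁ n₂ n) := by
  rw [ball_eq_iInter]
  exact isClosed_iInter fun Y => isClosed_iInter fun _ => isClosed_le (by fun_prop) (by fun_prop)

theorem zero_mem_ball : (0 : Tensor n₁ n₂ n) ∈ ball n₁ n₂ n := by
  rw [mem_ball_iff]
  simp

theorem isProj_iff_inner_le {P Z : Tensor n₁ n₂ n} (hZ : Z ∈ ball n₁ n₂ n) :
    IsProj P Z ↔ ∀ W ∈ ball n₁ n₂ n, ⟪P - Z, W - Z⟫_ℝ ≤ 0 :=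
  (isProj_iff_norm_eq_iInf hZ).trans (norm_eq_iInf_iff_real_inner_le_zero convex_ball hZ)

theorem IsProj.inner_le {P Z W : Tensor n₁ n₂ n} (h : IsProj P Z) (hW : W ∈ ball n₁ n₂ n) :
    ⟪P - Z, W - Z⟫_ℝ ≤ 0 :=
  (isProj_iff_inner_le h.1).1 h W hW

theorem exists_isProj (P : Tensor n₁ n₂ n) : ∃ Z, IsProj P Z := by
  obtain ⟨Z, hZ, h⟩ := exists_norm_eq_iInf_of_complete_convex ⟨0, zero_mem_ball⟩
    (isClosed_ball (n₁ := n₁) (n₂ := n₂)).isComplete convex_ball P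
  exact ⟨Z, (isProj_iff_norm_eq_iInf hZ).2 h⟩

theorem IsProj.norm_sub_le {P P' Z Z' : Tensor n₁ n₂ n} (h : IsProj P Z) (h' : IsProj P' Z') :
    ‖Z - Z'‖ ≤ ‖P - P'‖ := by
  have hsum : ⟪Z - Z', Z - Z'⟫_ℝ =
      ⟪P - Z, Z' - Z⟫_ℝ + ⟪P' - Z', Z - Z'⟫_ℝ + ⟪P - P', Z - Z'⟫_ℝ := by
    rw [← neg_sub Z Z', inner_neg_right, neg_add_eq_sub, ← inner_sub_left, ← inner_add_left]
    congr 1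
    abel
  have hsq : ‖Z - Z'‖ ^ 2 ≤ ‖P - P'‖ * ‖Z - Z'‖ := by
    rw [← real_inner_self_eq_norm_sq, hsum]
    linarith [h.inner_le h'.1, h'.inner_le h.1, real_inner_le_norm (P - P') (Z - Z')]
  by_contra! hlt
  nlinarith [norm_nonneg (P - P')]

theorem IsProj.unique {P Z Z' : Tensor n₁ n₂ n} (h : IsProj P Z) (h' : IsProj P Z') : Z = Z' :=
  sub_eq_zero.1 (norm_le_zero_iff.1 (by simpa using h.norm_sub_le h'))

end Duality

section Truncation

/-- The sum over the slices of the `r` leading singular values soft-thresholded at level `s`. -/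
def thresholdSum (r : ℕ) (P : Tensor n₁ n₂ n) (s : ℝ) : ℝ :=
  ∑ i : SliceIdx n, ∑ j ∈ Finset.range r, max 0 (sval (fslice P i) j - s)

theorem sval_nonneg {p q : Type*} [Fintype p] [Fintype q] [DecidableEq q] (A : Matrix p q ℂ)
    (j : ℕ) : 0 ≤ sval A j := LinearMap.singularValues_nonneg _ j

theorem sval_antitone {p q : Type*} [Fintype p] [Fintype q] [DecidableEq q] (A : Matrix p q ℂ) :
    Antitone (sval A) := LinearMap.singularValues_antitone _

theorem thresholdSum_zero (r : ℕ) (P : Tensor n₁ n₂ n) :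
    thresholdSum r P 0 = ∑ i : SliceIdx n, ∑ j ∈ Finset.range r, sval (fslice P i) j := by
  simp only [thresholdSum, sub_zero, max_eq_right (sval_nonneg _ _)]

theorem thresholdSum_lt_of_lt {r : ℕ} {P : Tensor n₁ n₂ n} {s t : ℝ} (hst : s < t)
    (ht : 0 < thresholdSum r P t) : thresholdSum r P t < thresholdSum r P s := by
  have hmono (x : ℝ) : max 0 (x - t) ≤ max 0 (x - s) := max_le_max le_rfl (by linarith)
  obtain ⟨i, -, hi⟩ := (Finset.sum_pos_iff_of_nonneg fun _ _ =>
    Finset.sum_nonneg fun _ _ => le_max_left _ _).1 ht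
  obtain ⟨j, hj, hij⟩ := (Finset.sum_pos_iff_of_nonneg fun _ _ => le_max_left _ _).1 hi
  refine Finset.sum_lt_sum (fun i _ => Finset.sum_le_sum fun j _ => hmono _)
    ⟨i, Finset.mem_univ i, Finset.sum_lt_sum (fun j _ => hmono _) ⟨j, hj, ?_⟩⟩
  have hpos : 0 < sval (fslice P i) j - t := (lt_max_iff.1 hij).resolve_left (lt_irrefl 0)
  rw [max_eq_right hpos.le]
  exact lt_max_of_lt_right (by linarith)

theorem thresholdSum_eq_of_sval_le {r m : ℕ} (hrm : r ≤ m) {P : Tensor n₁ n₂ n} {s : ℝ}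
    (hs : ∀ i, sval (fslice P i) r ≤ s) : thresholdSum r P s = thresholdSum m P s :=
  Finset.sum_congr rfl fun i _ =>
    Finset.sum_subset (Finset.range_subset_range.2 hrm) fun j _ hj => max_eq_left <| by
      linarith [hs i, sval_antitone (fslice P i) (not_lt.1 (Finset.mem_range.not.1 hj))]

theorem thresholdSum_eq_zero {r : ℕ} {P : Tensor n₁ n₂ n} {s : ℝ}
    (hs : ∀ i, sval (fslice P i) 0 ≤ s) : thresholdSum r P s = 0 :=
  Finset.sum_eq_zero fun i _ => Finset.sum_eq_zero fun j _ => max_eq_left <| by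
    linarith [hs i, sval_antitone (fslice P i) (Nat.zero_le j)]

theorem continuous_thresholdSum (r : ℕ) (P : Tensor n₁ n₂ n) : Continuous (thresholdSum r P) := by
  unfold thresholdSum
  fun_prop

theorem exists_thresholdSum_eq {r : ℕ} {P : Tensor n₁ n₂ n} {s₀ c : ℝ} (hc : 0 ≤ c)
    (hs₀ : c ≤ thresholdSum r P s₀) : ∃ σ, s₀ ≤ σ ∧ thresholdSum r P σ = c := by
  let M : ℝ := |s₀| + ∑ i : SliceIdx n, sval (fslice P i) 0
  have hsum : 0 ≤ ∑ i : SliceIdx n, sval (fslice P i) 0 :=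
    Finset.sum_nonneg fun i _ => sval_nonneg _ _
  have hM : thresholdSum r P M = 0 := thresholdSum_eq_zero fun i =>
    (Finset.single_le_sum (fun i _ => sval_nonneg (fslice P i) 0) (Finset.mem_univ i)).trans
      (le_add_of_nonneg_left (abs_nonneg s₀))
  obtain ⟨σ, hσ, h⟩ := intermediate_value_Icc'
    ((le_abs_self s₀).trans (le_add_of_nonneg_right hsum) : s₀ ≤ M)
    (continuous_thresholdSum r P).continuousOn ⟨hM ▸ hc, hs₀⟩
  exact ⟨σ, hσ.1, h⟩

variable [∀ j, NeZero (n j)]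

theorem inv_numSlices_mul_eq_one_iff {x : ℝ} :
    1 / (numSlices n : ℝ) * x = 1 ↔ x = numSlices n := by
  rw [one_div, inv_mul_eq_one₀ (Nat.cast_ne_zero.2 numSlices_pos.ne'), eq_comm]

/-- A thresholded sum of at least `N` at level `s₀` excludes the unthresholded alternative in
`IsTruncProj`, unless `s₀ = 0` and both alternatives agree. -/
theorem thresholdSum_eq_numSlices {r : ℕ} {P : Tensor n₁ n₂ n} {s₀ σ : ℝ} (hs₀ : 0 ≤ s₀)
    (hsum : (numSlices n : ℝ) ≤ thresholdSum r P s₀)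
    (hσ : 1 / (numSlices n : ℝ) * thresholdSum r P σ = 1 ∨
      σ = 0 ∧ 1 / (numSlices n : ℝ) * thresholdSum r P 0 ≤ 1) :
    s₀ ≤ σ ∧ thresholdSum r P σ = numSlices n := by
  have hN : (0 : ℝ) < numSlices n := mod_cast numSlices_pos
  rw [inv_numSlices_mul_eq_one_iff, one_div, inv_mul_le_iff₀ hN, mul_one] at hσ
  have hle : thresholdSum r P σ ≤ numSlices n := by
    rcases hσ with h | ⟨rfl, h⟩
    exacts [h.le, h]
  have hs₀σ : s₀ ≤ σ := by
    by_contra! hlt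
    linarith [thresholdSum_lt_of_lt hlt (hN.trans_le hsum)]
  rcases hσ with h | ⟨h0, -⟩
  · exact ⟨hs₀σ, h⟩
  · rw [le_antisymm hs₀σ (h0.trans_le hs₀)] at hsum
    exact ⟨hs₀σ, hle.antisymm hsum⟩

theorem abs_sub_softThreshold_le {x s : ℝ} (hx : 0 ≤ x) (hs : 0 ≤ s) : |x - max 0 (x - s)| ≤ s := by
  rcases le_total 0 (x - s) with h | h
  · rw [max_eq_right h, sub_sub_cancel, abs_of_nonneg hs]
  · rwa [max_eq_left h, sub_zero, abs_of_nonneg hx, ← sub_nonpos]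

theorem sub_softThreshold_mul (x s : ℝ) :
    (x - max 0 (x - s)) * max 0 (x - s) = s * max 0 (x - s) := by
  rcases le_total 0 (x - s) with h | h
  · rw [max_eq_right h, sub_sub_cancel]
  · rw [max_eq_left h, mul_zero, mul_zero]

/-- Soft-thresholding all singular values at the level with average sum `1` is the projection:
`P - Z` has spectral norm at most `σ` and `⟪P - Z, Z⟫ = σ`. -/
theorem isProj_of_isDiagIn_softThreshold {P Z : Tensor n₁ n₂ n} {σ : ℝ} (hσ : 0 ≤ σ)
    (hdiag : ∀ i, ∃ u v, IsDiagIn (slice i P) (sval (fslice P i)) u v ∧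
      IsDiagIn (slice i Z) (fun j => max 0 (sval (fslice P i) j - σ)) u v)
    (hsum : thresholdSum (min n₁ n₂) P σ = numSlices n) : IsProj P Z := by
  have htnn : tnn Z = 1 := by
    rw [tnn, inv_numSlices_mul_eq_one_iff, ← hsum]
    refine Finset.sum_congr rfl fun i _ => Finset.sum_congr rfl fun j hj => ?_
    obtain ⟨u, v, -, hZ⟩ := hdiag i
    exact hZ.singularValues_eq (fun _ => le_max_left _ _)
      (fun _ _ hab => max_le_max le_rfl (sub_le_sub_right (sval_antitone _ hab) σ))
      (Finset.mem_range.1 hj)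
  have hbound : SliceBound (P - Z) σ := by
    intro i x
    obtain ⟨u, v, hP, hZ⟩ := hdiag i
    rw [map_sub]
    exact (hP.sub hZ).norm_apply_le hσ
      (fun j _ => abs_sub_softThreshold_le (sval_nonneg _ _) hσ) x
  have hinner : ⟪P - Z, Z⟫_ℝ = σ := by
    have hslice (i : SliceIdx n) : frobInner (slice i (P - Z)) (slice i Z) =
        ∑ j ∈ Finset.range (min n₁ n₂), σ * max 0 (sval (fslice P i) j - σ) := by
      obtain ⟨u, v, hP, hZ⟩ := hdiag i
      simp only [map_sub, (hP.sub hZ).frobInner_eq hZ, sub_softThreshold_mul]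
    simp only [inner_eq_sum_frobInner, hslice, ← Finset.mul_sum]
    change 1 / (numSlices n : ℝ) * (σ * thresholdSum (min n₁ n₂) P σ) = σ
    rw [mul_left_comm, inv_numSlices_mul_eq_one_iff.2 hsum, mul_one]
  refine (isProj_iff_inner_le htnn.le).2 fun W hW => ?_
  rw [inner_sub_right, hinner, sub_nonpos]
  exact (inner_le_of_sliceBound hbound).trans (mul_le_of_le_one_right hσ hW)

theorem IsTruncProj.isProj {r : ℕ} (hr : r ≤ min n₁ n₂) {P Z : Tensor n₁ n₂ n} {s₀ : ℝ}
    (hs₀ : ∀ i, sval (fslice P i) r ≤ s₀) (hsum : (numSlices n : ℝ) ≤ thresholdSum r P s₀)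
    (h : IsTruncProj r P Z) : IsProj P Z := by
  obtain ⟨U, V, σ, hUV, hσ0, hσ, hZ⟩ := h
  rw [← thresholdSum_zero] at hσ
  obtain ⟨hs₀σ, hσsum⟩ := thresholdSum_eq_numSlices ((sval_nonneg _ _).trans (hs₀ 0)) hsum hσ
  have htail (i : SliceIdx n) : sval (fslice P i) r ≤ σ := (hs₀ i).trans hs₀σ
  have htrunc (i : SliceIdx n) : (fun j => if j < r then max 0 (sval (fslice P i) j - σ) else 0) =
      fun j => max 0 (sval (fslice P i) j - σ) := by
    funext j
    split_ifs with hj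
    · rfl
    · rw [max_eq_left]
      linarith [htail i, sval_antitone (fslice P i) (not_lt.1 hj)]
  refine isProj_of_isDiagIn_softThreshold hσ0 (fun i => ?_)
    (thresholdSum_eq_of_sval_le hr htail ▸ hσsum)
  exact hUV.exists_isDiagIn (htrunc i ▸ hZ i)

theorem exists_isTruncProj {r : ℕ} {P : Tensor n₁ n₂ n} {s₀ : ℝ} (hs₀ : 0 ≤ s₀)
    (hsum : (numSlices n : ℝ) ≤ thresholdSum r P s₀) : ∃ Z, IsTruncProj r P Z := by
  obtain ⟨σ, hσ, hσsum⟩ := exists_thresholdSum_eq (Nat.cast_nonneg _) hsum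
  obtain ⟨U, V, h⟩ := exists_isTSVD P
  obtain ⟨Z, hZ⟩ := exists_fslice_eq U V
    (fun i j => if j < r then max 0 (sval (fslice P i) j - σ) else 0)
    fun i => by rw [fslice_neg_idx, sval_map_conj]
  exact ⟨Z, U, V, σ, h, hs₀.trans hσ, Or.inl (inv_numSlices_mul_eq_one_iff.2 hσsum), hZ⟩

theorem isProj_iff_isTruncProj {r : ℕ} (hr : r ≤ min n₁ n₂) {P : Tensor n₁ n₂ n} {s₀ : ℝ}
    (hs₀ : ∀ i, sval (fslice P i) r ≤ s₀) (hsum : (numSlices n : ℝ) ≤ thresholdSum r P s₀)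
    (Z : Tensor n₁ n₂ n) : IsProj P Z ↔ IsTruncProj r P Z := by
  refine ⟨fun h => ?_, fun h => h.isProj hr hs₀ hsum⟩
  obtain ⟨Z', hZ'⟩ := exists_isTruncProj ((sval_nonneg _ _).trans (hs₀ 0)) hsum
  rwa [h.unique (hZ'.isProj hr hs₀ hsum)]

end Truncation

section SmoothConvex

variable {E : Type*} [NormedAddCommGroup E] [InnerProductSpace ℝ E] [CompleteSpace E]
  {f : E → ℝ} {β : ℝ}

theorem hasDerivAt_line (hf : Differentiable ℝ f) (X D : E) (t : ℝ) :
    HasDerivAt (fun t : ℝ => f (X + t • D)) ⟪∇ f (X + t • D), D⟫_ℝ t := by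
  have hline : HasDerivAt (fun t : ℝ => X + t • D) D t := by
    simpa using ((hasDerivAt_id t).smul_const D).const_add X
  refine ((hf (X + t • D)).hasGradientAt.hasFDerivAt.comp_hasDerivAt t hline).congr_deriv ?_
  rw [InnerProductSpace.toDual_apply_apply]

theorem add_inner_gradient_add_le {F : Type*} [NormedAddCommGroup F] [NormedSpace ℝ F]
    {g : F → ℝ} {A : E →ₗ[ℝ] F} {C : E} {α : ℝ} (hf : ∀ X, f X = g (A X) + ⟪C, X⟫_ℝ)
    (hg : StrongConvexOn Set.univ α g) (hd : Differentiable ℝ f) (X Y : E) :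
    f X + ⟪∇ f X, Y - X⟫_ℝ + α / 2 * ‖A (Y - X)‖ ^ 2 ≤ f Y := by
  set c := α / 2 * ‖A (Y - X)‖ ^ 2 with hc
  have hchord {t : ℝ} (ht : t ∈ Set.Ioo (0 : ℝ) 1) :
      f (X + t • (Y - X)) ≤ (1 - t) * f X + t * f Y - (1 - t) * t * c := by
    have hgt := hg.2 (Set.mem_univ (A X)) (Set.mem_univ (A Y)) (sub_nonneg.2 ht.2.le) ht.1.le
      (sub_add_cancel 1 t)
    have hA : A (X + t • (Y - X)) = (1 - t) • A X + t • A Y := by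
      simp only [map_add, map_smul, map_sub]
      module
    simp only [smul_eq_mul] at hgt
    rw [norm_sub_rev, ← map_sub, ← hc] at hgt
    rw [hf, hf X, hf Y, hA, inner_add_right, inner_smul_right, inner_sub_right]
    linarith
  have hslope := (hasDerivAt_line hd X (Y - X) 0).tendsto_slope_zero_right
  have hbound : Filter.Tendsto (fun t : ℝ => f Y - f X - (1 - t) * c)
      (nhdsWithin 0 (Set.Ioi 0)) (nhds (f Y - f X - (1 - 0) * c)) :=
    (Continuous.tendsto (by fun_prop) 0).mono_left nhdsWithin_le_nhds
  have hlim := le_of_tendsto_of_tendsto hslope hbound <| by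
    filter_upwards [Ioo_mem_nhdsGT one_pos] with t ht
    simp only [zero_add, zero_smul, add_zero, smul_eq_mul]
    rw [inv_mul_le_iff₀ ht.1]
    linarith [hchord ht]
  rw [zero_smul, add_zero] at hlim
  linarith

theorem le_add_inner_gradient_add (hd : Differentiable ℝ f)
    (hL : ∀ X Y, ‖∇ f X - ∇ f Y‖ ≤ β * ‖X - Y‖) (X Y : E) :
    f Y ≤ f X + ⟪∇ f X, Y - X⟫_ℝ + β / 2 * ‖Y - X‖ ^ 2 := by
  set D := Y - X with hD
  let φ (t : ℝ) : ℝ := f (X + t • D) - (t * ⟪∇ f X, D⟫_ℝ + β / 2 * ‖D‖ ^ 2 * t ^ 2)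
  have hφ (t : ℝ) :
      HasDerivAt φ (⟪∇ f (X + t • D), D⟫_ℝ - (⟪∇ f X, D⟫_ℝ + β * ‖D‖ ^ 2 * t)) t := by
    refine (hasDerivAt_line hd X D t).sub <| (((hasDerivAt_id t).mul_const ⟪∇ f X, D⟫_ℝ).add
      ((hasDerivAt_pow 2 t).const_mul (β / 2 * ‖D‖ ^ 2))).congr_deriv ?_
    push_cast
    ring
  have hslope {t : ℝ} (ht : 0 ≤ t) :
      ⟪∇ f (X + t • D), D⟫_ℝ - ⟪∇ f X, D⟫_ℝ ≤ β * ‖D‖ ^ 2 * t := by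
    calc ⟪∇ f (X + t • D), D⟫_ℝ - ⟪∇ f X, D⟫_ℝ ≤ ‖∇ f (X + t • D) - ∇ f X‖ * ‖D‖ := by
          rw [← inner_sub_left]
          exact real_inner_le_norm _ _
      _ ≤ β * ‖X + t • D - X‖ * ‖D‖ := by gcongr; exact hL _ _
      _ = β * ‖D‖ ^ 2 * t := by
          rw [add_sub_cancel_left, norm_smul, Real.norm_of_nonneg ht]
          ring
  have hanti : AntitoneOn φ (Set.Icc 0 1) := by
    refine antitoneOn_of_deriv_nonpos (convex_Icc 0 1)
      (fun t _ => (hφ t).continuousAt.continuousWithinAt)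
      (fun t _ => (hφ t).differentiableAt.differentiableWithinAt) fun t ht => ?_
    rw [interior_Icc] at ht
    rw [(hφ t).deriv]
    linarith [hslope ht.1.le]
  have h01 := hanti (Set.left_mem_Icc.2 zero_le_one) (Set.right_mem_Icc.2 zero_le_one) zero_le_one
  simp only [φ, one_smul, zero_smul, add_zero, hD, add_sub_cancel] at h01
  linarith

theorem inner_gradient_nonneg_of_isMinOn (hd : Differentiable ℝ f) {B : Set E} (hB : Convex ℝ B)
    {X Y : E} (hX : X ∈ B) (hmin : IsMinOn f B X) (hY : Y ∈ B) : 0 ≤ ⟪∇ f X, Y - X⟫_ℝ :=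
  hmin.localize.hasFDerivWithinAt_nonneg (hd X).hasGradientAt.hasFDerivAt.hasFDerivWithinAt
    (sub_mem_posTangentConeAt_of_segment_subset (hB.segment_subset hX hY))

/-- `f` is convex and `β`-smooth, expressed by the first-order lower and upper bounds. -/
structure IsConvexSmooth (f : E → ℝ) (β : ℝ) : Prop where
  le_apply : ∀ X Y, f X + ⟪∇ f X, Y - X⟫_ℝ ≤ f Y
  apply_le : ∀ X Y, f Y ≤ f X + ⟪∇ f X, Y - X⟫_ℝ + β / 2 * ‖Y - X‖ ^ 2

/-- `z` results from a projected gradient step of length `1 / β` at `y`; the projection onto `B` is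
expressed by its variational inequality. -/
def ProjGradStep (f : E → ℝ) (β : ℝ) (B : Set E) (y z : E) : Prop :=
  z ∈ B ∧ ∀ W ∈ B, ⟪y - (1 / β) • ∇ f y - z, W - z⟫_ℝ ≤ 0

namespace IsConvexSmooth

theorem convexOn (h : IsConvexSmooth f β) : ConvexOn ℝ Set.univ f := by
  refine ⟨convex_univ, fun X _ Y _ a b ha hb hab => ?_⟩
  set W := a • X + b • Y with hW
  have hcomb : a • (X - W) + b • (Y - W) = 0 := by
    rw [smul_sub, smul_sub, sub_add_sub_comm, ← hW, ← add_smul, hab, one_smul, sub_self]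
  have hinner : a * ⟪∇ f W, X - W⟫_ℝ + b * ⟪∇ f W, Y - W⟫_ℝ = 0 := by
    rw [← inner_smul_right, ← inner_smul_right, ← inner_add_right, hcomb, inner_zero_right]
  calc f W = a * (f W + ⟪∇ f W, X - W⟫_ℝ) + b * (f W + ⟪∇ f W, Y - W⟫_ℝ) := by
        linear_combination (-f W) * hab - hinner
    _ ≤ a • f X + b • f Y := by
        simp only [smul_eq_mul]
        gcongr <;> exact h.le_apply W _

/-- Compare the two first-order bounds at the gradient step from `Y` for `f - ⟪∇ f X, ·⟫`. -/
theorem add_inner_add_norm_sq_le (h : IsConvexSmooth f β) (hβ : 0 < β) (X Y : E) :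
    f X + ⟪∇ f X, Y - X⟫_ℝ + 1 / (2 * β) * ‖∇ f Y - ∇ f X‖ ^ 2 ≤ f Y := by
  set g := ∇ f Y - ∇ f X with hg
  have hlow := h.le_apply X (Y - (1 / β) • g)
  have hupp := h.apply_le Y (Y - (1 / β) • g)
  have hsq : 1 / β * ⟪∇ f Y, g⟫_ℝ - 1 / β * ⟪∇ f X, g⟫_ℝ = 2 * (1 / (2 * β) * ‖g‖ ^ 2) := by
    rw [← mul_sub, ← inner_sub_left, ← hg, real_inner_self_eq_norm_sq]
    field_simp
  have hβsq : β / 2 * ((1 / β) ^ 2 * ‖g‖ ^ 2) = 1 / (2 * β) * ‖g‖ ^ 2 := by field_simp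
  rw [sub_sub_cancel_left, norm_neg, norm_smul, inner_neg_right, inner_smul_right, mul_pow,
    Real.norm_eq_abs, sq_abs, hβsq] at hupp
  rw [sub_right_comm, inner_sub_right, inner_smul_right] at hlow
  linarith

theorem norm_gradient_sub_sq_le (h : IsConvexSmooth f β) (hβ : 0 < β) (X Y : E) :
    1 / β * ‖∇ f Y - ∇ f X‖ ^ 2 ≤ ⟪Y - X, ∇ f Y - ∇ f X⟫_ℝ := by
  have hXY := h.add_inner_add_norm_sq_le hβ X Y
  have hYX := h.add_inner_add_norm_sq_le hβ Y X
  rw [norm_sub_rev, ← neg_sub Y X, inner_neg_right] at hYX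
  have hhalf : 1 / β * ‖∇ f Y - ∇ f X‖ ^ 2 = 2 * (1 / (2 * β) * ‖∇ f Y - ∇ f X‖ ^ 2) := by
    field_simp
  rw [real_inner_comm, inner_sub_left]
  linarith

theorem norm_gradient_step_sub_le (h : IsConvexSmooth f β) (hβ : 0 < β) (X Y : E) :
    ‖(Y - (1 / β) • ∇ f Y) - (X - (1 / β) • ∇ f X)‖ ≤ ‖Y - X‖ := by
  have hcoc := mul_le_mul_of_nonneg_left (h.norm_gradient_sub_sq_le hβ X Y) (one_div_pos.2 hβ).le
  have hnn : 0 ≤ 1 / β * (1 / β * ‖∇ f Y - ∇ f X‖ ^ 2) := by positivity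
  refine le_of_sq_le_sq ?_ (norm_nonneg _)
  rw [sub_sub_sub_comm, ← smul_sub, norm_sub_sq_real, inner_smul_right, norm_smul, mul_pow,
    Real.norm_eq_abs, sq_abs]
  linarith

theorem sub_le_of_projGradStep (h : IsConvexSmooth f β) (hβ : 0 < β) {B : Set E} {y z W : E}
    (hz : ProjGradStep f β B y z) (hW : W ∈ B) :
    f z - f W ≤ β / 2 * (‖y - W‖ ^ 2 - ‖z - W‖ ^ 2) := by
  have hvar : β * ⟪y - z, W - z⟫_ℝ ≤ ⟪∇ f y, W - z⟫_ℝ := by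
    have hproj := hz.2 W hW
    rw [sub_right_comm, inner_sub_left, real_inner_smul_left, sub_nonpos] at hproj
    rwa [one_div, le_inv_mul_iff₀ hβ] at hproj
  have hsplit : ⟪∇ f y, W - z⟫_ℝ = ⟪∇ f y, W - y⟫_ℝ - ⟪∇ f y, z - y⟫_ℝ := by
    rw [← inner_sub_right, sub_sub_sub_cancel_right]
  have hexpand : ‖y - W‖ ^ 2 = ‖z - y‖ ^ 2 - 2 * ⟪y - z, W - z⟫_ℝ + ‖z - W‖ ^ 2 := by
    rw [norm_sub_rev z y, norm_sub_rev z W, ← norm_sub_sq_real, sub_sub_sub_cancel_right]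
  rw [hexpand]
  linarith [h.le_apply y W, h.apply_le y z]

end IsConvexSmooth

end SmoothConvex

section FastGradient

theorem theta_one : theta 1 = 1 := rfl

theorem theta_succ {s : ℕ} (hs : 1 ≤ s) : theta (s + 1) = (1 + √(1 + 4 * theta s ^ 2)) / 2 := by
  obtain ⟨s, rfl⟩ := Nat.exists_eq_add_of_le' hs
  rfl

theorem theta_succ_sq {s : ℕ} (hs : 1 ≤ s) : theta (s + 1) ^ 2 - theta (s + 1) = theta s ^ 2 := by
  have hsqrt := Real.sq_sqrt (show (0 : ℝ) ≤ 1 + 4 * theta s ^ 2 by positivity)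
  rw [theta_succ hs]
  linear_combination hsqrt / 4

theorem add_one_div_two_le_theta {s : ℕ} (hs : 1 ≤ s) : ((s : ℝ) + 1) / 2 ≤ theta s := by
  induction s, hs using Nat.le_induction with
  | base => simp [theta_one]
  | succ s hs ih =>
    have hsqrt : 2 * theta s ≤ √(1 + 4 * theta s ^ 2) := Real.le_sqrt_of_sq_le (by linarith)
    rw [theta_succ hs]
    push_cast
    linarith

theorem one_le_theta {s : ℕ} (hs : 1 ≤ s) : 1 ≤ theta s := by
  have hs' : (1 : ℝ) ≤ s := mod_cast hs
  linarith [add_one_div_two_le_theta hs]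

theorem theta_le_theta_succ {s : ℕ} (hs : 1 ≤ s) : theta s ≤ theta (s + 1) := by
  have hsucc := one_le_theta (Nat.le_add_left 1 s)
  refine le_of_sq_le_sq ?_ (by linarith)
  linarith [theta_succ_sq hs]

theorem momentum_coeff_nonneg {s : ℕ} (hs : 1 ≤ s) : 0 ≤ (theta s - 1) / theta (s + 1) :=
  div_nonneg (sub_nonneg.2 (one_le_theta hs)) (by linarith [one_le_theta (Nat.le_add_left 1 s)])

theorem momentum_coeff_le_one {s : ℕ} (hs : 1 ≤ s) : (theta s - 1) / theta (s + 1) ≤ 1 :=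
  div_le_one_of_le₀ (by linarith [theta_le_theta_succ hs])
    (by linarith [one_le_theta (Nat.le_add_left 1 s)])

variable {E : Type*} [NormedAddCommGroup E] [InnerProductSpace ℝ E] [CompleteSpace E]
  {f : E → ℝ} {β : ℝ} {B : Set E} {Xs : E} {S : ℕ} {x y : ℕ → E}

/-- `x` and `y` are the iterates of `S` steps of the fast projected gradient method for `f` over
`B` with step size `1 / β`; indices start at `1`. -/
structure IsFastGradient (f : E → ℝ) (β : ℝ) (B : Set E) (S : ℕ) (x y : ℕ → E) : Prop where
  init_mem : x 1 ∈ B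
  init_eq : y 1 = x 1
  step : ∀ s, 1 ≤ s → s ≤ S → ProjGradStep f β B (y s) (x (s + 1))
  momentum : ∀ s, 1 ≤ s → s ≤ S →
    y (s + 1) = x (s + 1) + ((theta s - 1) / theta (s + 1)) • (x (s + 1) - x s)

/-- Compare the step with the point `(1 - 1 / θ) • x + (1 / θ) • Xs` of `B`. -/
theorem IsConvexSmooth.potential_le (h : IsConvexSmooth f β) (hβ : 0 < β) (hB : Convex ℝ B)
    (hXs : Xs ∈ B) {x y z : E} (hx : x ∈ B) (hz : ProjGradStep f β B y z) {θ : ℝ} (hθ : 1 ≤ θ) :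
    θ ^ 2 * (f z - f Xs) + β / 2 * ‖θ • z - (θ - 1) • x - Xs‖ ^ 2 ≤
      (θ ^ 2 - θ) * (f x - f Xs) + β / 2 * ‖θ • y - (θ - 1) • x - Xs‖ ^ 2 := by
  have hθ0 : 0 < θ := by linarith
  have hle : 0 ≤ 1 - 1 / θ := sub_nonneg.2 ((div_le_one hθ0).2 hθ)
  set W := (1 - 1 / θ) • x + (1 / θ) • Xs with hW
  have hWB : W ∈ B := hB hx hXs hle (by positivity) (by ring)
  have hfW : f W ≤ (1 - 1 / θ) * f x + 1 / θ * f Xs :=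
    h.convexOn.2 (Set.mem_univ x) (Set.mem_univ Xs) hle (by positivity) (by ring)
  have hnorm (p : E) : ‖θ • p - (θ - 1) • x - Xs‖ ^ 2 = θ ^ 2 * ‖p - W‖ ^ 2 := by
    have hscale : θ • p - (θ - 1) • x - Xs = θ • (p - W) := by
      rw [hW, smul_sub, smul_add, smul_smul, smul_smul, mul_sub, mul_one,
        mul_one_div_cancel hθ0.ne', one_smul, sub_add_eq_sub_sub]
    rw [hscale, norm_smul, mul_pow, Real.norm_eq_abs, sq_abs]
  have hstep : θ ^ 2 * (f z - ((1 - 1 / θ) * f x + 1 / θ * f Xs)) ≤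
      θ ^ 2 * (β / 2 * (‖y - W‖ ^ 2 - ‖z - W‖ ^ 2)) := by
    gcongr
    linarith [h.sub_le_of_projGradStep hβ hz hWB]
  have hsplit : θ ^ 2 * (f z - ((1 - 1 / θ) * f x + 1 / θ * f Xs)) =
      θ ^ 2 * (f z - f Xs) - (θ ^ 2 - θ) * (f x - f Xs) := by
    field_simp
    ring
  rw [hnorm, hnorm]
  linarith

namespace IsFastGradient

theorem mem (h : IsFastGradient f β B S x y) {s : ℕ} (hs : 1 ≤ s) (hsS : s ≤ S + 1) : x s ∈ B := by
  obtain ⟨s, rfl⟩ := Nat.exists_eq_add_of_le' hs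
  rcases Nat.eq_zero_or_pos s with rfl | hs
  · exact h.init_mem
  · exact (h.step s hs (Nat.succ_le_succ_iff.1 hsS)).1

theorem potential_le (h : IsFastGradient f β B S x y) (hf : IsConvexSmooth f β) (hβ : 0 < β)
    (hB : Convex ℝ B) (hXs : Xs ∈ B) {s : ℕ} (hs : 1 ≤ s) (hsS : s ≤ S) :
    theta s ^ 2 * (f (x (s + 1)) - f Xs) +
      β / 2 * ‖theta s • x (s + 1) - (theta s - 1) • x s - Xs‖ ^ 2 ≤ β / 2 * ‖x 1 - Xs‖ ^ 2 := by
  induction s, hs using Nat.le_induction with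
  | base =>
    have hfirst := hf.potential_le hβ hB hXs h.init_mem (h.step 1 le_rfl hsS) theta_one.ge
    simpa [h.init_eq, theta_one] using hfirst
  | succ s hs ih =>
    have hs1 : 1 ≤ s + 1 := Nat.le_add_left 1 s
    have hθ : theta (s + 1) ≠ 0 := by linarith [one_le_theta hs1]
    have hmom : theta (s + 1) • y (s + 1) - (theta (s + 1) - 1) • x (s + 1) =
        theta s • x (s + 1) - (theta s - 1) • x s := by
      rw [h.momentum s hs (by lia), smul_add, smul_smul, mul_div_cancel₀ _ hθ]
      module
    refine (hf.potential_le hβ hB hXs (h.mem hs1 (by lia)) (h.step _ hs1 hsS)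
      (one_le_theta hs1)).trans ?_
    rw [theta_succ_sq hs, hmom]
    exact ih (by lia)

theorem sub_le (h : IsFastGradient f β B S x y) (hf : IsConvexSmooth f β) (hβ : 0 < β)
    (hB : Convex ℝ B) (hXs : Xs ∈ B) (hmin : IsMinOn f B Xs) {s : ℕ} (hs : 1 ≤ s) (hsS : s ≤ S) :
    ((s : ℝ) + 1) ^ 2 * (f (x (s + 1)) - f Xs) ≤ 2 * β * ‖x 1 - Xs‖ ^ 2 := by
  have hpot := h.potential_le hf hβ hB hXs hs hsS
  have hval : 0 ≤ f (x (s + 1)) - f Xs := sub_nonneg.2 (hmin (h.step s hs hsS).1)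
  have hnorm : 0 ≤ β / 2 * ‖theta s • x (s + 1) - (theta s - 1) • x s - Xs‖ ^ 2 := by positivity
  have htheta : (((s : ℝ) + 1) / 2) ^ 2 * (f (x (s + 1)) - f Xs) ≤
      theta s ^ 2 * (f (x (s + 1)) - f Xs) := by
    gcongr
    exact add_one_div_two_le_theta hs
  linarith

theorem mul_norm_sub_sq_le (h : IsFastGradient f β B S x y) (hf : IsConvexSmooth f β) (hβ : 0 < β)
    (hB : Convex ℝ B) (hXs : Xs ∈ B) (hmin : IsMinOn f B Xs) {γ : ℝ}
    (hqg : ∀ X ∈ B, γ * ‖X - Xs‖ ^ 2 ≤ f X - f Xs) {s : ℕ} (hs : 1 ≤ s) (hsS : s ≤ S) :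
    γ * ‖x (s + 1) - Xs‖ ^ 2 ≤ β / 2 * ‖x 1 - Xs‖ ^ 2 := by
  have hmem := (h.step s hs hsS).1
  have hval : 0 ≤ f (x (s + 1)) - f Xs := sub_nonneg.2 (hmin hmem)
  have hs1 : (1 : ℝ) ≤ s := mod_cast hs
  have htwo : (2 : ℝ) ^ 2 * (f (x (s + 1)) - f Xs) ≤
      ((s : ℝ) + 1) ^ 2 * (f (x (s + 1)) - f Xs) := by
    gcongr
    linarith
  linarith [h.sub_le hf hβ hB hXs hmin hs hsS, hqg _ hmem]

/-- The bound after at least one step is three times the bound on `x`, as the momentum coefficient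
is at most `1`. -/
theorem norm_extrapolation_sub_le (h : IsFastGradient f β B S x y) (hf : IsConvexSmooth f β)
    (hβ : 0 < β) (hB : Convex ℝ B) (hXs : Xs ∈ B) (hmin : IsMinOn f B Xs) {γ : ℝ} (hγ : 0 < γ)
    (hqg : ∀ X ∈ B, γ * ‖X - Xs‖ ^ 2 ≤ f X - f Xs) {R : ℝ} (hR : 0 ≤ R)
    (hdist : 9 * β * ‖x 1 - Xs‖ ^ 2 ≤ 2 * γ * R ^ 2) (hS : 1 ≤ S) :
    ‖y (S + 1) - Xs‖ ≤ R := by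
  have hx {s : ℕ} (hs : 1 ≤ s) (hsS : s ≤ S) : ‖x (s + 1) - Xs‖ ≤ R / 3 := by
    have hsq : γ * ‖x (s + 1) - Xs‖ ^ 2 ≤ γ * (R / 3) ^ 2 := by
      linarith [h.mul_norm_sub_sq_le hf hβ hB hXs hmin hqg hs hsS]
    exact le_of_sq_le_sq (le_of_mul_le_mul_left hsq hγ) (by positivity)
  have hincr : (theta S - 1) / theta (S + 1) * ‖x (S + 1) - x S‖ ≤ R / 3 + R / 3 := by
    obtain ⟨S, rfl⟩ := Nat.exists_eq_add_of_le' hS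
    rcases Nat.eq_zero_or_pos S with rfl | hS0
    · rw [zero_add, theta_one, sub_self, zero_div, zero_mul]
      positivity
    · refine (mul_le_of_le_one_left (norm_nonneg _) (momentum_coeff_le_one hS)).trans ?_
      rw [← dist_eq_norm]
      refine (dist_triangle_right _ _ Xs).trans (add_le_add ?_ ?_) <;> rw [dist_eq_norm]
      exacts [hx hS le_rfl, hx hS0 (Nat.le_succ S)]
  have hy : y (S + 1) - Xs =
      (x (S + 1) - Xs) + ((theta S - 1) / theta (S + 1)) • (x (S + 1) - x S) := by
    rw [h.momentum S hS le_rfl, add_sub_right_comm]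
  rw [hy]
  refine (norm_add_le _ _).trans ?_
  rw [norm_smul, Real.norm_of_nonneg (momentum_coeff_nonneg hS)]
  linarith [hx hS le_rfl]

end IsFastGradient

end FastGradient

section RankOne

/-- The real tensor representing the functional `W ↦ N⁻¹ Re ⟪W̄⁽ⁱ⁾ v, u⟫`. -/
def rankOneTensor (i : SliceIdx n) (u : EuclideanSpace ℂ (Fin n₁)) (v : EuclideanSpace ℂ (Fin n₂)) :
    Tensor n₁ n₂ n :=
  realInvDFT fun j => if j = i then
    Matrix.toEuclideanLin.symm (InnerProductSpace.rankOne ℂ u v).toLinearMap else 0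

theorem frobInner_rankOne {𝕜 E F : Type*} [RCLike 𝕜] [NormedAddCommGroup E]
    [InnerProductSpace 𝕜 E] [FiniteDimensional 𝕜 E] [NormedAddCommGroup F]
    [InnerProductSpace 𝕜 F] [FiniteDimensional 𝕜 F] (T : E →ₗ[𝕜] F) (u : F) (v : E) :
    frobInner T (InnerProductSpace.rankOne 𝕜 u v).toLinearMap = RCLike.re ⟪T v, u⟫_𝕜 := by
  let b := stdOrthonormalBasis 𝕜 E
  rw [frobInner_eq_sum _ _ b]
  conv_rhs => rw [← b.sum_repr' v, map_sum, sum_inner, map_sum]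
  refine Finset.sum_congr rfl fun j _ => ?_
  rw [map_smul, inner_smul_left, inner_conj_symm]
  simp [InnerProductSpace.rankOne_apply, inner_smul_right]

theorem inner_rankOneTensor (W : Tensor n₁ n₂ n) (i : SliceIdx n) (u : EuclideanSpace ℂ (Fin n₁))
    (v : EuclideanSpace ℂ (Fin n₂)) :
    ⟪W, rankOneTensor i u v⟫_ℝ = 1 / (numSlices n : ℝ) * (⟪slice i W v, u⟫_ℂ).re := by
  rw [rankOneTensor, inner_realInvDFT, Finset.sum_eq_single i]
  · rw [if_pos rfl, LinearEquiv.apply_symm_apply, frobInner_rankOne]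
    rfl
  · intro j _ hj
    simp [hj, frobInner]
  · simp

theorem sliceBound_sqrt_mul_norm [∀ j, NeZero (n j)] (W : Tensor n₁ n₂ n) :
    SliceBound W (√(numSlices n) * ‖W‖) := by
  intro i x
  refine (norm_apply_le_sqrt_frobInner_mul _ x).trans ?_
  gcongr
  rw [← Real.sqrt_sq (norm_nonneg W), ← Real.sqrt_mul (Nat.cast_nonneg _), ← sum_frobInner_self]
  exact Real.sqrt_le_sqrt (Finset.single_le_sum
    (f := fun i => frobInner (slice i W) (slice i W)) (fun i _ => frobInner_self_nonneg _)
    (Finset.mem_univ i))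

end RankOne

section BlockDiagonal

variable {𝕜 ι m p : Type*} [RCLike 𝕜]

/-- The components of a vector in the `i`-th block. -/
def blockProj (i : ι) : EuclideanSpace 𝕜 (m × ι) →ₗ[𝕜] EuclideanSpace 𝕜 m where
  toFun w := WithLp.toLp 2 fun b => w (b, i)
  map_add' _ _ := rfl
  map_smul' _ _ := rfl

theorem blockProj_apply (i : ι) (w : EuclideanSpace 𝕜 (m × ι)) (b : m) :
    blockProj i w b = w (b, i) := rfl

theorem norm_sq_eq_sum_blockProj [Fintype ι] [Fintype m] (w : EuclideanSpace 𝕜 (m × ι)) :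
    ‖w‖ ^ 2 = ∑ i, ‖blockProj i w‖ ^ 2 := by
  simp only [EuclideanSpace.norm_sq_eq, blockProj_apply]
  rw [Fintype.sum_prod_type, Finset.sum_comm]

variable [DecidableEq ι]

/-- The vector supported on the `i`-th block. -/
def blockIncl (i : ι) : EuclideanSpace 𝕜 m →ₗ[𝕜] EuclideanSpace 𝕜 (m × ι) where
  toFun x := WithLp.toLp 2 fun p => if p.2 = i then x p.1 else 0
  map_add' x y := by ext p; by_cases h : p.2 = i <;> simp [h]
  map_smul' c x := by ext p; by_cases h : p.2 = i <;> simp [h]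

theorem blockIncl_apply (i : ι) (x : EuclideanSpace 𝕜 m) (p : m × ι) :
    blockIncl i x p = if p.2 = i then x p.1 else 0 := rfl

theorem blockProj_blockIncl (i j : ι) (x : EuclideanSpace 𝕜 m) :
    blockProj j (blockIncl i x) = if j = i then x else 0 := by
  ext b
  rw [blockProj_apply, blockIncl_apply]
  split_ifs <;> simp

variable [Fintype ι] [Fintype p] [DecidableEq p] (M : ι → Matrix m p 𝕜)

theorem blockProj_blockDiagonal_apply (i : ι) (w : EuclideanSpace 𝕜 (p × ι)) :
    blockProj i (Matrix.toEuclideanLin (Matrix.blockDiagonal M) w) =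
      Matrix.toEuclideanLin (M i) (blockProj i w) := by
  ext a
  simp only [blockProj_apply, Matrix.toLpLin_apply, Matrix.mulVec, dotProduct,
    Fintype.sum_prod_type, Matrix.blockDiagonal_apply]
  refine Finset.sum_congr rfl fun b _ => ?_
  simp

theorem blockDiagonal_apply_blockIncl (i : ι) (x : EuclideanSpace 𝕜 p) :
    Matrix.toEuclideanLin (Matrix.blockDiagonal M) (blockIncl i x) =
      blockIncl i (Matrix.toEuclideanLin (M i) x) := by
  ext ⟨a, j⟩
  rw [← blockProj_apply, blockProj_blockDiagonal_apply, blockProj_blockIncl, blockIncl_apply]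
  dsimp only
  split_ifs with h
  · rw [h]
  · simp

variable [Fintype m]

theorem inner_blockIncl (i : ι) (x : EuclideanSpace 𝕜 m) (w : EuclideanSpace 𝕜 (m × ι)) :
    ⟪blockIncl i x, w⟫_𝕜 = ⟪x, blockProj i w⟫_𝕜 := by
  simp only [PiLp.inner_apply, Fintype.sum_prod_type, blockIncl_apply, blockProj_apply]
  refine Finset.sum_congr rfl fun b _ => ?_
  rw [Finset.sum_eq_single i]
  · simp
  · intro j _ hj
    simp [hj]
  · simp

theorem norm_blockIncl (i : ι) (x : EuclideanSpace 𝕜 m) : ‖blockIncl i x‖ = ‖x‖ := by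
  rw [← sq_eq_sq₀ (norm_nonneg _) (norm_nonneg _), ← inner_self_eq_norm_sq (𝕜 := 𝕜),
    inner_blockIncl, blockProj_blockIncl, if_pos rfl, inner_self_eq_norm_sq]

theorem norm_apply_le_singularValues_blockDiagonal_mul (i : ι) (x : EuclideanSpace 𝕜 p) :
    ‖Matrix.toEuclideanLin (M i) x‖ ≤
      (Matrix.toEuclideanLin (Matrix.blockDiagonal M)).singularValues 0 * ‖x‖ := by
  rw [← norm_blockIncl i, ← blockDiagonal_apply_blockIncl, ← norm_blockIncl i x]
  exact norm_apply_le_singularValues_zero_mul _ _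

variable {M}

theorem norm_blockDiagonal_apply_le {c : ℝ} (hc : 0 ≤ c)
    (hM : ∀ i x, ‖Matrix.toEuclideanLin (M i) x‖ ≤ c * ‖x‖) (w : EuclideanSpace 𝕜 (p × ι)) :
    ‖Matrix.toEuclideanLin (Matrix.blockDiagonal M) w‖ ≤ c * ‖w‖ := by
  refine le_of_sq_le_sq ?_ (by positivity)
  rw [mul_pow, norm_sq_eq_sum_blockProj, norm_sq_eq_sum_blockProj w, Finset.mul_sum]
  refine Finset.sum_le_sum fun i _ => ?_
  rw [blockProj_blockDiagonal_apply, ← mul_pow]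
  gcongr
  exact hM i _

theorem norm_blockDiagonal_apply_eq {w : EuclideanSpace 𝕜 (p × ι)}
    (hM : ∀ i, ‖Matrix.toEuclideanLin (M i) (blockProj i w)‖ = ‖blockProj i w‖) :
    ‖Matrix.toEuclideanLin (Matrix.blockDiagonal M) w‖ = ‖w‖ := by
  rw [← sq_eq_sq₀ (norm_nonneg _) (norm_nonneg _), norm_sq_eq_sum_blockProj,
    norm_sq_eq_sum_blockProj w]
  exact Finset.sum_congr rfl fun i _ => by rw [blockProj_blockDiagonal_apply, hM]

end BlockDiagonal

section Contraction

variable {𝕜 E F : Type*} [RCLike 𝕜] [NormedAddCommGroup E] [InnerProductSpace 𝕜 E]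
  [FiniteDimensional 𝕜 E] [NormedAddCommGroup F] [InnerProductSpace 𝕜 F] [FiniteDimensional 𝕜 F]
  {Q T : E →ₗ[𝕜] F}

theorem norm_adjoint_apply_le (hQ : ∀ x, ‖Q x‖ ≤ ‖x‖) (y : F) : ‖Q.adjoint y‖ ≤ ‖y‖ := by
  have hmul : ‖Q.adjoint y‖ * ‖Q.adjoint y‖ ≤ ‖Q.adjoint y‖ * ‖y‖ := by
    calc ‖Q.adjoint y‖ * ‖Q.adjoint y‖ = RCLike.re ⟪Q (Q.adjoint y), y⟫_𝕜 := by
          rw [← LinearMap.adjoint_inner_right, inner_self_eq_norm_mul_norm]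
      _ ≤ ‖Q (Q.adjoint y)‖ * ‖y‖ := re_inner_le_norm _ _
      _ ≤ ‖Q.adjoint y‖ * ‖y‖ := by gcongr; exact hQ _
  nlinarith [norm_nonneg y]

theorem adjoint_apply_apply_eq_iff (hQ : ∀ x, ‖Q x‖ ≤ ‖x‖) {x : E} :
    Q.adjoint (Q x) = x ↔ ‖Q x‖ = ‖x‖ := by
  refine ⟨fun h => ?_, fun h => ?_⟩
  · rw [← sq_eq_sq₀ (norm_nonneg _) (norm_nonneg _), ← inner_self_eq_norm_sq (𝕜 := 𝕜),
      ← LinearMap.adjoint_inner_right, h, inner_self_eq_norm_sq]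
  · have hadj := pow_le_pow_left₀ (norm_nonneg _) (norm_adjoint_apply_le hQ (Q x)) 2
    have hsub : ‖Q.adjoint (Q x) - x‖ ^ 2 ≤ 0 := by
      rw [norm_sub_sq (𝕜 := 𝕜), LinearMap.adjoint_inner_left, inner_self_eq_norm_sq, ← h]
      linarith
    rw [← sub_eq_zero, ← norm_eq_zero]
    exact pow_eq_zero_iff two_ne_zero |>.1 (hsub.antisymm (sq_nonneg _))

/-- The equality case `Q* Q x = x` of the contraction property. -/
theorem inner_map_map_of_norm_eq (hQ : ∀ x, ‖Q x‖ ≤ ‖x‖) {x : E} (hx : ‖Q x‖ = ‖x‖) (v : E) :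
    ⟪Q x, Q v⟫_𝕜 = ⟪x, v⟫_𝕜 := by
  rw [← LinearMap.adjoint_inner_left, (adjoint_apply_apply_eq_iff hQ).2 hx]

theorem norm_map_eq_of_mem_span (hQ : ∀ x, ‖Q x‖ ≤ ‖x‖) {s : Set E} (hs : ∀ x ∈ s, ‖Q x‖ = ‖x‖)
    {x : E} (hx : x ∈ Submodule.span 𝕜 s) : ‖Q x‖ = ‖x‖ := by
  have hspan : Submodule.span 𝕜 s ≤ LinearMap.eqLocus (Q.adjoint ∘ₗ Q) LinearMap.id :=
    Submodule.span_le.2 fun y hy => (adjoint_apply_apply_eq_iff hQ).2 (hs y hy)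
  exact (adjoint_apply_apply_eq_iff hQ).1 (hspan hx)

/-- The bound holds on the whole space `(S ⊓ Vᗮ) ⊔ V`, since `Q` preserves orthogonality to `V`. -/
theorem min_one_le_singularValues (hQ : ∀ x, ‖Q x‖ ≤ ‖x‖) {V S : Submodule 𝕜 E}
    (hV : ∀ x ∈ V, ‖Q x‖ = ‖x‖) {j : ℕ} (hj : j < finrank 𝕜 S) {a : ℝ} (ha : 0 ≤ a)
    (hS : ∀ x ∈ S ⊓ Vᗮ, a * ‖x‖ ≤ ‖Q x‖) : min 1 a ≤ Q.singularValues j := by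
  have hfin : j < finrank 𝕜 ↥((S ⊓ Vᗮ) ⊔ V) := by
    have hsup := Submodule.finrank_sup_add_finrank_inf_eq S Vᗮ
    have hle := Submodule.finrank_le (S ⊔ Vᗮ)
    have hV := Submodule.finrank_add_finrank_orthogonal V
    have hdisj := Submodule.finrank_sup_add_finrank_inf_eq (S ⊓ Vᗮ) V
    rw [(V.orthogonal_disjoint.symm.mono_left inf_le_right).eq_bot, finrank_bot] at hdisj
    omega
  refine le_singularValues Q _ hfin fun x hx => ?_
  obtain ⟨y, hy, z, hz, rfl⟩ := Submodule.mem_sup.1 hx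
  have hzy : ⟪z, y⟫_𝕜 = 0 := hy.2 z hz
  have hmin : 0 ≤ min 1 a := le_min zero_le_one ha
  have hysq : min 1 a ^ 2 * ‖y‖ ^ 2 ≤ ‖Q y‖ ^ 2 := by
    rw [← mul_pow]
    gcongr
    exact (mul_le_mul_of_nonneg_right (min_le_right _ _) (norm_nonneg y)).trans (hS y hy)
  have hzsq : min 1 a ^ 2 * ‖z‖ ^ 2 ≤ ‖z‖ ^ 2 :=
    mul_le_of_le_one_left (sq_nonneg ‖z‖) (pow_le_one₀ hmin (min_le_left _ _))
  refine le_of_sq_le_sq ?_ (norm_nonneg _)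
  rw [add_comm y z, map_add, mul_pow, norm_add_sq (𝕜 := 𝕜), norm_add_sq (𝕜 := 𝕜),
    inner_map_map_of_norm_eq hQ (hV z hz), hzy, hV z hz]
  simp only [map_zero, mul_zero, add_zero, mul_add]
  linarith

theorem norm_apply_le_singularValues_finrank_mul (hQ : ∀ x, ‖Q x‖ ≤ ‖x‖) {R : Submodule 𝕜 E}
    (hR : ∀ x ∈ R, ‖Q x‖ = ‖x‖) {w : E} (hw : w ∈ Rᗮ) :
    ‖Q w‖ ≤ Q.singularValues (finrank 𝕜 R) * ‖w‖ := by
  rcases eq_or_ne w 0 with rfl | hw0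
  · simp
  have hwpos : 0 < ‖w‖ := norm_pos_iff.2 hw0
  have hfin : finrank 𝕜 R < finrank 𝕜 ↥(R ⊔ Submodule.span 𝕜 {w}) := by
    refine Submodule.finrank_lt_finrank_of_lt (left_lt_sup.2 fun hle => hw0 ?_)
    have hwR := hle (Submodule.mem_span_singleton_self w)
    exact inner_self_eq_zero.1 (hw w hwR)
  have hmin := min_one_le_singularValues hQ hR hfin (a := ‖Q w‖ / ‖w‖) (by positivity) ?_
  · rwa [min_eq_right ((div_le_one hwpos).2 (hQ w)), div_le_iff₀ hwpos] at hmin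
  rintro x ⟨hx, hxR⟩
  obtain ⟨y, hy, z, hz, rfl⟩ := Submodule.mem_sup.1 hx
  obtain ⟨c, rfl⟩ := Submodule.mem_span_singleton.1 hz
  have hyR : y ∈ Rᗮ := by simpa using Rᗮ.sub_mem hxR (Rᗮ.smul_mem c hw)
  have hy0 : y = 0 := inner_self_eq_zero.1 (hyR y hy)
  rw [hy0, zero_add, map_smul, norm_smul, norm_smul]
  exact (by field_simp : ‖Q w‖ / ‖w‖ * (‖c‖ * ‖w‖) = ‖c‖ * ‖Q w‖).le

namespace IsRightSVBasis

variable {q : ℕ} {c : ℕ → ℝ} {b : OrthonormalBasis (Fin q) 𝕜 E}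

/-- The equality case of `frobInner_le_of_bound`. -/
theorem apply_eq_smul_of_frobInner_eq (hb : IsRightSVBasis T T.singularValues b)
    (hQ : ∀ x, ‖Q x‖ ≤ ‖x‖) (h : frobInner Q T = ∑ j : Fin q, T.singularValues j) (j : Fin q) :
    T (b j) = (T.singularValues j : 𝕜) • Q (b j) := by
  have hQb (j : Fin q) : ‖Q (b j)‖ ≤ 1 := by simpa using hQ (b j)
  have hnorm (j : Fin q) : ‖T (b j)‖ = T.singularValues j := by
    rw [hb.norm_apply j, abs_of_nonneg (T.singularValues_nonneg j)]
  have hle (j : Fin q) (_ : j ∈ Finset.univ) :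
      RCLike.re ⟪Q (b j), T (b j)⟫_𝕜 ≤ T.singularValues j := by
    refine (re_inner_le_norm _ _).trans ?_
    rw [hnorm]
    exact mul_le_of_le_one_left (T.singularValues_nonneg j) (hQb j)
  rw [frobInner_eq_sum _ _ b] at h
  have heq := (Finset.sum_eq_sum_iff_of_le hle).1 h j (Finset.mem_univ j)
  set s := T.singularValues j
  have hs : 0 ≤ s := T.singularValues_nonneg j
  have hsub : ‖T (b j) - (s : 𝕜) • Q (b j)‖ ^ 2 ≤ 0 := by
    rw [norm_sub_sq (𝕜 := 𝕜), inner_smul_right, norm_smul, hnorm, RCLike.re_ofReal_mul,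
      inner_re_symm, heq, RCLike.norm_of_nonneg hs, mul_pow]
    nlinarith [mul_le_of_le_one_right (sq_nonneg s) (pow_le_one₀ (n := 2) (norm_nonneg _) (hQb j))]
  exact sub_eq_zero.1 (norm_eq_zero.1 (pow_eq_zero_iff two_ne_zero |>.1
    (hsub.antisymm (sq_nonneg _))))

end IsRightSVBasis

theorem norm_apply_eq_of_mem_ker_orthogonal {q : ℕ} (hq : finrank 𝕜 E = q)
    (hQ : ∀ x, ‖Q x‖ ≤ ‖x‖) (h : frobInner Q T = ∑ j : Fin q, T.singularValues j) {x : E}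
    (hx : x ∈ T.kerᗮ) : ‖Q x‖ = ‖x‖ := by
  obtain ⟨b, hb⟩ := exists_isRightSVBasis T hq
  refine norm_map_eq_of_mem_span hQ ?_ (hb.ker_orthogonal_le_span hx)
  rintro _ ⟨j, hj, rfl⟩
  have hmul := congrArg norm (hb.apply_eq_smul_of_frobInner_eq hQ h j)
  rw [hb.norm_apply j, norm_smul, RCLike.norm_ofReal] at hmul
  rw [b.norm_eq_one]
  exact mul_left_cancel₀ (abs_ne_zero.2 hj) (by rw [← hmul, mul_one])

end Contraction

section DualCertificate

/-- `Q` is a dual certificate of the point `Xs` of the unit ball: it lies in the dual unit ball and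
attains the value one at `Xs`, so that it exposes a face of the unit ball containing `Xs`. -/
structure IsCertificate (Q Xs : Tensor n₁ n₂ n) : Prop where
  mem : Xs ∈ ball n₁ n₂ n
  bound : SliceBound Q 1
  inner_eq : ⟪Q, Xs⟫_ℝ = 1

theorem rank_bdiag (X : Tensor n₁ n₂ n) :
    (bdiag X).rank = finrank ℂ (Matrix.toEuclideanLin (bdiag X)).range :=
  Matrix.rank_eq_finrank_range_toLin (bdiag X)
    (EuclideanSpace.basisFun (Fin n₁ × SliceIdx n) ℂ).toBasis
    (EuclideanSpace.basisFun (Fin n₂ × SliceIdx n) ℂ).toBasis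

variable {Q Xs : Tensor n₁ n₂ n}

namespace IsCertificate

theorem norm_apply_le (h : IsCertificate Q Xs) (i : SliceIdx n) (x : EuclideanSpace ℂ (Fin n₂)) :
    ‖slice i Q x‖ ≤ ‖x‖ := by
  simpa using h.bound i x

variable [∀ j, NeZero (n j)]

theorem tnn_eq_one (h : IsCertificate Q Xs) : tnn Xs = 1 := by
  refine le_antisymm h.mem ?_
  simpa [h.inner_eq] using inner_le_of_sliceBound (X := Xs) h.bound

theorem frobInner_eq (h : IsCertificate Q Xs) (i : SliceIdx n) :
    frobInner (slice i Q) (slice i Xs) = ∑ j : Fin n₂, (slice i Xs).singularValues j := by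
  have hN : (0 : ℝ) < numSlices n := Nat.cast_pos.2 numSlices_pos
  have hsum := h.inner_eq.trans h.tnn_eq_one.symm
  rw [inner_eq_sum_frobInner, tnn_eq] at hsum
  have hle (i : SliceIdx n) (_ : i ∈ Finset.univ) : frobInner (slice i Q) (slice i Xs) ≤
      ∑ j : Fin n₂, (slice i Xs).singularValues j := by
    simpa using frobInner_le_of_bound (T := slice i Xs) finrank_euclideanSpace_fin (h.bound i)
  exact (Finset.sum_eq_sum_iff_of_le hle).1 (mul_left_cancel₀ (by positivity) hsum) i
    (Finset.mem_univ i)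

theorem norm_apply_eq (h : IsCertificate Q Xs) {i : SliceIdx n} {x : EuclideanSpace ℂ (Fin n₂)}
    (hx : x ∈ (slice i Xs).kerᗮ) : ‖slice i Q x‖ = ‖x‖ :=
  norm_apply_eq_of_mem_ker_orthogonal finrank_euclideanSpace_fin (h.norm_apply_le i)
    (h.frobInner_eq i) hx

theorem norm_apply_le_of_mem_ker (h : IsCertificate Q Xs) {i : SliceIdx n}
    {v : EuclideanSpace ℂ (Fin n₂)} (hv : v ∈ (slice i Xs).ker) :
    ‖slice i Q v‖ ≤ sval (bdiag Q) (bdiag Xs).rank * ‖v‖ := by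
  let M := Matrix.toEuclideanLin (Matrix.blockDiagonal (fslice Xs))
  let H := Matrix.toEuclideanLin (Matrix.blockDiagonal (fslice Q))
  have hincl {i : SliceIdx n} {y : EuclideanSpace ℂ (Fin n₂)} (hy : y ∈ (slice i Xs).ker) :
      blockIncl i y ∈ M.ker := by
    simp only [M, LinearMap.mem_ker]
    rw [blockDiagonal_apply_blockIncl, ← slice_apply, LinearMap.mem_ker.1 hy, map_zero]
  have hH (w : EuclideanSpace ℂ (Fin n₂ × SliceIdx n)) : ‖H w‖ ≤ ‖w‖ :=
    (norm_blockDiagonal_apply_le zero_le_one h.bound w).trans_eq (one_mul _)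
  have hisom (w : EuclideanSpace ℂ (Fin n₂ × SliceIdx n)) (hw : w ∈ M.kerᗮ) : ‖H w‖ = ‖w‖ :=
    norm_blockDiagonal_apply_eq fun i => h.norm_apply_eq fun y hy => by
      rw [← inner_blockIncl]
      exact hw _ (hincl hy)
  have hfin : finrank ℂ M.kerᗮ = (bdiag Xs).rank := by
    rw [LinearMap.orthogonal_ker, LinearMap.finrank_range_adjoint, rank_bdiag]
    rfl
  have hw := norm_apply_le_singularValues_finrank_mul hH hisom
    (Submodule.le_orthogonal_orthogonal _ (hincl hv))
  have hHv : H (blockIncl i v) = blockIncl i (slice i Q v) := blockDiagonal_apply_blockIncl _ _ _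
  rwa [hfin, hHv, norm_blockIncl, norm_blockIncl] at hw

theorem inner_eq_sum (h : IsCertificate Q Xs)
    {b : SliceIdx n → OrthonormalBasis (Fin n₂) ℂ (EuclideanSpace ℂ (Fin n₂))}
    (hb : ∀ i, IsRightSVBasis (slice i Xs) (slice i Xs).singularValues (b i))
    (W : Tensor n₁ n₂ n) : ⟪W, Xs⟫_ℝ = 1 / (numSlices n : ℝ) *
      ∑ i, ∑ j : Fin n₂, (slice i Xs).singularValues j *
        (⟪slice i W (b i j), slice i Q (b i j)⟫_ℂ).re := by
  rw [inner_eq_sum_frobInner]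
  congr 1
  refine Finset.sum_congr rfl fun i _ => ?_
  rw [frobInner_eq_sum _ _ (b i)]
  refine Finset.sum_congr rfl fun j _ => ?_
  rw [(hb i).apply_eq_smul_of_frobInner_eq (h.norm_apply_le i) (h.frobInner_eq i) j,
    inner_smul_right]
  exact Complex.re_ofReal_mul _ _

end IsCertificate

end DualCertificate

section FaceSpan

variable {Q Xs : Tensor n₁ n₂ n}

/-- The linear span of the smallest face of the unit ball exposed by the certificate `Q` of
`Xs`. -/
def faceSpan (Q Xs : Tensor n₁ n₂ n) : Submodule ℝ (Tensor n₁ n₂ n) :=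
  Submodule.span ℝ {Z | ∃ i, ∃ x ∈ (slice i Xs).kerᗮ, Z = rankOneTensor i (slice i Q x) x}

variable [∀ j, NeZero (n j)]

theorem re_inner_eq_zero_of_mem_faceSpan_orthogonal {W : Tensor n₁ n₂ n}
    (hW : W ∈ (faceSpan Q Xs)ᗮ) {i : SliceIdx n} {x : EuclideanSpace ℂ (Fin n₂)}
    (hx : x ∈ (slice i Xs).kerᗮ) : RCLike.re ⟪slice i W x, slice i Q x⟫_ℂ = 0 := by
  have hN : (numSlices n : ℝ) ≠ 0 := Nat.cast_ne_zero.2 numSlices_pos.ne'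
  have hinner := (Submodule.mem_orthogonal' _ _).1 hW _ (Submodule.subset_span ⟨i, x, hx, rfl⟩)
  rw [inner_rankOneTensor] at hinner
  exact (mul_eq_zero_iff_left (one_div_ne_zero hN)).1 hinner

theorem IsCertificate.mem_faceSpan (h : IsCertificate Q Xs) : Xs ∈ faceSpan Q Xs := by
  rw [← Submodule.orthogonal_orthogonal (faceSpan Q Xs), Submodule.mem_orthogonal]
  intro W hW
  choose b hb using fun i => exists_isRightSVBasis (slice i Xs) finrank_euclideanSpace_fin
  rw [h.inner_eq_sum hb]
  refine mul_eq_zero_of_right _ (Finset.sum_eq_zero fun i _ => Finset.sum_eq_zero fun j _ => ?_)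
  rcases eq_or_ne ((slice i Xs).singularValues j) 0 with h0 | h0
  · rw [h0, zero_mul]
  · exact mul_eq_zero_of_right _
      (re_inner_eq_zero_of_mem_faceSpan_orthogonal hW ((hb i).mem_ker_orthogonal h0))

end FaceSpan

section TransversalGrowth

section Contraction

variable {𝕜 E F : Type*} [RCLike 𝕜] [NormedAddCommGroup E] [InnerProductSpace 𝕜 E]
  [NormedAddCommGroup F] [InnerProductSpace 𝕜 F]
  {Q W : E →ₗ[𝕜] F} {V : Submodule 𝕜 E} {q p : E}

theorem re_inner_map_add_le (hQ : ∀ x, ‖Q x‖ ≤ ‖x‖) {w : ℝ}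
    (hW : ∀ x, ‖W x‖ ≤ w * ‖x‖) (hQW : ∀ x ∈ V, RCLike.re ⟪W x, Q x⟫_𝕜 = 0) (hq : q ∈ V)
    (hp : p ∈ Vᗮ) : RCLike.re ⟪Q (q + p), W (q + p)⟫_𝕜 ≤ 2 * w * ‖p‖ * ‖q + p‖ := by
  have hqle : ‖q‖ ≤ ‖q + p‖ := by
    refine le_of_sq_le_sq ?_ (norm_nonneg _)
    rw [norm_add_sq (𝕜 := 𝕜), hp q hq]
    simp
  have hsplit : RCLike.re ⟪Q (q + p), W (q + p)⟫_𝕜 =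
      RCLike.re ⟪Q q, W p⟫_𝕜 + RCLike.re ⟪Q p, W (q + p)⟫_𝕜 := by
    rw [map_add Q, inner_add_left, map_add RCLike.re, map_add W q p, inner_add_right,
      map_add RCLike.re, inner_re_symm (Q q), hQW q hq, zero_add]
  rw [hsplit]
  calc RCLike.re ⟪Q q, W p⟫_𝕜 + RCLike.re ⟪Q p, W (q + p)⟫_𝕜
      ≤ ‖q + p‖ * (w * ‖p‖) + ‖p‖ * (w * ‖q + p‖) :=
        add_le_add
          ((re_inner_le_norm _ _).trans (mul_le_mul ((hQ q).trans hqle) (hW p) (norm_nonneg _)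
            (norm_nonneg _)))
          ((re_inner_le_norm _ _).trans (mul_le_mul (hQ p) (hW _) (norm_nonneg _) (norm_nonneg _)))
    _ = 2 * w * ‖p‖ * ‖q + p‖ := by ring

variable [FiniteDimensional 𝕜 E] [FiniteDimensional 𝕜 F]

theorem norm_map_add_sq_le (hQ : ∀ x, ‖Q x‖ ≤ ‖x‖) (hV : ∀ x ∈ V, ‖Q x‖ = ‖x‖) {τ : ℝ}
    (hVτ : ∀ x ∈ Vᗮ, ‖Q x‖ ≤ τ * ‖x‖) (hq : q ∈ V) (hp : p ∈ Vᗮ) :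
    ‖Q (q + p)‖ ^ 2 ≤ ‖q + p‖ ^ 2 - (1 - τ ^ 2) * ‖p‖ ^ 2 := by
  have hpτ := pow_le_pow_left₀ (norm_nonneg _) (hVτ p hp) 2
  rw [map_add, norm_add_sq (𝕜 := 𝕜), norm_add_sq (𝕜 := 𝕜), inner_map_map_of_norm_eq hQ (hV q hq),
    hV q hq, hp q hq]
  linarith

/-- The condition `hQW` makes the effect of `W` on the norm of `Q` of second order. -/
theorem norm_map_add_map_sq_le (hQ : ∀ x, ‖Q x‖ ≤ ‖x‖) (hV : ∀ x ∈ V, ‖Q x‖ = ‖x‖) {τ : ℝ}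
    (hτ0 : 0 ≤ τ) (hτ : τ < 1) (hVτ : ∀ x ∈ Vᗮ, ‖Q x‖ ≤ τ * ‖x‖) {w : ℝ}
    (hW : ∀ x, ‖W x‖ ≤ w * ‖x‖) (hQW : ∀ x ∈ V, RCLike.re ⟪W x, Q x⟫_𝕜 = 0) (v : E) :
    ‖Q v + W v‖ ^ 2 ≤ (1 + (1 + 4 / (1 - τ ^ 2)) * w ^ 2) * ‖v‖ ^ 2 := by
  obtain ⟨q, hq, p, hp, rfl⟩ := V.exists_add_mem_mem_orthogonal v
  have hQv := norm_map_add_sq_le hQ hV hVτ hq hp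
  have hcross := re_inner_map_add_le hQ hW hQW hq hp
  have hWv : ‖W (q + p)‖ ^ 2 ≤ w ^ 2 * ‖q + p‖ ^ 2 := by
    rw [← mul_pow]
    exact pow_le_pow_left₀ (norm_nonneg _) (hW _) 2
  have hκ : 0 < 1 - τ ^ 2 := by nlinarith
  set κ := 1 - τ ^ 2
  have hyoung : 4 * w * ‖p‖ * ‖q + p‖ ≤ κ * ‖p‖ ^ 2 + 4 / κ * w ^ 2 * ‖q + p‖ ^ 2 := by
    have hsquare : κ * ‖p‖ ^ 2 + 4 / κ * w ^ 2 * ‖q + p‖ ^ 2 - 4 * w * ‖p‖ * ‖q + p‖ =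
        (κ * ‖p‖ - 2 * w * ‖q + p‖) ^ 2 / κ := by
      field_simp
      ring
    have hnonneg : 0 ≤ (κ * ‖p‖ - 2 * w * ‖q + p‖) ^ 2 / κ := by positivity
    linarith
  rw [norm_add_sq (𝕜 := 𝕜)]
  linarith

end Contraction

variable {Q Xs : Tensor n₁ n₂ n} [∀ j, NeZero (n j)]

theorem IsCertificate.sliceBound_add (h : IsCertificate Q Xs) {τ : ℝ} (hτ0 : 0 ≤ τ) (hτ : τ < 1)
    (hker : ∀ i, ∀ v ∈ (slice i Xs).ker, ‖slice i Q v‖ ≤ τ * ‖v‖) {W : Tensor n₁ n₂ n}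
    (hW : W ∈ (faceSpan Q Xs)ᗮ) :
    SliceBound (Q + W) (1 + (1 + 4 / (1 - τ ^ 2)) * numSlices n * ‖W‖ ^ 2) := by
  intro i v
  have hκ : 0 < 1 - τ ^ 2 := by nlinarith
  have hsq := norm_map_add_map_sq_le (h.norm_apply_le i) (fun x hx => h.norm_apply_eq hx) hτ0 hτ
    (fun x hx => hker i x (by rwa [Submodule.orthogonal_orthogonal] at hx))
    (sliceBound_sqrt_mul_norm W i)
    (fun x hx => re_inner_eq_zero_of_mem_faceSpan_orthogonal hW hx) v
  rw [mul_pow, Real.sq_sqrt (Nat.cast_nonneg _), ← mul_assoc] at hsq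
  rw [map_add, LinearMap.add_apply]
  refine le_of_sq_le_sq (hsq.trans ?_) (by positivity)
  rw [mul_pow]
  gcongr
  set c := (1 + 4 / (1 - τ ^ 2)) * numSlices n * ‖W‖ ^ 2
  have hc : 0 ≤ c := by positivity
  nlinarith

/-- Test `X` against the functionals `Q + t W` of `sliceBound_add` and optimize over `t`. -/
theorem IsCertificate.exists_norm_sq_le_mul_inner (h : IsCertificate Q Xs) {τ : ℝ} (hτ0 : 0 ≤ τ)
    (hτ : τ < 1) (hker : ∀ i, ∀ v ∈ (slice i Xs).ker, ‖slice i Q v‖ ≤ τ * ‖v‖) :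
    ∃ C : ℝ, 0 < C ∧ ∀ X ∈ ball n₁ n₂ n, ∃ W ∈ (faceSpan Q Xs)ᗮ,
      X - Xs - W ∈ faceSpan Q Xs ∧ ‖W‖ ^ 2 ≤ C * ⟪Q, Xs - X⟫_ℝ := by
  have hN : (0 : ℝ) < numSlices n := Nat.cast_pos.2 numSlices_pos
  have hκ : 0 < 1 - τ ^ 2 := by nlinarith
  obtain ⟨C, hC⟩ : ∃ C, C = (1 + 4 / (1 - τ ^ 2)) * (numSlices n : ℝ) := ⟨_, rfl⟩
  have hC0 : 0 < C := by rw [hC]; positivity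
  refine ⟨4 * C, by positivity, fun X hX => ?_⟩
  obtain ⟨Z, hZ, W, hW, hXZ⟩ := (faceSpan Q Xs).exists_add_mem_mem_orthogonal X
  refine ⟨W, hW, ?_, ?_⟩
  · rw [hXZ, sub_right_comm, add_sub_cancel_right]
    exact Submodule.sub_mem _ hZ h.mem_faceSpan
  let t : ℝ := 1 / (2 * C)
  have hWX : ⟪W, X⟫_ℝ = ‖W‖ ^ 2 := by
    rw [hXZ, inner_add_right, (Submodule.mem_orthogonal' _ _).1 hW Z hZ,
      real_inner_self_eq_norm_sq, zero_add]
  have htest : ⟪Q, X⟫_ℝ + t * ‖W‖ ^ 2 ≤ 1 + C * (t ^ 2 * ‖W‖ ^ 2) := by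
    calc ⟪Q, X⟫_ℝ + t * ‖W‖ ^ 2 = ⟪Q + t • W, X⟫_ℝ := by
          rw [inner_add_left, real_inner_smul_left, hWX]
      _ ≤ (1 + C * ‖t • W‖ ^ 2) * tnn X := inner_le_of_sliceBound
          (hC ▸ h.sliceBound_add hτ0 hτ hker (Submodule.smul_mem _ t hW))
      _ ≤ 1 + C * ‖t • W‖ ^ 2 := mul_le_of_le_one_right (by positivity) hX
      _ = 1 + C * (t ^ 2 * ‖W‖ ^ 2) := by rw [norm_smul, mul_pow, Real.norm_eq_abs, sq_abs]
  have hopt : t * ‖W‖ ^ 2 - C * (t ^ 2 * ‖W‖ ^ 2) = ‖W‖ ^ 2 / (4 * C) := by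
    simp only [t]
    field_simp
    ring
  rw [inner_sub_right, h.inner_eq, ← div_le_iff₀' (by positivity), ← hopt]
  linarith

end TransversalGrowth

section FaceInterior

section Span

variable {𝕜 E F : Type*} [RCLike 𝕜] [NormedAddCommGroup E] [NormedAddCommGroup F]

theorem exists_abs_inner_le_of_mem_span [InnerProductSpace ℝ E] {s t : Set E} {z : E}
    (hs : ∀ x ∈ s, ∃ C, ∀ u ∈ t, |⟪u, x⟫_ℝ| ≤ C * ⟪u, z⟫_ℝ) {x : E}
    (hx : x ∈ Submodule.span ℝ s) : ∃ C, ∀ u ∈ t, |⟪u, x⟫_ℝ| ≤ C * ⟪u, z⟫_ℝ := by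
  induction hx using Submodule.span_induction with
  | mem x hx => exact hs x hx
  | zero => exact ⟨0, by simp⟩
  | add x y _ _ hx hy =>
    obtain ⟨C, hC⟩ := hx
    obtain ⟨D, hD⟩ := hy
    refine ⟨C + D, fun u hu => ?_⟩
    rw [inner_add_right, add_mul]
    exact (abs_add_le _ _).trans (add_le_add (hC u hu) (hD u hu))
  | smul c x _ hx =>
    obtain ⟨C, hC⟩ := hx
    refine ⟨|c| * C, fun u hu => ?_⟩
    rw [inner_smul_right, abs_mul, mul_assoc]
    exact mul_le_mul_of_nonneg_left (hC u hu) (abs_nonneg c)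

variable [InnerProductSpace 𝕜 E] [InnerProductSpace 𝕜 F]

/-- By the parallelogram identity a nonnegative quadratic form satisfies
`φ (x + y) ≤ 2 φ x + 2 φ y`, so uniform bounds pass from a spanning set to its span. -/
theorem exists_re_inner_le_of_mem_span {κ : Type*} {t : Set κ} {L : κ → E →ₗ[𝕜] F} {Q : E →ₗ[𝕜] F}
    {m : κ → ℝ} {s : Set E} (hpos : ∀ k ∈ t, ∀ x ∈ Submodule.span 𝕜 s, 0 ≤ RCLike.re ⟪L k x, Q x⟫_𝕜)
    (hs : ∀ x ∈ s, ∃ C, ∀ k ∈ t, RCLike.re ⟪L k x, Q x⟫_𝕜 ≤ C * m k) {x : E}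
    (hx : x ∈ Submodule.span 𝕜 s) : ∃ C, ∀ k ∈ t, RCLike.re ⟪L k x, Q x⟫_𝕜 ≤ C * m k := by
  induction hx using Submodule.span_induction with
  | mem x hx => exact hs x hx
  | zero => exact ⟨0, by simp⟩
  | add x y hxs hys hx hy =>
    obtain ⟨C, hC⟩ := hx
    obtain ⟨D, hD⟩ := hy
    refine ⟨2 * C + 2 * D, fun k hk => ?_⟩
    have hparallelogram : RCLike.re ⟪L k (x + y), Q (x + y)⟫_𝕜 +
        RCLike.re ⟪L k (x - y), Q (x - y)⟫_𝕜 =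
          2 * RCLike.re ⟪L k x, Q x⟫_𝕜 + 2 * RCLike.re ⟪L k y, Q y⟫_𝕜 := by
      simp only [map_add, map_sub, inner_add_left, inner_add_right, inner_sub_left,
        inner_sub_right]
      ring
    linarith [hC k hk, hD k hk, hpos k hk _ (Submodule.sub_mem _ hxs hys)]
  | smul c x _ hx =>
    obtain ⟨C, hC⟩ := hx
    refine ⟨‖c‖ ^ 2 * C, fun k hk => ?_⟩
    rw [map_smul, map_smul, inner_smul_left, inner_smul_right, ← mul_assoc, RCLike.conj_mul,
      ← RCLike.ofReal_pow, RCLike.re_ofReal_mul, mul_assoc]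
    exact mul_le_mul_of_nonneg_left (hC k hk) (by positivity)

end Span

variable {Q Xs : Tensor n₁ n₂ n} [∀ j, NeZero (n j)]

namespace IsCertificate

theorem re_inner_nonneg (h : IsCertificate Q Xs) {D : Tensor n₁ n₂ n}
    (hD : SliceBound (Q - D) 1) {i : SliceIdx n} {x : EuclideanSpace ℂ (Fin n₂)}
    (hx : x ∈ (slice i Xs).kerᗮ) : 0 ≤ RCLike.re ⟪slice i D x, slice i Q x⟫_ℂ := by
  have hsplit : RCLike.re ⟪slice i D x, slice i Q x⟫_ℂ =
      ‖slice i Q x‖ ^ 2 - RCLike.re ⟪slice i (Q - D) x, slice i Q x⟫_ℂ := by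
    rw [map_sub, LinearMap.sub_apply, inner_sub_left, map_sub, inner_self_eq_norm_sq,
      sub_sub_cancel]
  have hle : RCLike.re ⟪slice i (Q - D) x, slice i Q x⟫_ℂ ≤ ‖x‖ * ‖slice i Q x‖ :=
    (re_inner_le_norm _ _).trans <| by gcongr; simpa using hD i x
  rw [hsplit, sub_nonneg, sq]
  rwa [h.norm_apply_eq hx] at hle ⊢

theorem singularValues_mul_re_inner_le (h : IsCertificate Q Xs)
    {b : SliceIdx n → OrthonormalBasis (Fin n₂) ℂ (EuclideanSpace ℂ (Fin n₂))}
    (hb : ∀ i, IsRightSVBasis (slice i Xs) (slice i Xs).singularValues (b i))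
    {D : Tensor n₁ n₂ n} (hD : SliceBound (Q - D) 1) (i : SliceIdx n) (j : Fin n₂) :
    (slice i Xs).singularValues j * RCLike.re ⟪slice i D (b i j), slice i Q (b i j)⟫_ℂ ≤
      numSlices n * ⟪D, Xs⟫_ℝ := by
  have hN : (numSlices n : ℝ) ≠ 0 := Nat.cast_ne_zero.2 numSlices_pos.ne'
  let φ (i : SliceIdx n) (j : Fin n₂) : ℝ :=
    (slice i Xs).singularValues j * RCLike.re ⟪slice i D (b i j), slice i Q (b i j)⟫_ℂ
  have hφ (i : SliceIdx n) (j : Fin n₂) : 0 ≤ φ i j := by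
    rcases eq_or_ne ((slice i Xs).singularValues j) 0 with h0 | h0
    · simp only [φ, h0, zero_mul, le_refl]
    · exact mul_nonneg (LinearMap.singularValues_nonneg _ _)
        (h.re_inner_nonneg hD ((hb i).mem_ker_orthogonal h0))
  calc φ i j ≤ ∑ j, φ i j := Finset.single_le_sum (fun j _ => hφ i j) (Finset.mem_univ j)
    _ ≤ ∑ i, ∑ j, φ i j := Finset.single_le_sum (f := fun i => ∑ j, φ i j)
        (fun i _ => Finset.sum_nonneg fun j _ => hφ i j) (Finset.mem_univ i)
    _ = numSlices n * ⟪D, Xs⟫_ℝ := by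
        rw [h.inner_eq_sum hb D, ← mul_assoc, mul_one_div_cancel hN, one_mul]
        rfl

theorem exists_re_inner_le (h : IsCertificate Q Xs) {i : SliceIdx n}
    {x : EuclideanSpace ℂ (Fin n₂)} (hx : x ∈ (slice i Xs).kerᗮ) :
    ∃ C, ∀ D, SliceBound (Q - D) 1 →
      RCLike.re ⟪slice i D x, slice i Q x⟫_ℂ ≤ C * ⟪D, Xs⟫_ℝ := by
  choose b hb using fun i => exists_isRightSVBasis (slice i Xs) finrank_euclideanSpace_fin
  refine exists_re_inner_le_of_mem_span (t := {D | SliceBound (Q - D) 1})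
    (fun D hD x hx => h.re_inner_nonneg hD (Submodule.span_le.2 ?_ hx)) ?_
    ((hb i).ker_orthogonal_le_span hx)
  · rintro _ ⟨j, hj, rfl⟩
    exact (hb i).mem_ker_orthogonal hj
  · rintro _ ⟨j, hj, rfl⟩
    have hpos := (LinearMap.singularValues_nonneg (slice i Xs) j).lt_of_ne' hj
    refine ⟨numSlices n / (slice i Xs).singularValues j, fun D hD => ?_⟩
    rw [div_mul_eq_mul_div, le_div_iff₀' hpos]
    exact h.singularValues_mul_re_inner_le hb hD i j

theorem exists_abs_inner_le (h : IsCertificate Q Xs) {Z : Tensor n₁ n₂ n}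
    (hZ : Z ∈ faceSpan Q Xs) :
    ∃ C, ∀ D, SliceBound (Q - D) 1 → |⟪D, Z⟫_ℝ| ≤ C * ⟪D, Xs⟫_ℝ := by
  refine exists_abs_inner_le_of_mem_span (t := {D | SliceBound (Q - D) 1}) ?_ hZ
  rintro _ ⟨i, x, hx, rfl⟩
  obtain ⟨C, hC⟩ := h.exists_re_inner_le hx
  refine ⟨1 / numSlices n * C, fun D hD => ?_⟩
  have hnonneg : 0 ≤ (⟪slice i D x, slice i Q x⟫_ℂ).re := h.re_inner_nonneg hD hx
  rw [inner_rankOneTensor, abs_of_nonneg (by positivity), mul_assoc]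
  exact mul_le_mul_of_nonneg_left (hC D hD) (by positivity)

theorem exists_add_smul_mem_ball (h : IsCertificate Q Xs) {Z : Tensor n₁ n₂ n}
    (hZ : Z ∈ faceSpan Q Xs) (hQZ : ⟪Q, Z⟫_ℝ = 0) :
    ∃ ε : ℝ, 0 < ε ∧ Xs + ε • Z ∈ ball n₁ n₂ n := by
  obtain ⟨C, hC⟩ := h.exists_abs_inner_le hZ
  refine ⟨1 / (|C| + 1), by positivity, (mem_ball_iff _).2 fun Y hY => ?_⟩
  have hgap : 0 ≤ ⟪Q - Y, Xs⟫_ℝ := by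
    rw [inner_sub_left, h.inner_eq]
    linarith [(mem_ball_iff Xs).1 h.mem Y hY]
  have hYZ : ⟪Y, Z⟫_ℝ ≤ (|C| + 1) * ⟪Q - Y, Xs⟫_ℝ := calc
    ⟪Y, Z⟫_ℝ = -⟪Q - Y, Z⟫_ℝ := by rw [inner_sub_left, hQZ, zero_sub, neg_neg]
    _ ≤ C * ⟪Q - Y, Xs⟫_ℝ :=
      (neg_le_abs _).trans (hC _ (by rwa [sub_sub_cancel]))
    _ ≤ (|C| + 1) * ⟪Q - Y, Xs⟫_ℝ := by gcongr; linarith [le_abs_self C]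
  rw [inner_add_right, inner_smul_right, one_div_mul_eq_div]
  calc ⟪Y, Xs⟫_ℝ + ⟪Y, Z⟫_ℝ / (|C| + 1) ≤ ⟪Y, Xs⟫_ℝ + ⟪Q - Y, Xs⟫_ℝ := by
        gcongr
        exact (div_le_iff₀' (by positivity)).2 hYZ
    _ = 1 := by rw [← inner_add_left, add_sub_cancel, h.inner_eq]

end IsCertificate

end FaceInterior

section Growth

theorem sliceBound_sval_bdiag (X : Tensor n₁ n₂ n) : SliceBound X (sval (bdiag X) 0) :=
  norm_apply_le_singularValues_blockDiagonal_mul (fslice X)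

theorem sval_bdiag_zero_le {X : Tensor n₁ n₂ n} {c : ℝ} (hc : 0 ≤ c) (hX : SliceBound X c) :
    sval (bdiag X) 0 ≤ c :=
  singularValues_le _ hc ⊤ (by rw [finrank_top, add_zero])
    fun w _ => norm_blockDiagonal_apply_le hc hX w

theorem sval_bdiag_smul_le (c : ℝ) (X : Tensor n₁ n₂ n) (j : ℕ) :
    sval (bdiag (c • X)) j ≤ |c| * sval (bdiag X) j := by
  have hbdiag : bdiag (c • X) = (c : ℂ) • bdiag X := by
    rw [bdiag, bdiag, ← Matrix.blockDiagonal_smul]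
    exact congrArg _ (funext fun i => fslice_smul c X i)
  rw [hbdiag, sval, map_smul, ← Real.norm_eq_abs, ← Complex.norm_real]
  exact singularValues_smul_le _ _ _

theorem sliceBound_smul {X : Tensor n₁ n₂ n} {c : ℝ} (hX : SliceBound X c) (a : ℝ) :
    SliceBound (a • X) (|a| * c) := by
  intro i x
  rw [map_smul, LinearMap.smul_apply, norm_smul, Real.norm_eq_abs, mul_assoc]
  exact mul_le_mul_of_nonneg_left (hX i x) (abs_nonneg a)

variable [∀ j, NeZero (n j)]

theorem smul_rankOneTensor_mem_ball {c : ℝ} (hc : 0 ≤ c) (i : SliceIdx n)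
    {u : EuclideanSpace ℂ (Fin n₁)} {v : EuclideanSpace ℂ (Fin n₂)}
    (huv : c * (‖u‖ * ‖v‖) ≤ numSlices n) : c • rankOneTensor i u v ∈ ball n₁ n₂ n := by
  have hN : (0 : ℝ) < numSlices n := Nat.cast_pos.2 numSlices_pos
  refine (mem_ball_iff _).2 fun Y hY => ?_
  have hle : (⟪slice i Y v, u⟫_ℂ).re ≤ ‖u‖ * ‖v‖ := calc
    (⟪slice i Y v, u⟫_ℂ).re ≤ ‖slice i Y v‖ * ‖u‖ := re_inner_le_norm (𝕜 := ℂ) _ _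
    _ ≤ ‖u‖ * ‖v‖ := by
      rw [mul_comm]
      gcongr
      simpa using hY i v
  rw [inner_smul_right, inner_rankOneTensor, mul_left_comm, one_div, inv_mul_le_iff₀ hN, mul_one]
  exact (mul_le_mul_of_nonneg_left hle hc).trans huv

/-- The extreme points of the unit ball are multiples of rank-one tensors, so the functionals
bounded by `c` on the ball are those whose slices have operator norm at most `c`. -/
theorem sliceBound_of_forall_inner_le {Y : Tensor n₁ n₂ n} {c : ℝ}
    (h : ∀ X ∈ ball n₁ n₂ n, ⟪Y, X⟫_ℝ ≤ c) : SliceBound Y c := by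
  have hN : (numSlices n : ℝ) ≠ 0 := Nat.cast_ne_zero.2 numSlices_pos.ne'
  intro i v
  rcases eq_or_ne v 0 with rfl | hv
  · simp
  rcases eq_or_ne (slice i Y v) 0 with hYv | hYv
  · have hc : 0 ≤ c := by simpa using h 0 zero_mem_ball
    rw [hYv, norm_zero]
    positivity
  have hv' : 0 < ‖v‖ := norm_pos_iff.2 hv
  have hle := h _ (smul_rankOneTensor_mem_ball (c := numSlices n / (‖slice i Y v‖ * ‖v‖))
    (by positivity) i (div_mul_cancel₀ _ (by positivity)).le)
  have hself : (⟪slice i Y v, slice i Y v⟫_ℂ).re = ‖slice i Y v‖ ^ 2 :=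
    inner_self_eq_norm_sq (𝕜 := ℂ) _
  rw [inner_smul_right, inner_rankOneTensor, hself] at hle
  rw [← div_le_iff₀ hv']
  refine le_of_eq_of_le ?_ hle
  field_simp

theorem isCertificate_of_inner_nonneg {G Xs : Tensor n₁ n₂ n} (hXs : Xs ∈ ball n₁ n₂ n)
    (hG : ∀ X ∈ ball n₁ n₂ n, 0 ≤ ⟪G, X - Xs⟫_ℝ) (hσ : 0 < sval (bdiag G) 0) :
    IsCertificate (-(1 / sval (bdiag G) 0) • G) Xs := by
  set σ := sval (bdiag G) 0 with hσdef
  have hbound : SliceBound (-(1 / σ) • G) 1 := by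
    have hG := sliceBound_smul (sliceBound_sval_bdiag G) (-(1 / σ))
    rwa [abs_neg, abs_of_pos (by positivity), ← hσdef, one_div_mul_cancel hσ.ne'] at hG
  have hneg : SliceBound (-G) ⟪-G, Xs⟫_ℝ := sliceBound_of_forall_inner_le fun X hX => by
    have hGX := hG X hX
    rw [inner_sub_right] at hGX
    rw [inner_neg_left, inner_neg_left]
    linarith
  have hle : σ ≤ ⟪-G, Xs⟫_ℝ := by
    refine sval_bdiag_zero_le ?_ fun i x => ?_
    · simpa using hG 0 zero_mem_ball
    · simpa using hneg i x
  refine ⟨hXs, hbound, le_antisymm ((mem_ball_iff Xs).1 hXs _ hbound) ?_⟩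
  rw [neg_smul, ← smul_neg, real_inner_smul_left, one_div, le_inv_mul_iff₀ hσ, mul_one]
  exact hle

end Growth

section QuadraticGrowth

theorem exists_norm_sq_le_of_injOn {E F : Type*} [NormedAddCommGroup E] [NormedSpace ℝ E]
    [FiniteDimensional ℝ E] [NormedAddCommGroup F] [NormedSpace ℝ F] {L : E →ₗ[ℝ] F}
    {V : Submodule ℝ E} (hV : ∀ Z ∈ V, L Z = 0 → Z = 0) :
    ∃ c : ℝ, 0 < c ∧ ∀ D W, D - W ∈ V → ‖D‖ ^ 2 ≤ c * (‖L D‖ ^ 2 + ‖W‖ ^ 2) := by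
  obtain ⟨K, -, hanti⟩ := (L ∘ₗ V.subtype).exists_antilipschitzWith <|
    LinearMap.ker_eq_bot'.2 fun Z hZ => Subtype.ext (hV Z Z.2 hZ)
  set M := ‖L.toContinuousLinearMap‖
  refine ⟨2 * (K ^ 2 + (K * M + 1) ^ 2), by positivity, fun D W hDW => ?_⟩
  have hDW' : ‖D - W‖ ≤ K * ‖L (D - W)‖ :=
    ZeroHomClass.bound_of_antilipschitz _ hanti (⟨D - W, hDW⟩ : V)
  have hL : ‖L (D - W)‖ ≤ ‖L D‖ + M * ‖W‖ := by
    rw [map_sub]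
    exact (norm_sub_le _ _).trans (by gcongr; exact L.toContinuousLinearMap.le_opNorm W)
  have hD : ‖D‖ ≤ K * ‖L D‖ + (K * M + 1) * ‖W‖ := calc
    ‖D‖ ≤ ‖D - W‖ + ‖W‖ := by simpa using norm_add_le (D - W) W
    _ ≤ K * (‖L D‖ + M * ‖W‖) + ‖W‖ := by gcongr; exact hDW'.trans (by gcongr)
    _ = K * ‖L D‖ + (K * M + 1) * ‖W‖ := by ring
  calc ‖D‖ ^ 2 ≤ (K * ‖L D‖ + (K * M + 1) * ‖W‖) ^ 2 := by gcongr
    _ ≤ (K ^ 2 + (K * M + 1) ^ 2) * (2 * (‖L D‖ ^ 2 + ‖W‖ ^ 2)) := by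
        nlinarith [sq_nonneg (K * ‖W‖ - (K * M + 1) * ‖L D‖),
          mul_nonneg (by positivity : 0 ≤ (K : ℝ) ^ 2 + (K * M + 1) ^ 2)
            (by positivity : 0 ≤ ‖L D‖ ^ 2 + ‖W‖ ^ 2)]
    _ = 2 * (K ^ 2 + (K * M + 1) ^ 2) * (‖L D‖ ^ 2 + ‖W‖ ^ 2) := by ring

variable {Q Xs : Tensor n₁ n₂ n} {f : Tensor n₁ n₂ n → ℝ}

theorem IsUniqueMinimizer.isMinOn (hopt : IsUniqueMinimizer f Xs) :
    IsMinOn f (ball n₁ n₂ n) Xs := by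
  refine isMinOn_iff.2 fun Y hY => ?_
  rcases eq_or_ne Y Xs with rfl | hne
  · rfl
  · exact (hopt.2 Y hY hne).le

variable [∀ j, NeZero (n j)]

theorem IsCertificate.inner_sub_nonneg (h : IsCertificate Q Xs) {X : Tensor n₁ n₂ n}
    (hX : X ∈ ball n₁ n₂ n) : 0 ≤ ⟪Q, Xs - X⟫_ℝ := by
  rw [inner_sub_right, h.inner_eq]
  linarith [(mem_ball_iff X).1 hX Q h.bound]

theorem IsCertificate.inner_sub_le_two (h : IsCertificate Q Xs) {X : Tensor n₁ n₂ n}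
    (hX : X ∈ ball n₁ n₂ n) : ⟪Q, Xs - X⟫_ℝ ≤ 2 := by
  have hneg := (mem_ball_iff X).1 hX (-Q) fun i x => by simpa using h.bound i x
  rw [inner_neg_left] at hneg
  rw [inner_sub_right, h.inner_eq]
  linarith

section Face

variable {F : Type*} {g : F → ℝ} {C : Tensor n₁ n₂ n}

/-- Along `Z` the function `f` is affine with vanishing slope, while `Z` points into the face. -/
theorem IsUniqueMinimizer.eq_zero_of_mem_faceSpan [AddCommGroup F] [Module ℝ F]
    {A : Tensor n₁ n₂ n →ₗ[ℝ] F} (hopt : IsUniqueMinimizer f Xs) (h : IsCertificate Q Xs)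
    (hf : ∀ X, f X = g (A X) + ⟪C, X⟫_ℝ) (hd : Differentiable ℝ f) {Z : Tensor n₁ n₂ n}
    (hZ : Z ∈ faceSpan Q Xs) (hAZ : A Z = 0) (hQZ : ⟪Q, Z⟫_ℝ = 0) (hGZ : ⟪∇ f Xs, Z⟫_ℝ = 0) :
    Z = 0 := by
  obtain ⟨ε, hε, hmem⟩ := h.exists_add_smul_mem_ball hZ hQZ
  have hline (t : ℝ) : f (Xs + t • Z) = f Xs + t * ⟪C, Z⟫_ℝ := by
    rw [hf, hf, map_add, map_smul, hAZ, smul_zero, add_zero, inner_add_right, inner_smul_right]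
    ring
  have hderiv := hasDerivAt_line hd Xs Z 0
  rw [zero_smul, add_zero, hGZ] at hderiv
  have hCZ : ⟪C, Z⟫_ℝ = 0 := by
    refine HasDerivAt.unique (f := fun t : ℝ => f (Xs + t • Z)) ?_ hderiv
    simp only [hline]
    simpa using ((hasDerivAt_id (0 : ℝ)).mul_const ⟪C, Z⟫_ℝ).const_add (f Xs)
  by_contra hne
  have hlt := hopt.2 _ hmem (by simpa using ⟨hε.ne', hne⟩)
  rw [hline, hCZ, mul_zero, add_zero] at hlt
  exact lt_irrefl _ hlt

variable [NormedAddCommGroup F] [NormedSpace ℝ F] {A : Tensor n₁ n₂ n →ₗ[ℝ] F} {α σ : ℝ}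

theorem IsCertificate.exists_quadraticGrowth (h : IsCertificate Q Xs)
    (hrank : sval (bdiag Q) (bdiag Xs).rank < 1) (hσ : 0 < σ) (hQ : ∇ f Xs = -(σ • Q))
    (hf : ∀ X, f X = g (A X) + ⟪C, X⟫_ℝ) (hα : 0 < α) (hg : StrongConvexOn Set.univ α g)
    (hd : Differentiable ℝ f) (hopt : IsUniqueMinimizer f Xs) :
    ∃ γ : ℝ, 0 < γ ∧ QuadraticGrowth f Xs γ := by
  obtain ⟨C₁, hC₁, htransversal⟩ := h.exists_norm_sq_le_mul_inner (sval_nonneg _ _) hrank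
    fun i v hv => h.norm_apply_le_of_mem_ker hv
  obtain ⟨c, hc, hface⟩ := exists_norm_sq_le_of_injOn (V := faceSpan Q Xs)
    (L := A.prod (innerSL ℝ Q).toLinearMap) fun Z hZ hLZ => by
      obtain ⟨hAZ, hQZ⟩ : A Z = 0 ∧ ⟪Q, Z⟫_ℝ = 0 := Prod.mk_eq_zero.1 hLZ
      refine hopt.eq_zero_of_mem_faceSpan h hf hd hZ hAZ hQZ ?_
      rw [hQ, inner_neg_left, real_inner_smul_left, hQZ, mul_zero, neg_zero]
  set κ := min (α / 2) (σ / (2 + C₁))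
  have hκ : 0 < κ := by positivity
  refine ⟨κ / c, by positivity, fun X hX => ?_⟩
  obtain ⟨W, -, hW, hWle⟩ := htransversal X hX
  set ε := ⟪Q, Xs - X⟫_ℝ with hε
  have hε0 : 0 ≤ ε := h.inner_sub_nonneg hX
  have hQX : ⟪Q, X - Xs⟫_ℝ = -ε := by rw [hε, ← inner_neg_right, neg_sub]
  have hL : ‖A.prod (innerSL ℝ Q).toLinearMap (X - Xs)‖ ^ 2 ≤ ‖A (X - Xs)‖ ^ 2 + 2 * ε := by
    change ‖(A (X - Xs), ⟪Q, X - Xs⟫_ℝ)‖ ^ 2 ≤ _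
    rw [Prod.norm_mk, hQX, norm_neg, Real.norm_of_nonneg hε0]
    rcases max_choice ‖A (X - Xs)‖ ε with hmax | hmax <;> rw [hmax] <;>
      nlinarith [h.inner_sub_le_two hX, sq_nonneg ‖A (X - Xs)‖]
  have hdist : ‖X - Xs‖ ^ 2 ≤ c * (‖A (X - Xs)‖ ^ 2 + (2 + C₁) * ε) :=
    (hface _ _ hW).trans (mul_le_mul_of_nonneg_left (by linarith [hL]) hc.le)
  have hlower := add_inner_gradient_add_le hf hg hd Xs X
  rw [hQ, inner_neg_left, real_inner_smul_left, hQX] at hlower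
  calc κ / c * ‖X - Xs‖ ^ 2 ≤ κ / c * (c * (‖A (X - Xs)‖ ^ 2 + (2 + C₁) * ε)) := by gcongr
    _ = κ * ‖A (X - Xs)‖ ^ 2 + κ * (2 + C₁) * ε := by field_simp
    _ ≤ α / 2 * ‖A (X - Xs)‖ ^ 2 + σ * ε := by
        gcongr
        · exact min_le_left _ _
        · exact (le_div_iff₀ (by positivity)).1 (min_le_right _ _)
    _ ≤ f X - f Xs := by linarith

theorem exists_quadraticGrowth (hf : ∀ X, f X = g (A X) + ⟪C, X⟫_ℝ) (hα : 0 < α)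
    (hg : StrongConvexOn Set.univ α g) (hd : Differentiable ℝ f) (hopt : IsUniqueMinimizer f Xs)
    (hgap : sval (bdiag (∇ f Xs)) (bdiag Xs).rank < sval (bdiag (∇ f Xs)) 0) :
    ∃ γ : ℝ, 0 < γ ∧ QuadraticGrowth f Xs γ := by
  have hσ : 0 < sval (bdiag (∇ f Xs)) 0 := (sval_nonneg _ _).trans_lt hgap
  refine (isCertificate_of_inner_nonneg hopt.1 (fun X hX => inner_gradient_nonneg_of_isMinOn hd
    convex_ball hopt.1 hopt.isMinOn hX) hσ).exists_quadraticGrowth ?_ hσ ?_ hf hα hg hd hopt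
  · refine (sval_bdiag_smul_le _ _ _).trans_lt ?_
    rwa [abs_neg, abs_of_pos (by positivity), one_div, inv_mul_lt_iff₀ hσ, mul_one]
  · rw [smul_smul, mul_neg, mul_one_div_cancel hσ.ne', neg_smul, one_smul, neg_neg]

end Face

end QuadraticGrowth

section Multiplicity

section Matrix

variable {p q : Type*} [Fintype p] [Fintype q] [DecidableEq q] {A : Matrix p q ℂ} {m : ℕ}

theorem le_topMult (h : ∀ j < m, sval A j = sval A 0 ∧ sval A j ≠ 0) : m ≤ topMult A := by
  have hfin : {j : ℕ | sval A j = sval A 0 ∧ sval A j ≠ 0}.Finite :=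
    (Matrix.toEuclideanLin A).singularValues.hasFiniteSupport.subset fun _ hj => hj.2
  have hcard := Set.ncard_le_ncard (s := (Finset.range m : Set ℕ))
    (fun j hj => h j (by simpa using hj)) hfin
  rwa [Set.ncard_coe_finset, Finset.card_range] at hcard

theorem topMult_le (h : sval A m < sval A 0) : topMult A ≤ m := by
  have hsub : {j : ℕ | sval A j = sval A 0 ∧ sval A j ≠ 0} ⊆ (Finset.range m : Set ℕ) := by
    intro j hj
    by_contra hmj
    have hle := sval_antitone A (not_lt.1 (by simpa using hmj))
    exact (hj.1 ▸ hle).not_gt h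
  have hcard := Set.ncard_le_ncard hsub (Finset.finite_toSet _)
  rwa [Set.ncard_coe_finset, Finset.card_range] at hcard

end Matrix

variable {G : Tensor n₁ n₂ n}

theorem topMult_le_maxTopMult (i : SliceIdx n) : topMult (fslice G i) ≤ maxTopMult G :=
  Finset.le_sup (f := fun i : SliceIdx n => topMult (fslice G i)) (Finset.mem_univ i)

theorem sval_fslice_le_sval_bdiag (i : SliceIdx n) (j : ℕ) :
    sval (fslice G i) j ≤ sval (bdiag G) 0 :=
  (sval_antitone _ (Nat.zero_le j)).trans <|
    singularValues_le (slice i G) (sval_nonneg _ _) ⊤ (by simp) fun x _ =>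
      sliceBound_sval_bdiag G i x

theorem sval_fslice_le_sub_genGap (i : SliceIdx n) (j : ℕ) :
    sval (fslice G i) j ≤ sval (bdiag G) 0 - genGap G j := by
  rw [genGap, sub_sub_cancel]
  exact le_ciSup (f := fun i : SliceIdx n => sval (fslice G i) j) (Set.finite_range _).bddAbove i

theorem genGap_pos [∀ j, NeZero (n j)] (hσ : 0 < sval (bdiag G) 0) {r : ℕ}
    (hr : maxTopMult G ≤ r) : 0 < genGap G r := by
  obtain ⟨i, hi⟩ := exists_eq_ciSup_of_finite (f := fun i : SliceIdx n => sval (fslice G i) r)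
  rw [genGap, sub_pos, ← hi]
  by_contra! hle
  have heq (j : ℕ) (hj : j ≤ r) : sval (fslice G i) j = sval (bdiag G) 0 :=
    (sval_fslice_le_sval_bdiag i j).antisymm (hle.trans (sval_antitone _ hj))
  have hmult : r + 1 ≤ topMult (fslice G i) := le_topMult fun j hj => by
    rw [heq j (Nat.lt_succ_iff.1 hj), heq 0 (Nat.zero_le r)]
    exact ⟨rfl, hσ.ne'⟩
  exact hmult.not_gt ((topMult_le_maxTopMult i).trans hr |>.trans_lt (Nat.lt_succ_self r))

end Multiplicity

section LocalTruncation

section FrobeniusEstimates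

variable {𝕜 E F : Type*} [RCLike 𝕜] [NormedAddCommGroup F] [InnerProductSpace 𝕜 F]

theorem sub_norm_le_re_inner_smul_add {q d : F} (hq : ‖q‖ = 1) (a : ℝ) :
    a - ‖d‖ ≤ RCLike.re ⟪q, (a : 𝕜) • q + d⟫_𝕜 := by
  have hd : -‖d‖ ≤ RCLike.re ⟪q, d⟫_𝕜 := by
    have hle := (RCLike.abs_re_le_norm ⟪q, d⟫_𝕜).trans (norm_inner_le_norm q d)
    rw [hq, one_mul] at hle
    exact (abs_le.1 hle).1
  rw [inner_add_right, inner_smul_right, map_add, RCLike.re_ofReal_mul, inner_self_eq_norm_sq, hq]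
  linarith

theorem starProjection_span_image_apply {κ : Type*} [Fintype κ] [DecidableEq κ]
    [NormedAddCommGroup E] [InnerProductSpace 𝕜 E] [FiniteDimensional 𝕜 E]
    (b : OrthonormalBasis κ 𝕜 E) (K : Finset κ) (j : κ) :
    (Submodule.span 𝕜 (b '' K)).starProjection (b j) = if j ∈ K then b j else 0 := by
  split_ifs with hj
  · exact Submodule.starProjection_eq_self_iff.2 (Submodule.subset_span ⟨j, hj, rfl⟩)
  · rw [Submodule.starProjection_apply_eq_zero_iff]
    have hle : Submodule.span 𝕜 (b '' K) ≤ (𝕜 ∙ b j)ᗮ := Submodule.span_le.2 <| by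
      rintro _ ⟨l, hl, rfl⟩
      exact Submodule.mem_orthogonal_singleton_iff_inner_right.2
        (b.orthonormal.2 fun h => hj (h ▸ hl))
    exact fun x hx => Submodule.mem_orthogonal_singleton_iff_inner_left.1 (hle hx)

theorem sum_norm_apply_le [NormedAddCommGroup E] [InnerProductSpace 𝕜 E] [FiniteDimensional 𝕜 E]
    [FiniteDimensional 𝕜 F] {ι : Type*} [Fintype ι] (T : E →ₗ[𝕜] F)
    (b : OrthonormalBasis ι 𝕜 E) (s : Finset ι) :
    ∑ j ∈ s, ‖T (b j)‖ ≤ √(s.card : ℝ) * √(frobInner T T) := by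
  rw [← Real.sqrt_mul (Nat.cast_nonneg _)]
  refine Real.le_sqrt_of_sq_le (sq_sum_le_card_mul_sum_sq.trans ?_)
  rw [frobInner_self_eq_sum T b]
  gcongr
  exact Finset.subset_univ s

end FrobeniusEstimates

section SoftThreshold

variable {Q T : EuclideanSpace ℂ (Fin n₂) →ₗ[ℂ] EuclideanSpace ℂ (Fin n₁)}

theorem IsDiagIn.frobInner_le {c : ℕ → ℝ}
    {u : OrthonormalBasis (Fin n₁) ℂ (EuclideanSpace ℂ (Fin n₁))}
    {v : OrthonormalBasis (Fin n₂) ℂ (EuclideanSpace ℂ (Fin n₂))} (hT : IsDiagIn T c u v)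
    (hc : ∀ j, 0 ≤ c j) (hQ : ∀ x, ‖Q x‖ ≤ ‖x‖) :
    frobInner Q T ≤ ∑ j ∈ Finset.range (min n₁ n₂), c j := by
  rw [frobInner_eq_sum Q T v, ← sum_fin_ite_lt]
  refine Finset.sum_le_sum fun j _ => ?_
  rw [hT j]
  split_ifs with hj
  · refine (re_inner_le_norm (𝕜 := ℂ) _ _).trans ?_
    rw [norm_smul, u.norm_eq_one, mul_one, RCLike.norm_of_nonneg (hc j)]
    exact mul_le_of_le_one_left (hc j) (by simpa using hQ (v j))
  · simp

/-- Soft-thresholding splits `T` into a part with trace norm `∑ max 0 (σ_j - s)` and a remainder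
with operator norm at most `s`. -/
theorem sum_re_inner_map_le (hQ : ∀ x, ‖Q x‖ ≤ ‖x‖)
    (b : OrthonormalBasis (Fin n₂) ℂ (EuclideanSpace ℂ (Fin n₂))) (K : Finset (Fin n₂)) {s : ℝ}
    (hs : 0 ≤ s) : ∑ j ∈ K, RCLike.re ⟪Q (b j), T (b j)⟫_ℂ ≤
      ∑ j ∈ Finset.range (min n₁ n₂), max 0 (T.singularValues j - s) + K.card * s := by
  obtain ⟨u, v, hT⟩ := exists_isDiagIn T
  obtain ⟨Z, hZ⟩ : ∃ Z, IsDiagIn Z (fun j => max 0 (T.singularValues j - s)) u v :=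
    ⟨_, (isDiagIn_iff _ _ u v).2 rfl⟩
  have hTZ := (hT.sub hZ).norm_apply_le hs fun j _ =>
    abs_sub_softThreshold_le (T.singularValues_nonneg j) hs
  let Pr := (Submodule.span ℂ (b '' K)).starProjection
  have hfrob : frobInner (Q ∘ₗ Pr.toLinearMap) Z = ∑ j ∈ K, RCLike.re ⟪Q (b j), Z (b j)⟫_ℂ := by
    rw [frobInner_eq_sum _ _ b, ← Finset.univ_inter K, ← Finset.sum_ite_mem]
    refine Finset.sum_congr rfl fun j _ => ?_
    rw [LinearMap.comp_apply, ContinuousLinearMap.coe_coe, starProjection_span_image_apply]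
    split_ifs <;> simp
  have hmain : ∑ j ∈ K, RCLike.re ⟪Q (b j), Z (b j)⟫_ℂ ≤
      ∑ j ∈ Finset.range (min n₁ n₂), max 0 (T.singularValues j - s) :=
    hfrob ▸ hZ.frobInner_le (fun j => le_max_left _ _) fun x =>
      (hQ _).trans (Submodule.norm_starProjection_apply_le _ x)
  have hrest (j : Fin n₂) (_ : j ∈ K) :
      RCLike.re ⟪Q (b j), T (b j)⟫_ℂ ≤ RCLike.re ⟪Q (b j), Z (b j)⟫_ℂ + s := by
    have hsplit : T (b j) = Z (b j) + (T - Z) (b j) := by simp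
    rw [hsplit, inner_add_right, map_add]
    gcongr
    calc RCLike.re ⟪Q (b j), (T - Z) (b j)⟫_ℂ ≤ ‖Q (b j)‖ * ‖(T - Z) (b j)‖ := re_inner_le_norm _ _
      _ ≤ 1 * s := by
          gcongr
          · simpa using hQ (b j)
          · simpa using hTZ (b j)
      _ = s := one_mul s
  calc ∑ j ∈ K, RCLike.re ⟪Q (b j), T (b j)⟫_ℂ
      ≤ ∑ j ∈ K, (RCLike.re ⟪Q (b j), Z (b j)⟫_ℂ + s) := Finset.sum_le_sum hrest
    _ = ∑ j ∈ K, RCLike.re ⟪Q (b j), Z (b j)⟫_ℂ + K.card * s := by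
        rw [Finset.sum_add_distrib, Finset.sum_const, nsmul_eq_mul]
    _ ≤ _ := by gcongr

end SoftThreshold

theorem card_filter_singularValues_pos
    (T : EuclideanSpace ℂ (Fin n₂) →ₗ[ℂ] EuclideanSpace ℂ (Fin n₁)) :
    (Finset.univ.filter fun j : Fin n₂ => 0 < T.singularValues j).card = finrank ℂ T.range := by
  have hle : finrank ℂ T.range ≤ n₂ := by simpa using T.finrank_range_le
  simpa only [T.singularValues_pos_iff_lt_finrank_range, Fin.card_filter_val_lt,
    min_eq_right_iff] using hle

variable {Q Xs : Tensor n₁ n₂ n} [∀ j, NeZero (n j)]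

namespace IsCertificate

theorem one_le_singularValues (h : IsCertificate Q Xs) {i : SliceIdx n} {j : ℕ}
    (hj : j < finrank ℂ (slice i Xs).range) : 1 ≤ (slice i Q).singularValues j := by
  rw [← LinearMap.finrank_range_adjoint, ← LinearMap.orthogonal_ker] at hj
  exact le_singularValues _ _ hj fun x hx => by rw [one_mul, h.norm_apply_eq hx]

theorem singularValues_add_smul_le (h : IsCertificate Q Xs) {κ : ℝ} (hκ : 0 < κ) {i : SliceIdx n}
    {j : ℕ} (hj : (slice i Q).singularValues j < 1) :
    (slice i (Xs + κ • Q)).singularValues j ≤ κ * (slice i Q).singularValues j := by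
  rcases le_or_gt (finrank ℂ (EuclideanSpace ℂ (Fin n₂))) j with hjn | hjn
  · rw [LinearMap.singularValues_of_finrank_le _ hjn]
    exact mul_nonneg hκ.le (LinearMap.singularValues_nonneg _ _)
  obtain ⟨S, hS, hSle⟩ := exists_submodule_singularValues_mul_le (slice i (Xs + κ • Q)) hjn
  set c := (slice i (Xs + κ • Q)).singularValues j
  have hc : 0 ≤ c / κ := div_nonneg (LinearMap.singularValues_nonneg _ _) hκ.le
  have hmin := min_one_le_singularValues (h.norm_apply_le i) (fun x => h.norm_apply_eq (x := x))
    (by omega : j < finrank ℂ S) hc fun y hy => by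
      have hker : slice i Xs y = 0 := by
        rw [Submodule.orthogonal_orthogonal] at hy
        exact hy.2
      have hle := hSle y hy.1
      rw [map_add, map_smul, LinearMap.add_apply, hker, zero_add, LinearMap.smul_apply, norm_smul,
        Real.norm_of_nonneg hκ.le] at hle
      rw [div_mul_eq_mul_div, div_le_iff₀' hκ]
      exact hle
  have hle := (min_le_iff.1 hmin).resolve_left hj.not_ge
  rwa [div_le_iff₀' hκ] at hle

theorem sum_singularValues_add_le (h : IsCertificate Q Xs) (P : Tensor n₁ n₂ n) (κ : ℝ) {s : ℝ}
    (hs : 0 ≤ s) (i : SliceIdx n) :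
    ∑ j : Fin n₂, (slice i Xs).singularValues j + finrank ℂ (slice i Xs).range * (κ - s) -
        √(finrank ℂ (slice i Xs).range) *
          √(frobInner (slice i (P - (Xs + κ • Q))) (slice i (P - (Xs + κ • Q)))) ≤
      ∑ j ∈ Finset.range (min n₁ n₂), max 0 (sval (fslice P i) j - s) := by
  obtain ⟨b, hb⟩ := exists_isRightSVBasis (slice i Xs) finrank_euclideanSpace_fin
  set D := P - (Xs + κ • Q) with hD
  set K := Finset.univ.filter fun j : Fin n₂ => 0 < (slice i Xs).singularValues j with hK
  have hterm (j : Fin n₂) (hj : j ∈ K) : (slice i Xs).singularValues j + κ - ‖slice i D (b j)‖ ≤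
      RCLike.re ⟪slice i Q (b j), slice i P (b j)⟫_ℂ := by
    have hpos : 0 < (slice i Xs).singularValues j := (Finset.mem_filter.1 hj).2
    have hQb : ‖slice i Q (b j)‖ = 1 := by
      rw [h.norm_apply_eq (hb.mem_ker_orthogonal hpos.ne'), b.norm_eq_one]
    have hP : slice i P (b j) = (((slice i Xs).singularValues j + κ : ℝ) : ℂ) • slice i Q (b j) +
        slice i D (b j) := by
      have hsplit : P = Xs + κ • Q + D := by rw [hD]; abel
      rw [hsplit, map_add, map_add, map_smul, LinearMap.add_apply, LinearMap.add_apply,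
        hb.apply_eq_smul_of_frobInner_eq (h.norm_apply_le i) (h.frobInner_eq i) j]
      push_cast
      rw [add_smul]
      rfl
    rw [hP]
    exact sub_norm_le_re_inner_smul_add hQb _
  have hsum : ∑ j ∈ K, (slice i Xs).singularValues j =
      ∑ j : Fin n₂, (slice i Xs).singularValues j :=
    Finset.sum_subset (Finset.subset_univ _) fun j _ hj =>
      le_antisymm (by simpa [hK] using hj) (LinearMap.singularValues_nonneg _ _)
  have hlower := Finset.sum_le_sum hterm
  have hupper := sum_re_inner_map_le (T := slice i P) (h.norm_apply_le i) b K hs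
  have hnorm := sum_norm_apply_le (slice i D) b K
  rw [Finset.sum_sub_distrib, Finset.sum_add_distrib, Finset.sum_const, nsmul_eq_mul, hsum]
    at hlower
  rw [card_filter_singularValues_pos] at hlower hupper hnorm
  simp only [sval_fslice]
  linarith

theorem le_thresholdSum (h : IsCertificate Q Xs) (P : Tensor n₁ n₂ n) (κ : ℝ) {r : ℕ}
    (hr : r ≤ min n₁ n₂) {s : ℝ} (hs : ∀ i, sval (fslice P i) r ≤ s) :
    numSlices n + (∑ i, (finrank ℂ (slice i Xs).range : ℝ)) * (κ - s) -
      ∑ i, √(finrank ℂ (slice i Xs).range) *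
        √(frobInner (slice i (P - (Xs + κ • Q))) (slice i (P - (Xs + κ • Q)))) ≤
      thresholdSum r P s := by
  have hN : (numSlices n : ℝ) = ∑ i, ∑ j : Fin n₂, (slice i Xs).singularValues j := by
    rw [← inv_numSlices_mul_eq_one_iff.1 (tnn_eq Xs ▸ h.tnn_eq_one)]
  rw [thresholdSum_eq_of_sval_le hr hs, hN, Finset.sum_mul, ← Finset.sum_add_distrib,
    ← Finset.sum_sub_distrib]
  exact Finset.sum_le_sum fun i _ =>
    h.sum_singularValues_add_le P κ ((sval_nonneg _ _).trans (hs i)) i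

end IsCertificate

end LocalTruncation

section LocalEquivalence

section PerturbationSize

variable [∀ j, NeZero (n j)]

theorem sqrt_sum_frobInner_self (D : Tensor n₁ n₂ n) :
    √(∑ i, frobInner (slice i D) (slice i D)) = √(numSlices n) * ‖D‖ := by
  rw [sum_frobInner_self, Real.sqrt_mul (Nat.cast_nonneg _), Real.sqrt_sq (norm_nonneg D)]

theorem sqrt_frobInner_self_le (D : Tensor n₁ n₂ n) (i : SliceIdx n) :
    √(frobInner (slice i D) (slice i D)) ≤ √(numSlices n) * ‖D‖ := by
  rw [← sqrt_sum_frobInner_self]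
  exact Real.sqrt_le_sqrt (Finset.single_le_sum
    (f := fun i => frobInner (slice i D) (slice i D)) (fun _ _ => frobInner_self_nonneg _)
    (Finset.mem_univ i))

end PerturbationSize

theorem singularValues_slice_smul_le (c : ℝ) (X : Tensor n₁ n₂ n) (i : SliceIdx n) (j : ℕ) :
    (slice i (c • X)).singularValues j ≤ |c| * sval (fslice X i) j := by
  have hle := singularValues_smul_le (c : ℂ) (slice i X) j
  rwa [Complex.norm_real, Real.norm_eq_abs, Complex.coe_smul, ← map_smul] at hle

theorem rank_bdiag_le (X : Tensor n₁ n₂ n) :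
    (bdiag X).rank ≤ ∑ i, finrank ℂ (slice i X).range := by
  rw [rank_bdiag, ← Module.finrank_pi_fintype ℂ]
  let L : (Matrix.toEuclideanLin (bdiag X)).range →ₗ[ℂ] ((i : SliceIdx n) → (slice i X).range) :=
    LinearMap.pi fun i => (blockProj i ∘ₗ Submodule.subtype _).codRestrict _ <| by
      rintro ⟨_, w, rfl⟩
      exact ⟨blockProj i w, (blockProj_blockDiagonal_apply (fslice X) i w).symm⟩
  refine LinearMap.finrank_le_finrank_of_injective (f := L) fun y z hyz => ?_
  ext ⟨a, i⟩
  exact congrArg (fun w => (w i : EuclideanSpace ℂ (Fin n₁)) a) hyz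

theorem sub_smul_eq_add_smul {E : Type*} [AddCommGroup E] [Module ℝ E] (x g : E) (η : ℝ) {σ : ℝ}
    (hσ : σ ≠ 0) : x - η • g = x + (η * σ) • (-(1 / σ) • g) := by
  rw [smul_smul, mul_neg, mul_assoc, mul_one_div_cancel hσ, mul_one, neg_smul, sub_eq_add_neg]

variable {G Xs : Tensor n₁ n₂ n}

theorem topMult_bdiag_pos (hσ : 0 < sval (bdiag G) 0) : 0 < topMult (bdiag G) :=
  le_topMult fun j hj => by
    obtain rfl : j = 0 := by omega
    exact ⟨rfl, hσ.ne'⟩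

theorem topMult_bdiag_le_sum_finrank
    (hgap : sval (bdiag G) (bdiag Xs).rank < sval (bdiag G) 0) :
    topMult (bdiag G) ≤ ∑ i, finrank ℂ (slice i Xs).range :=
  (topMult_le hgap).trans (rank_bdiag_le Xs)

theorem exists_radius_eq (β : ℝ) {r : ℕ} (hμ : 1 ≤ maxTopMult G) (hr : maxTopMult G ≤ r)
    (hgap : 0 < genGap G r) :
    ∃ j ≤ r, 0 < genGap G j ∧ radius β G r = 1 / (2 * β * √(numSlices n)) *
      (genGap G j / (1 / √((r - j : ℕ) + 1 : ℝ) +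
        √((maxTopMult G : ℝ) * nnzb G) / topMult (bdiag G))) := by
  set c := √((maxTopMult G : ℝ) * nnzb G) / topMult (bdiag G) with hc
  rcases le_total (genGap G (r - maxTopMult G + 1) / (1 / √(maxTopMult G : ℝ) + c))
    (genGap G r / (1 + c)) with hle | hle
  · refine ⟨r, le_rfl, hgap, ?_⟩
    rw [radius, ← hc, max_eq_left hle]
    simp
  · have : (0 : ℝ) < maxTopMult G := Nat.cast_pos.2 hμ
    have hpos : 0 < genGap G (r - maxTopMult G + 1) / (1 / √(maxTopMult G : ℝ) + c) :=
      (by positivity : 0 < genGap G r / (1 + c)).trans_le hle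
    refine ⟨r - maxTopMult G + 1, by omega,
      (div_pos_iff_of_pos_right (by positivity)).1 hpos, ?_⟩
    have hsub : r - (r - maxTopMult G + 1) = maxTopMult G - 1 := by omega
    rw [radius, ← hc, max_eq_right hle, hsub, Nat.cast_sub hμ, Nat.cast_one, sub_add_cancel]

variable [∀ j, NeZero (n j)]

namespace IsCertificate

section SubgradientRank

variable (h : IsCertificate (-(1 / sval (bdiag G) 0) • G) Xs) (hσ : 0 < sval (bdiag G) 0)
include h hσ

theorem sval_fslice_eq {i : SliceIdx n} {j : ℕ} (hj : j < finrank ℂ (slice i Xs).range) :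
    sval (fslice G i) j = sval (bdiag G) 0 := by
  refine (sval_fslice_le_sval_bdiag i j).antisymm ?_
  have hle := (h.one_le_singularValues hj).trans (singularValues_slice_smul_le _ G i j)
  rwa [abs_neg, abs_of_pos (by positivity), one_div, le_inv_mul_iff₀ hσ, mul_one] at hle

theorem finrank_range_slice_le (i : SliceIdx n) :
    finrank ℂ (slice i Xs).range ≤ maxTopMult G := by
  refine (le_topMult fun j hj => ?_).trans (topMult_le_maxTopMult i)
  rw [h.sval_fslice_eq hσ hj, h.sval_fslice_eq hσ (Nat.zero_lt_of_lt hj)]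
  exact ⟨rfl, hσ.ne'⟩

theorem finrank_range_slice_eq_zero {i : SliceIdx n} (hi : fslice G i = 0) :
    finrank ℂ (slice i Xs).range = 0 := by
  by_contra h0
  have hzero := h.sval_fslice_eq hσ (Nat.pos_of_ne_zero h0)
  rw [hi, sval, LinearEquiv.map_zero, LinearMap.singularValues_zero] at hzero
  exact hσ.ne hzero

theorem sum_finrank_range_slice_le :
    ∑ i, finrank ℂ (slice i Xs).range ≤ maxTopMult G * nnzb G := by
  classical
  have hcard : nnzb G = (Finset.univ.filter fun i => fslice G i ≠ 0).card := by
    rw [nnzb, Set.ncard_eq_toFinset_card', Set.toFinset_ofPred]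
  rw [hcard, mul_comm, ← smul_eq_mul, ← Finset.sum_const, Finset.sum_filter]
  refine Finset.sum_le_sum fun i _ => ?_
  split_ifs with hi
  · exact h.finrank_range_slice_le hσ i
  · exact (h.finrank_range_slice_eq_zero hσ (not_not.1 hi)).le

theorem sum_sqrt_finrank_mul_sqrt_frobInner_le (D : Tensor n₁ n₂ n) :
    ∑ i, √(finrank ℂ (slice i Xs).range) * √(frobInner (slice i D) (slice i D)) ≤
      √((maxTopMult G : ℝ) * nnzb G) * (√(numSlices n) * ‖D‖) := by
  refine (Real.sum_sqrt_mul_sqrt_le _ (fun i => Nat.cast_nonneg _)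
    fun i => frobInner_self_nonneg _).trans ?_
  rw [sqrt_sum_frobInner_self]
  gcongr
  exact_mod_cast h.sum_finrank_range_slice_le hσ

theorem sval_fslice_le_of_genGap_pos {η : ℝ} (hη : 0 < η) {r j : ℕ} (hj : j ≤ r)
    (hgap : 0 < genGap G j) (P : Tensor n₁ n₂ n) (i : SliceIdx n) :
    sval (fslice P i) r ≤ η * (sval (bdiag G) 0 - genGap G j) +
      1 / √((r - j : ℕ) + 1 : ℝ) * (√(numSlices n) * ‖P - (Xs - η • G)‖) := by
  set σ := sval (bdiag G) 0
  have hQ : (slice i (-(1 / σ) • G)).singularValues j ≤ (σ - genGap G j) / σ := by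
    refine (singularValues_slice_smul_le _ G i j).trans ?_
    rw [abs_neg, abs_of_pos (by positivity), one_div_mul_eq_div]
    gcongr
    exact sval_fslice_le_sub_genGap i j
  have hbase : (slice i (Xs - η • G)).singularValues j ≤ η * (σ - genGap G j) := by
    rw [sub_smul_eq_add_smul Xs G η hσ.ne']
    refine (h.singularValues_add_smul_le (mul_pos hη hσ) (hQ.trans_lt ?_)).trans ?_
    · rw [div_lt_one hσ]
      exact sub_lt_self σ hgap
    · calc η * σ * (slice i (-(1 / σ) • G)).singularValues j
          ≤ η * σ * ((σ - genGap G j) / σ) := by gcongr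
        _ = η * (σ - genGap G j) := by field_simp
  have hpert : (slice i (P - (Xs - η • G))).singularValues (r - j) ≤
      1 / √((r - j : ℕ) + 1 : ℝ) * (√(numSlices n) * ‖P - (Xs - η • G)‖) := by
    rw [one_div, le_inv_mul_iff₀ (by positivity)]
    exact (sqrt_succ_mul_singularValues_le _ _).trans (sqrt_frobInner_self_le _ i)
  have hweyl := singularValues_add_le (slice i (Xs - η • G)) (slice i (P - (Xs - η • G))) j (r - j)
  rw [← map_add, add_sub_cancel, Nat.add_sub_cancel' hj] at hweyl
  exact hweyl.trans (add_le_add hbase hpert)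

theorem exists_numSlices_le_thresholdSum
    (hsc : sval (bdiag G) (bdiag Xs).rank < sval (bdiag G) 0) {η : ℝ} (hη : 0 < η) {r j : ℕ}
    (hr : r ≤ min n₁ n₂) (hj : j ≤ r) (hgap : 0 < genGap G j) {P : Tensor n₁ n₂ n}
    (hP : √(numSlices n) * ‖P - (Xs - η • G)‖ * (1 / √((r - j : ℕ) + 1 : ℝ) +
      √((maxTopMult G : ℝ) * nnzb G) / topMult (bdiag G)) ≤ η * genGap G j) :
    ∃ s, (∀ i, sval (fslice P i) r ≤ s) ∧ (numSlices n : ℝ) ≤ thresholdSum r P s := by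
  have hs := h.sval_fslice_le_of_genGap_pos hσ hη hj hgap P
  refine ⟨_, hs, ?_⟩
  have hsum := h.le_thresholdSum P (η * sval (bdiag G) 0) hr hs
  rw [← sub_smul_eq_add_smul Xs G η hσ.ne'] at hsum
  have herr := h.sum_sqrt_finrank_mul_sqrt_frobInner_le hσ (P - (Xs - η • G))
  have htop : (0 : ℝ) < topMult (bdiag G) := Nat.cast_pos.2 (topMult_bdiag_pos hσ)
  have hrank : (topMult (bdiag G) : ℝ) ≤ ∑ i, (finrank ℂ (slice i Xs).range : ℝ) :=
    mod_cast topMult_bdiag_le_sum_finrank hsc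
  set ρ := ∑ i, (finrank ℂ (slice i Xs).range : ℝ)
  set x := √(numSlices n) * ‖P - (Xs - η • G)‖
  set w := 1 / √((r - j : ℕ) + 1 : ℝ)
  set c := √((maxTopMult G : ℝ) * nnzb G)
  have : 0 ≤ x := by positivity
  have hgain : c * x ≤ ρ * (η * genGap G j - w * x) :=
    calc c * x = topMult (bdiag G) * (c / topMult (bdiag G) * x) := by field_simp
      _ ≤ ρ * (c / topMult (bdiag G) * x) := by gcongr
      _ ≤ ρ * (η * genGap G j - w * x) := by
        gcongr
        linarith
  linarith

end SubgradientRank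

end IsCertificate

theorem isProj_iff_isTruncProj_of_dist_le (hXs : Xs ∈ ball n₁ n₂ n)
    (hG : ∀ X ∈ ball n₁ n₂ n, 0 ≤ ⟪G, X - Xs⟫_ℝ)
    (hsc : sval (bdiag G) (bdiag Xs).rank < sval (bdiag G) 0) {β : ℝ} (hβ : 0 < β) {r : ℕ}
    (hμ : maxTopMult G ≤ r) (hr : r ≤ min n₁ n₂) {P : Tensor n₁ n₂ n}
    (hP : ‖P - (Xs - (1 / β) • G)‖ ≤ 2 * radius β G r) (Z : Tensor n₁ n₂ n) :
    IsProj P Z ↔ IsTruncProj r P Z := by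
  have hN : (0 : ℝ) < numSlices n := Nat.cast_pos.2 numSlices_pos
  have hσ : 0 < sval (bdiag G) 0 := (sval_nonneg _ _).trans_lt hsc
  have h := isCertificate_of_inner_nonneg hXs hG hσ
  have hμ1 : 1 ≤ maxTopMult G := by
    by_contra! h0
    have hle := (topMult_bdiag_le_sum_finrank hsc).trans (h.sum_finrank_range_slice_le hσ)
    rw [Nat.lt_one_iff.1 h0, zero_mul] at hle
    exact hle.not_gt (topMult_bdiag_pos hσ)
  obtain ⟨j, hj, hgap, hrad⟩ := exists_radius_eq β hμ1 hμ (genGap_pos hσ hμ)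
  obtain ⟨s, hs, hsum⟩ := h.exists_numSlices_le_thresholdSum hσ hsc (one_div_pos.2 hβ) hr hj hgap <|
    by
      rw [← le_div_iff₀ (by positivity)]
      calc √(numSlices n) * ‖P - (Xs - (1 / β) • G)‖
          ≤ √(numSlices n) * (2 * radius β G r) := by gcongr
        _ = _ := by rw [hrad]; field_simp
  exact isProj_iff_isTruncProj hr hs hsum Z

end LocalEquivalence

section RestartedMethod

section OneEpoch

variable {E : Type*} [NormedAddCommGroup E] [InnerProductSpace ℝ E] [CompleteSpace E]
  {f : E → ℝ} {β γ : ℝ} {B : Set E} {Xs : E} {S : ℕ} {x y : ℕ → E}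

theorem IsFastGradient.mul_sub_le (h : IsFastGradient f β B S x y) (hf : IsConvexSmooth f β)
    (hβ : 0 < β) (hB : Convex ℝ B) (hXs : Xs ∈ B) (hmin : IsMinOn f B Xs) (hγ : 0 ≤ γ)
    (hS : 1 ≤ S) {c : ℝ} (hc : 2 * β * c ≤ γ * ((S : ℝ) + 1) ^ 2) :
    c * (f (x (S + 1)) - f Xs) ≤ γ * ‖x 1 - Xs‖ ^ 2 := by
  have hval : 0 ≤ f (x (S + 1)) - f Xs := sub_nonneg.2 (hmin (h.step S hS le_rfl).1)
  refine le_of_mul_le_mul_left ?_ (by positivity : 0 < 2 * β)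
  calc 2 * β * (c * (f (x (S + 1)) - f Xs))
      = 2 * β * c * (f (x (S + 1)) - f Xs) := by ring
    _ ≤ γ * ((S : ℝ) + 1) ^ 2 * (f (x (S + 1)) - f Xs) := by gcongr
    _ = γ * (((S : ℝ) + 1) ^ 2 * (f (x (S + 1)) - f Xs)) := by ring
    _ ≤ γ * (2 * β * ‖x 1 - Xs‖ ^ 2) :=
      mul_le_mul_of_nonneg_left (h.sub_le hf hβ hB hXs hmin hS le_rfl) hγ
    _ = 2 * β * (γ * ‖x 1 - Xs‖ ^ 2) := by ring

theorem IsFastGradient.norm_sub_le (h : IsFastGradient f β B S x y) (hf : IsConvexSmooth f β)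
    (hβ : 0 < β) (hB : Convex ℝ B) (hXs : Xs ∈ B) (hmin : IsMinOn f B Xs) (hγ : 0 < γ)
    (hqg : ∀ X ∈ B, γ * ‖X - Xs‖ ^ 2 ≤ f X - f Xs) (hS : 1 ≤ S)
    (hβγ : 2 * β ≤ γ * ((S : ℝ) + 1) ^ 2) : ‖x (S + 1) - Xs‖ ≤ ‖x 1 - Xs‖ := by
  have hval := h.mul_sub_le hf hβ hB hXs hmin hγ.le hS (c := 1) (by rwa [mul_one])
  rw [one_mul] at hval
  exact le_of_sq_le_sq (le_of_mul_le_mul_left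
    ((hqg _ (h.step S hS le_rfl).1).trans hval) hγ) (norm_nonneg _)

theorem mul_sq_le_mul_sq_of_sqrt_mul_div_le {a c K : ℝ} (ha : 0 ≤ a) (hc : 0 ≤ c) (hγ : 0 < γ)
    (hK : √a * c / √γ ≤ K) : a * c ^ 2 ≤ γ * K ^ 2 := by
  have hsq := pow_le_pow_left₀ (by positivity) hK 2
  rwa [div_pow, mul_pow, Real.sq_sqrt ha, Real.sq_sqrt hγ.le, div_le_iff₀' hγ] at hsq

theorem sqrt_two_mul_div_le_two (hβ : 0 < β) (hγβ : γ ≤ 2 * Real.exp 1 ^ 2 * β) :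
    √(2 * γ) / (√β * Real.exp 1) ≤ 2 := by
  rw [div_le_iff₀ (by positivity)]
  refine Real.sqrt_le_iff.2 ⟨by positivity, ?_⟩
  rw [mul_pow, mul_pow, Real.sq_sqrt hβ.le]
  linarith

end OneEpoch

variable {f : Tensor n₁ n₂ n → ℝ} {β γ : ℝ} {K : ℕ} {X₁ Xs : Tensor n₁ n₂ n}
  {X : ℕ → Tensor n₁ n₂ n} {x y : ℕ → ℕ → Tensor n₁ n₂ n}
  {p q : Tensor n₁ n₂ n → Tensor n₁ n₂ n → Prop}

theorem exists_isRestartedFGM (hp : ∀ P, ∃ Z, p P Z) (f : Tensor n₁ n₂ n → ℝ) (β : ℝ) (K : ℕ)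
    (X₁ : Tensor n₁ n₂ n) : ∃ X x y, IsRestartedFGM p f β K X₁ X x y := by
  choose π hπ using hp
  let inner (X : Tensor n₁ n₂ n) (s : ℕ) : Tensor n₁ n₂ n × Tensor n₁ n₂ n :=
    Nat.rec (X, X) (fun s w =>
      let z := π (w.2 - (1 / β) • ∇ f w.2)
      (z, z + ((theta (s + 1) - 1) / theta (s + 2)) • (z - w.1))) s
  let outer (t : ℕ) : Tensor n₁ n₂ n := Nat.rec X₁ (fun _ X => (inner X K).1) t
  refine ⟨fun t => outer (t - 1), fun t s => (inner (outer (t - 1)) (s - 1)).1,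
    fun t s => (inner (outer (t - 1)) (s - 1)).2, rfl, fun _ _ => rfl, fun _ _ => rfl,
    fun t _ s hs _ => ?_, fun t _ s hs _ => ?_, fun t ht => ?_⟩
  · obtain ⟨s, rfl⟩ := Nat.exists_eq_add_of_le' hs
    exact hπ _
  · obtain ⟨s, rfl⟩ := Nat.exists_eq_add_of_le' hs
    rfl
  · obtain ⟨t, rfl⟩ := Nat.exists_eq_add_of_le' ht
    rfl

namespace IsRestartedFGM

theorem of_step (h : IsRestartedFGM p f β K X₁ X x y)
    (hq : ∀ t, 1 ≤ t → ∀ s, 1 ≤ s → s ≤ K → q (y t s - (1 / β) • ∇ f (y t s)) (x t (s + 1))) :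
    IsRestartedFGM q f β K X₁ X x y :=
  ⟨h.init, h.restart_x, h.restart_y, hq, h.momentum, h.next⟩

variable [∀ j, NeZero (n j)]

theorem isFastGradient (h : IsRestartedFGM p f β K X₁ X x y) {t : ℕ} (ht : 1 ≤ t)
    (hX : X t ∈ ball n₁ n₂ n) {S : ℕ} (hS : S ≤ K)
    (hstep : ∀ s, 1 ≤ s → s ≤ S → IsProj (y t s - (1 / β) • ∇ f (y t s)) (x t (s + 1))) :
    IsFastGradient f β (ball n₁ n₂ n) S (x t) (y t) where
  init_mem := h.restart_x t ht ▸ hX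
  init_eq := by rw [h.restart_x t ht, h.restart_y t ht]
  step s hs hsS := ⟨(hstep s hs hsS).1, fun _ hW => (hstep s hs hsS).inner_le hW⟩
  momentum s hs hsS := h.momentum t ht s hs (hsS.trans hS)

variable (hf : IsConvexSmooth f β) (hβ : 0 < β) (hXs : Xs ∈ ball n₁ n₂ n)
  (hmin : IsMinOn f (ball n₁ n₂ n) Xs) (hγ : 0 < γ) (hqg : QuadraticGrowth f Xs γ) (hK : 1 ≤ K)

section ExactProjection

include hf hβ hXs hmin hγ hqg hK

theorem mem_and_sub_le_exp_mul (h : IsRestartedFGM IsProj f β K X₁ X x y)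
    (hKγ : 2 * β * Real.exp 1 ^ 2 ≤ γ * ((K : ℝ) + 1) ^ 2) (hX₁ : X₁ ∈ ball n₁ n₂ n)
    {t : ℕ} (ht : 1 ≤ t) : X t ∈ ball n₁ n₂ n ∧
      f (X t) - f Xs ≤ Real.exp (-2 * ((t : ℝ) - 1)) * (f X₁ - f Xs) := by
  induction t, ht using Nat.le_induction with
  | base =>
    rw [h.init]
    exact ⟨hX₁, by simp⟩
  | succ t ht ih =>
    have hfast := h.isFastGradient ht ih.1 le_rfl (h.step t ht)
    have hdec := hfast.mul_sub_le hf hβ convex_ball hXs hmin hγ.le hK hKγ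
    rw [h.restart_x t ht, ← h.next t ht] at hdec
    refine ⟨h.next t ht ▸ (h.step t ht K hK le_rfl).1, ?_⟩
    have hexp : Real.exp (-2 * ((t : ℝ) - 1)) =
        Real.exp 1 ^ 2 * Real.exp (-2 * (((t + 1 : ℕ) : ℝ) - 1)) := by
      rw [← Real.exp_nat_mul, ← Real.exp_add]
      congr 1
      push_cast
      ring
    refine le_of_mul_le_mul_left ?_ (by positivity : 0 < Real.exp 1 ^ 2)
    rw [← mul_assoc, ← hexp]
    exact hdec.trans ((hqg _ ih.1).trans ih.2)

theorem sub_le_exp_mul (h : IsRestartedFGM IsProj f β K X₁ X x y)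
    (hKγ : 2 * β * Real.exp 1 ^ 2 ≤ γ * ((K : ℝ) + 1) ^ 2)
    (hγβ : γ ≤ 2 * Real.exp 1 ^ 2 * β) (hX₁ : X₁ ∈ ball n₁ n₂ n) {t : ℕ} (ht : 1 ≤ t) :
    f (X t) - f Xs ≤
      Real.exp (-(√(2 * γ) / (√β * Real.exp 1)) * ((t : ℝ) - 1)) * (f X₁ - f Xs) := by
  refine (h.mem_and_sub_le_exp_mul hf hβ hXs hmin hγ hqg hK hKγ hX₁ ht).2.trans ?_
  have : 0 ≤ f X₁ - f Xs := sub_nonneg.2 (hmin hX₁)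
  have : (0 : ℝ) ≤ (t : ℝ) - 1 := sub_nonneg.2 (mod_cast ht)
  gcongr
  exact sqrt_two_mul_div_le_two hβ hγβ

end ExactProjection

section LocallyExactProjection

variable {R : ℝ} (hp : ∀ y, ‖y - Xs‖ ≤ R → ∀ Z, p (y - (1 / β) • ∇ f y) Z →
  IsProj (y - (1 / β) • ∇ f y) Z)
include hf hβ hXs hmin hγ hqg hp

theorem norm_sub_le_and_isProj (h : IsRestartedFGM p f β K X₁ X x y) {t : ℕ} (ht : 1 ≤ t)
    (hX : X t ∈ ball n₁ n₂ n) (hR : ‖X t - Xs‖ ≤ R)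
    (hdist : 9 * β * ‖X t - Xs‖ ^ 2 ≤ 2 * γ * R ^ 2) {s : ℕ} (hs : 1 ≤ s) (hsK : s ≤ K) :
    ‖y t s - Xs‖ ≤ R ∧ IsProj (y t s - (1 / β) • ∇ f (y t s)) (x t (s + 1)) := by
  induction s using Nat.strong_induction_on with
  | _ s ih =>
    suffices hy : ‖y t s - Xs‖ ≤ R from ⟨hy, hp _ hy _ (h.step t ht s hs hsK)⟩
    obtain ⟨S, rfl⟩ := Nat.exists_eq_add_of_le' hs
    rcases Nat.eq_zero_or_pos S with rfl | hS
    · rwa [h.restart_y t ht]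
    have hfast := h.isFastGradient ht hX (by omega : S ≤ K) fun s hs hsS =>
      (ih s (by omega) hs (by omega)).2
    rw [← h.restart_x t ht] at hdist
    exact hfast.norm_extrapolation_sub_le hf hβ convex_ball hXs hmin hγ hqg
      ((norm_nonneg _).trans hR) hdist hS

include hK

theorem mem_and_norm_sub_le (h : IsRestartedFGM p f β K X₁ X x y)
    (hKγ : 2 * β ≤ γ * ((K : ℝ) + 1) ^ 2) (hX₁ : X₁ ∈ ball n₁ n₂ n) (hR : ‖X₁ - Xs‖ ≤ R)
    (hdist : 9 * β * ‖X₁ - Xs‖ ^ 2 ≤ 2 * γ * R ^ 2) {t : ℕ} (ht : 1 ≤ t) :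
    X t ∈ ball n₁ n₂ n ∧ ‖X t - Xs‖ ≤ ‖X₁ - Xs‖ := by
  induction t, ht using Nat.le_induction with
  | base =>
    rw [h.init]
    exact ⟨hX₁, le_rfl⟩
  | succ t ht ih =>
    have hsq : 9 * β * ‖X t - Xs‖ ^ 2 ≤ 9 * β * ‖X₁ - Xs‖ ^ 2 := by
      gcongr
      exact ih.2
    have hexact (s : ℕ) (hs : 1 ≤ s) (hsK : s ≤ K) := (h.norm_sub_le_and_isProj hf hβ hXs hmin hγ
      hqg hp ht ih.1 (ih.2.trans hR) (hsq.trans hdist) hs hsK).2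
    have hnorm := (h.isFastGradient ht ih.1 le_rfl hexact).norm_sub_le hf hβ convex_ball hXs hmin
      hγ hqg hK hKγ
    rw [← h.next t ht, h.restart_x t ht] at hnorm
    exact ⟨h.next t ht ▸ (hexact K hK le_rfl).1, hnorm.trans ih.2⟩

theorem norm_extrapolation_sub_le (h : IsRestartedFGM p f β K X₁ X x y)
    (hKγ : 2 * β ≤ γ * ((K : ℝ) + 1) ^ 2) (hX₁ : X₁ ∈ ball n₁ n₂ n) (hR : ‖X₁ - Xs‖ ≤ R)
    (hdist : 9 * β * ‖X₁ - Xs‖ ^ 2 ≤ 2 * γ * R ^ 2) {t s : ℕ} (ht : 1 ≤ t) (hs : 1 ≤ s)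
    (hsK : s ≤ K) : ‖y t s - Xs‖ ≤ R := by
  obtain ⟨hX, hle⟩ := h.mem_and_norm_sub_le hf hβ hXs hmin hγ hqg hK hp hKγ hX₁ hR hdist ht
  refine (h.norm_sub_le_and_isProj hf hβ hXs hmin hγ hqg hp ht hX (hle.trans hR) ?_ hs hsK).1
  have hsq : 9 * β * ‖X t - Xs‖ ^ 2 ≤ 9 * β * ‖X₁ - Xs‖ ^ 2 := by gcongr
  exact hsq.trans hdist

end LocallyExactProjection

end IsRestartedFGM

variable [∀ j, NeZero (n j)]

theorem isRestartedFGM_isProj_iff (hf : IsConvexSmooth f β) (hβ : 0 < β) (hXs : Xs ∈ ball n₁ n₂ n)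
    (hmin : IsMinOn f (ball n₁ n₂ n) Xs) (hγ : 0 < γ) (hqg : QuadraticGrowth f Xs γ) (hK : 1 ≤ K)
    (hKγ : 2 * β ≤ γ * ((K : ℝ) + 1) ^ 2) {R : ℝ}
    (hp : ∀ y, ‖y - Xs‖ ≤ R → ∀ Z, IsProj (y - (1 / β) • ∇ f y) Z ↔ p (y - (1 / β) • ∇ f y) Z)
    (hX₁ : X₁ ∈ ball n₁ n₂ n) (hR : ‖X₁ - Xs‖ ≤ R)
    (hdist : 9 * β * ‖X₁ - Xs‖ ^ 2 ≤ 2 * γ * R ^ 2) :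
    IsRestartedFGM IsProj f β K X₁ X x y ↔ IsRestartedFGM p f β K X₁ X x y := by
  refine ⟨fun h => h.of_step fun t ht s hs hsK => (hp _ ?_ _).1 (h.step t ht s hs hsK),
    fun h => h.of_step fun t ht s hs hsK => (hp _ ?_ _).2 (h.step t ht s hs hsK)⟩
  · exact h.norm_extrapolation_sub_le hf hβ hXs hmin hγ hqg hK (fun _ _ _ => id) hKγ hX₁ hR hdist
      ht hs hsK
  · exact h.norm_extrapolation_sub_le hf hβ hXs hmin hγ hqg hK (fun y hy Z => (hp y hy Z).2) hKγ
      hX₁ hR hdist ht hs hsK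

end RestartedMethod

section ParameterBounds

variable {β γ d R : ℝ}

theorem mul_sq_le_mul_sq_of_le_sqrt_two_mul_min (hβ : 0 < β) (hγ : 0 < γ) (hd : 0 ≤ d)
    (hR : 0 ≤ R) (h : d ≤ √2 * min γ √γ / (3 * √β) * R) : 9 * β * d ^ 2 ≤ 2 * γ * R ^ 2 := by
  have hroot : 3 * √β * d ≤ √2 * √γ * R := by
    calc 3 * √β * d ≤ 3 * √β * (√2 * √γ / (3 * √β) * R) := by
          gcongr
          refine h.trans ?_
          gcongr
          exact min_le_right _ _
      _ = √2 * √γ * R := by field_simp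
  calc 9 * β * d ^ 2 = (3 * √β * d) ^ 2 := by
        rw [mul_pow, mul_pow, Real.sq_sqrt hβ.le]
        norm_num
    _ ≤ (√2 * √γ * R) ^ 2 := by gcongr
    _ = 2 * γ * R ^ 2 := by
        rw [mul_pow, mul_pow, Real.sq_sqrt hγ.le, Real.sq_sqrt zero_le_two]

theorem le_two_mul_of_mul_sq_le (hβ : 0 < β) (hγβ : γ ≤ 2 * Real.exp 1 ^ 2 * β) (hR : 0 ≤ R)
    (h : 9 * β * d ^ 2 ≤ 2 * γ * R ^ 2) : d ≤ 2 * R := by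
  have hexp : Real.exp 1 ≤ 3 := Real.exp_one_lt_three.le
  refine le_of_sq_le_sq (le_of_mul_le_mul_left ?_ (by positivity : 0 < 9 * β)) (by positivity)
  calc 9 * β * d ^ 2 ≤ 2 * (2 * Real.exp 1 ^ 2 * β) * R ^ 2 := h.trans (by gcongr)
    _ ≤ 2 * (2 * 3 ^ 2 * β) * R ^ 2 := by gcongr
    _ = 9 * β * (2 * R) ^ 2 := by ring

theorem one_le_of_sqrt_mul_exp_div_le {K : ℕ} (hβ : 0 < β) (hγ : 0 < γ)
    (hK : √(2 * β) * Real.exp 1 / √γ ≤ K) : 1 ≤ K :=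
  Nat.cast_pos.1 (lt_of_lt_of_le (by positivity) hK)

theorem mul_exp_sq_le_of_sqrt_mul_exp_div_le {K : ℕ} (hβ : 0 ≤ β) (hγ : 0 < γ)
    (hK : √(2 * β) * Real.exp 1 / √γ ≤ K) :
    2 * β * Real.exp 1 ^ 2 ≤ γ * ((K : ℝ) + 1) ^ 2 :=
  mul_sq_le_mul_sq_of_sqrt_mul_div_le (by positivity) (by positivity) hγ
    (hK.trans (le_add_of_nonneg_right zero_le_one))

theorem le_of_mul_exp_sq_le (hβ : 0 ≤ β) (h : 2 * β * Real.exp 1 ^ 2 ≤ d) : 2 * β ≤ d :=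
  (le_mul_of_one_le_right (by positivity)
    (one_le_pow₀ (Real.one_le_exp zero_le_one))).trans h

end ParameterBounds

section Main

variable {f : Tensor n₁ n₂ n → ℝ} {β γ : ℝ} {Xs X₁ : Tensor n₁ n₂ n}

theorem QuadraticGrowth.mono {γ' : ℝ} (h : QuadraticGrowth f Xs γ) (hγ : γ' ≤ γ) :
    QuadraticGrowth f Xs γ' := fun X hX =>
  (mul_le_mul_of_nonneg_right hγ (sq_nonneg _)).trans (h X hX)

theorem IsSmooth.isConvexSmooth {F : Type*} [NormedAddCommGroup F] [NormedSpace ℝ F] {g : F → ℝ}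
    {A : Tensor n₁ n₂ n →ₗ[ℝ] F} {C : Tensor n₁ n₂ n} {α : ℝ} (h : IsSmooth β f)
    (hf : ∀ X, f X = g (A X) + ⟪C, X⟫_ℝ) (hα : 0 ≤ α) (hg : StrongConvexOn Set.univ α g) :
    IsConvexSmooth f β where
  le_apply X Y := (le_add_of_nonneg_right (by positivity)).trans
    (add_inner_gradient_add_le hf hg h.1 X Y)
  apply_le := le_add_inner_gradient_add h.1 h.2

variable [∀ j, NeZero (n j)]

theorem isRestartedFGM_isProj_iff_isTruncProj {K r : ℕ} (hf : IsConvexSmooth f β) (hβ : 0 < β)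
    (hd : Differentiable ℝ f) (hXs : Xs ∈ ball n₁ n₂ n) (hmin : IsMinOn f (ball n₁ n₂ n) Xs)
    (hgap : sval (bdiag (∇ f Xs)) (bdiag Xs).rank < sval (bdiag (∇ f Xs)) 0)
    (hγ : 0 < γ) (hγβ : γ ≤ 2 * Real.exp 1 ^ 2 * β) (hqg : QuadraticGrowth f Xs γ) (hK : 1 ≤ K)
    (hKγ : 2 * β ≤ γ * ((K : ℝ) + 1) ^ 2) (hμ : maxTopMult (∇ f Xs) ≤ r) (hr : r ≤ min n₁ n₂)
    (hX₁ : X₁ ∈ ball n₁ n₂ n)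
    (hdist : ‖X₁ - Xs‖ ≤ √2 * min γ √γ / (3 * √β) * radius β (∇ f Xs) r)
    {X : ℕ → Tensor n₁ n₂ n} {x y : ℕ → ℕ → Tensor n₁ n₂ n} :
    IsRestartedFGM IsProj f β K X₁ X x y ↔ IsRestartedFGM (IsTruncProj r) f β K X₁ X x y := by
  have hR : 0 ≤ radius β (∇ f Xs) r :=
    nonneg_of_mul_nonneg_right ((norm_nonneg _).trans hdist) (by positivity)
  have hsq := mul_sq_le_mul_sq_of_le_sqrt_two_mul_min hβ hγ (norm_nonneg _) hR hdist
  have hlocal (Y : Tensor n₁ n₂ n) (hY : ‖Y - Xs‖ ≤ 2 * radius β (∇ f Xs) r) :=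
    isProj_iff_isTruncProj_of_dist_le hXs
      (fun X hX => inner_gradient_nonneg_of_isMinOn hd convex_ball hXs hmin hX) hgap hβ hμ hr
      ((hf.norm_gradient_step_sub_le hβ Xs Y).trans hY)
  refine isRestartedFGM_isProj_iff hf hβ hXs hmin hγ hqg hK hKγ hlocal hX₁
    (le_two_mul_of_mul_sq_le hβ hγβ hR hsq) (hsq.trans ?_)
  gcongr
  linarith

end Main

end TNN

end

theorem mainTheorem5_general {n₁ n₂ k : ℕ} {n : Fin k → ℕ} (hn : ∀ j, 0 < n j)
    {F : Type*} [NormedAddCommGroup F] [NormedSpace ℝ F]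
    (f : TNN.Tensor n₁ n₂ n → ℝ) (g : F → ℝ) (A : TNN.Tensor n₁ n₂ n →ₗ[ℝ] F)
    (C : TNN.Tensor n₁ n₂ n) (hf : ∀ X, f X = g (A X) + inner ℝ C X)
    (α β : ℝ) (hα : 0 < α) (hβ : 0 < β) (hg : StrongConvexOn Set.univ α g)
    (hsmooth : TNN.IsSmooth β f)
    (Xs : TNN.Tensor n₁ n₂ n) (hopt : TNN.IsUniqueMinimizer f Xs)
    (hgap : TNN.sval (TNN.bdiag (gradient f Xs)) (TNN.bdiag Xs).rank <
      TNN.sval (TNN.bdiag (gradient f Xs)) 0) :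
    (∃ γ : ℝ, 0 < γ ∧ γ ≤ 2 * Real.exp 1 ^ 2 * β ∧ TNN.QuadraticGrowth f Xs γ) ∧
    ∀ γ : ℝ, 0 < γ → γ ≤ 2 * Real.exp 1 ^ 2 * β → TNN.QuadraticGrowth f Xs γ →
    ∀ K : ℕ, √(2 * β) * Real.exp 1 / √γ ≤ K →
    ∀ r : ℕ, TNN.maxTopMult (gradient f Xs) ≤ r → r ≤ min n₁ n₂ →
    ∀ X₁ ∈ TNN.ball n₁ n₂ n,
      ‖X₁ - Xs‖ ≤ √2 * min γ √γ / (3 * √β) * TNN.radius β (gradient f Xs) r →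
      (∃ X x y, TNN.IsRestartedFGM TNN.IsProj f β K X₁ X x y) ∧
      (∀ X x y, TNN.IsRestartedFGM TNN.IsProj f β K X₁ X x y ↔
        TNN.IsRestartedFGM (TNN.IsTruncProj r) f β K X₁ X x y) ∧
      (∀ X x y, TNN.IsRestartedFGM TNN.IsProj f β K X₁ X x y → ∀ t : ℕ, 1 ≤ t →
        f (X t) - f Xs ≤
          Real.exp (-(√(2 * γ) / (√β * Real.exp 1)) * ((t : ℝ) - 1)) * (f X₁ - f Xs)) := by
  have : ∀ j, NeZero (n j) := fun j => ⟨(hn j).ne'⟩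
  have hcs := hsmooth.isConvexSmooth hf hα.le hg
  obtain ⟨γ₀, hγ₀, hqg₀⟩ := TNN.exists_quadraticGrowth hf hα hg hsmooth.1 hopt hgap
  refine ⟨⟨min γ₀ (2 * Real.exp 1 ^ 2 * β), lt_min hγ₀ (by positivity), min_le_right _ _,
    hqg₀.mono (min_le_left _ _)⟩, fun γ hγ hγβ hqg K hK r hμ hr X₁ hX₁ hdist => ?_⟩
  have hK₁ : 1 ≤ K := TNN.one_le_of_sqrt_mul_exp_div_le hβ hγ hK
  have hKexp := TNN.mul_exp_sq_le_of_sqrt_mul_exp_div_le hβ.le hγ hK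
  exact ⟨TNN.exists_isRestartedFGM TNN.exists_isProj f β K X₁,
    fun X x y => TNN.isRestartedFGM_isProj_iff_isTruncProj hcs hβ hsmooth.1 hopt.1 hopt.isMinOn
      hgap hγ hγβ hqg hK₁ (TNN.le_of_mul_exp_sq_le hβ.le hKexp) hμ hr hX₁ hdist,
    fun X x y h t ht => h.sub_le_exp_mul hcs hβ hopt.1 hopt.isMinOn hγ hqg hK₁ hKexp hγβ hX₁ ht⟩

theorem mainTheorem5 {n₁ n₂ k m : ℕ} {n : Fin k → ℕ} (hn : ∀ j, 0 < n j)
    (f : TNN.Tensor n₁ n₂ n → ℝ)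
    (g : EuclideanSpace ℝ (Fin m) → ℝ)
    (A : TNN.Tensor n₁ n₂ n →ₗ[ℝ] EuclideanSpace ℝ (Fin m))
    (C : TNN.Tensor n₁ n₂ n)
    (hf : ∀ X, f X = g (A X) + inner ℝ C X)
    (α β : ℝ) (hα : 0 < α) (hβ : 0 < β)
    (hg : StrongConvexOn Set.univ α g)
    (hsmooth : TNN.IsSmooth β f)
    (Xs : TNN.Tensor n₁ n₂ n)
    (hopt : TNN.IsUniqueMinimizer f Xs)
    (hsc : TNN.StrictComplementarity f Xs) :
    (∃ γ : ℝ, 0 < γ ∧ γ ≤ 2 * Real.exp 1 ^ 2 * β ∧ TNN.QuadraticGrowth f Xs γ) ∧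
    ∀ γ : ℝ, 0 < γ → γ ≤ 2 * Real.exp 1 ^ 2 * β → TNN.QuadraticGrowth f Xs γ →
    ∀ K : ℕ, K = ⌈√(2 * β) * Real.exp 1 / √γ⌉₊ →
    ∀ r : ℕ, TNN.maxTopMult (gradient f Xs) ≤ r → r < min n₁ n₂ →
    ∀ X₁ ∈ TNN.ball n₁ n₂ n,
      ‖X₁ - Xs‖ ≤ √2 * min γ √γ / (3 * √β) * TNN.radius β (gradient f Xs) r →
      (∃ X x y, TNN.IsRestartedFGM TNN.IsProj f β K X₁ X x y) ∧
      (∀ X x y, TNN.IsRestartedFGM TNN.IsProj f β K X₁ X x y ↔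
        TNN.IsRestartedFGM (TNN.IsTruncProj r) f β K X₁ X x y) ∧
      (∀ X x y, TNN.IsRestartedFGM TNN.IsProj f β K X₁ X x y → ∀ t : ℕ, 1 ≤ t →
        f (X t) - f Xs ≤
          Real.exp (-(√(2 * γ) / (√β * Real.exp 1)) * ((t : ℝ) - 1)) * (f X₁ - f Xs)) := by
  obtain ⟨hgrowth, hmethod⟩ := mainTheorem5_general hn f g A C hf α β hα hβ hg hsmooth Xs hopt
    (sub_pos.1 hsc.2)
  exact ⟨hgrowth, fun γ hγ hγβ hqg K hK r hμ hr =>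
    hmethod γ hγ hγβ hqg K (hK ▸ Nat.le_ceil _) r hμ hr.le⟩
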